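/- Let $\mathcal C$ be a rigid C$^*$-tensor category: a C$^*$-tensor category with finite direct sums and subobjects, irreducible unit $\varepsilon$, in which every object is a finite direct sum of irreducible objects and has a conjugate that is both a left and a right dual. Write $(\beta,\alpha)$ for the space of morphisms from $\alpha$ to $\beta$, and denote tensor products by juxtaposition. For every object $\alpha$ choose a standard solution $s_\alpha\in(\alpha\overline\alpha,\varepsilon)$, $t_\alpha\in(\overline\alpha\alpha,\varepsilon)$ of the conjugate equations, let $\operatorname{Tr}_\alpha(X)=t_\alpha^*(1\otimes X)t_\alpha=s_\alpha^*(X\otimes 1)s_\alpha$ be the categorical trace, $d(\alpha)=\operatorname{Tr}_\alpha(1)$, and $(\operatorname{Tr}_\alpha\otimes\mathrm{id})(X)=(t_\alpha^*\otimes1)(1\otimes X)(t_\alpha\otimes 1)$ for $X\in(\alpha\beta,\alpha\gamma)$. Each $(\beta,\alpha)$ is a Hilbert space with $\langle V,W\rangle=\operatorname{Tr}_\alpha(W^*V)$. Let $\operatorname{Irr}(\mathcal C)$ be a set of representatives of the irreducible objects. The tube $*$-algebra of $\mathcal C$ is $\mathcal A=\bigoplus_{i,j,\alpha\in\operatorname{Irr}(\mathcal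 C)}(i\alpha,\alpha j)$ (algebraic direct sum). For an arbitrary object $\beta$, a morphism $V\in(i\beta,\beta j)$ is viewed as the element of $\mathcal A$ whose component in $(i\alpha,\alpha j)$ is $\sum_{U}d(\alpha)(1\otimes U^*)V(U\otimes1)$, with $U$ running over an orthonormal basis of $(\beta,\alpha)$, all other components being zero. The product is $V\cdot W=\delta_{k,k'}(V\otimes 1)(1\otimes W)$ for $V\in(i\alpha,\alpha k)$, $W\in(k'\beta,\beta j)$; the involution is $V^\#=(t_\alpha^*\otimes1\otimes1)(1\otimes V^*\otimes1)(1\otimes1\otimes s_\alpha)$ for $V\in (i\alpha,\alpha j)$; and $p_i$ is the identity in $(i\varepsilon,\varepsilon i)$. A right Hilbert $\mathcal A$-module is a Hilbert space $\mathcal K$ with a $*$-anti-homomorphism $\mathcal A\to B(\mathcal K)$, $V\mapsto(\xi\mapsto\xi\cdot V)$; it is nondegenerate if $\mathcal K\cdot\mathcal A$ has dense linear span. An ind-object $X$ of $\mathcal C$ is a possibly infinite orthogonal direct sum of objects of $\mathcal C$; morphisms of ind-objects are bounded matrices of morphisms. For $i\in\operatorname{Irr}(\mathcal C)$, $(X,i)$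 is the Hilbert space of morphisms $i\to X$ with $\langle\xi,\eta\rangle=\operatorname{Tr}_i(\eta^*\xi)$. A unitary half braiding on $X$ is a family of unitary morphisms $\sigma_\alpha\in(X\alpha,\alpha X)$, $\alpha\in\mathcal C$, with $(1\otimes V)\sigma_\alpha=\sigma_\beta(V\otimes1)$ for all $V\in(\beta,\alpha)$, $\sigma_\varepsilon=\mathrm{id}$ and $\sigma_{\alpha\beta}=(\sigma_\alpha\otimes1)(1\otimes\sigma_\beta)$. Then the following constructions define a natural bijection, up to unitary equivalence, between unitary half braidings on ind-objects of $\mathcal C$ and nondegenerate right Hilbert $\mathcal A$-modules. 1. Let $\sigma$ be a unitary half braiding on $X$, put $\mathcal K_i=(X,i)$ and let $\mathcal K$ be the Hilbert space direct sum of the $\mathcal K_i$, $i\in\operatorname{Irr}(\mathcal C)$. There is a unique right Hilbert $\mathcal A$-module structure on $\mathcal K$ with $$\xi\cdot V=(\operatorname{Tr}_\alpha\otimes\mathrm{id})(\sigma_\alpha^*(\xi\otimes1)V)\in\mathcal K_j\qquad(\xi\in\mathcal K_i,\ V\in(i\alpha,\alpha j),\ i,j,\alpha\in\operatorname{Irr}(\mathcal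 C)).$$ It is nondegenerate, and $\mathcal K\cdot p_i=\mathcal K_i$ for all $i$. 2. Let $\mathcal K$ be a nondegenerate right Hilbert $\mathcal A$-module and put $\mathcal K_i=\mathcal K\cdot p_i$. There is an ind-object $X$ with unitary identifications $(X,i)=\mathcal K_i$ for all $i\in\operatorname{Irr}(\mathcal C)$; and for every such $X$ and every choice of identifications there is a unique unitary half braiding $\sigma$ on $X$ with $$\operatorname{Tr}_{\alpha j}((1\otimes\eta^*)\sigma_\alpha^*(\xi\otimes1)V)=\langle\xi\cdot V,\eta\rangle\qquad(\xi\in\mathcal K_i,\ \eta\in\mathcal K_j,\ V\in(i\alpha,\alpha j),\ i,j,\alpha\in\operatorname{Irr}(\mathcal C)).$$ 3. The constructions are mutually inverse: if $\mathcal K$ is obtained from $(X,\sigma)$ as in 1, then $\sigma$ satisfies the formula in 2 for the canonical identifications $(X,i)=\mathcal K_i$; and if $(X,\sigma)$ is obtained from $\mathcal K$ as in 2, then the identifications $(X,i)=\mathcal K_i$ extend to a unitary isomorphism of right $\mathcal A$-modules from the module obtained from $(X,\sigma)$ as in 1 onto $\mathcal K$. 4. The bijection is natural: if $(X,\sigma)$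 and $(Y,\rho)$ have associated modules $\mathcal K$ and $\mathcal L$ as in 1, then composition, $(X,i)\ni\xi\mapsto T\xi\in(Y,i)$, gives a bijection between the morphisms $T:X\to Y$ with $(T\otimes1)\sigma_\alpha=\rho_\alpha(1\otimes T)$ for all objects $\alpha$ of $\mathcal C$ and the bounded $\mathcal A$-linear operators $\mathcal K\to\mathcal L$; under it, unitary morphisms correspond to unitary operators. -/

import Mathlib

open CategoryTheory MonoidalCategory

set_option linter.unusedSectionVars false
set_option linter.unusedSimpArgs false

universe w w' v u

namespace TubeRep

noncomputable section

open scoped Classical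

/-- A C*-category: a `ℂ`-linear category with an antilinear contravariant involution `dagger`,
identical on objects, and complete norms on the morphism spaces such that the composition is
contractive, the C*-identity `‖f† f‖ = ‖f‖²` holds, and `f† f` is a positive element of the
C*-algebra `End X` for every `f : X ⟶ Y`. In the comments, `g f` denotes the composition that is
written `f ≫ g` in the code, and `(Y, X)` denotes the space of morphisms `X ⟶ Y`. -/
class CStarCategory (C : Type u) [Category.{v} C] [Preadditive C] [Linear ℂ C] where
  /-- the adjoint of a morphism -/
  dagger : ∀ {X Y : C}, (X ⟶ Y) → (Y ⟶ X)
  dagger_dagger : ∀ {X Y : C} (f : X ⟶ Y), dagger (dagger f) = f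
  dagger_comp : ∀ {X Y Z : C} (f : X ⟶ Y) (g : Y ⟶ Z), dagger (f ≫ g) = dagger g ≫ dagger f
  dagger_add : ∀ {X Y : C} (f g : X ⟶ Y), dagger (f + g) = dagger f + dagger g
  dagger_smul : ∀ {X Y : C} (c : ℂ) (f : X ⟶ Y), dagger (c • f) = (starRingEnd ℂ c) • dagger f
  /-- the norm of a morphism -/
  homNorm : ∀ {X Y : C}, (X ⟶ Y) → ℝ
  homNorm_nonneg : ∀ {X Y : C} (f : X ⟶ Y), 0 ≤ homNorm f
  homNorm_eq_zero_iff : ∀ {X Y : C} (f : X ⟶ Y), homNorm f = 0 ↔ f = 0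
  homNorm_add_le : ∀ {X Y : C} (f g : X ⟶ Y), homNorm (f + g) ≤ homNorm f + homNorm g
  homNorm_smul : ∀ {X Y : C} (c : ℂ) (f : X ⟶ Y), homNorm (c • f) = ‖c‖ * homNorm f
  homNorm_complete : ∀ {X Y : C} (x : ℕ → (X ⟶ Y)),
    (∀ ε > 0, ∃ N, ∀ m ≥ N, ∀ n ≥ N, homNorm (x m - x n) < ε) →
      ∃ f : X ⟶ Y, ∀ ε > 0, ∃ N, ∀ n ≥ N, homNorm (x n - f) < ε
  homNorm_comp_le : ∀ {X Y Z : C} (f : X ⟶ Y) (g : Y ⟶ Z),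
    homNorm (f ≫ g) ≤ homNorm f * homNorm g
  homNorm_comp_dagger : ∀ {X Y : C} (f : X ⟶ Y), homNorm (f ≫ dagger f) = homNorm f ^ 2
  comp_dagger_positive : ∀ {X Y : C} (f : X ⟶ Y), ∃ g : X ⟶ X, f ≫ dagger f = g ≫ dagger g

postfix:max "†" => CStarCategory.dagger

section CStar

variable {C : Type u} [Category.{v} C] [Preadditive C] [Linear ℂ C] [CStarCategory C]

open CStarCategory

instance homHasNorm (X Y : C) : Norm (X ⟶ Y) := ⟨homNorm⟩

theorem homNormCore (X Y : C) : NormedSpace.Core ℂ (X ⟶ Y) where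
  norm_nonneg f := homNorm_nonneg f
  norm_smul c f := homNorm_smul c f
  norm_triangle f g := homNorm_add_le f g
  norm_eq_zero_iff f := homNorm_eq_zero_iff f

instance homNormedAddCommGroup (X Y : C) : NormedAddCommGroup (X ⟶ Y) :=
  NormedAddCommGroup.ofCore (homNormCore X Y)

instance homNormedSpace (X Y : C) : NormedSpace ℂ (X ⟶ Y) where
  norm_smul_le c f := (homNorm_smul c f).le

/-- `f† f = 1` and `f f† = 1`. -/
def IsUnitaryHom {X Y : C} (f : X ⟶ Y) : Prop := f ≫ f† = 𝟙 X ∧ f† ≫ f = 𝟙 Y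

/-- An object is irreducible when `End X = ℂ 1 ≠ 0`. -/
def IsIrreducible (X : C) : Prop := ∀ f : X ⟶ X, ∃! c : ℂ, f = c • 𝟙 X

/-- The `v k` with `k ∈ F` are isometries `Y k ⟶ A` with mutually orthogonal ranges. -/
def IsOrthogonalFamily {ι : Type w} (F : Finset ι) {Y : ι → C} {A : C} (v : ∀ k, Y k ⟶ A) : Prop :=
  (∀ k ∈ F, v k ≫ (v k)† = 𝟙 (Y k)) ∧ ∀ k ∈ F, ∀ l ∈ F, k ≠ l → v k ≫ (v l)† = 0

/-- `A` is the orthogonal direct sum of the finite family `Y`, with inclusions `v k`. -/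
def IsDirectSum {ι : Type w} [Fintype ι] {Y : ι → C} {A : C} (v : ∀ k, Y k ⟶ A) : Prop :=
  IsOrthogonalFamily Finset.univ v ∧ ∑ k, (v k)† ≫ v k = 𝟙 A

end CStar

/-- A C*-tensor category: the tensor product is bilinear and compatible with the adjoint, and the
associativity and unit constraints are unitary; moreover there are finite direct sums and
subobjects. -/
class CStarTensorCategory (C : Type u) [Category.{v} C] [Preadditive C] [Linear ℂ C]
    [MonoidalCategory C] [MonoidalPreadditive C] [MonoidalLinear ℂ C] extends CStarCategory C where
  dagger_tensorHom : ∀ {X₁ Y₁ X₂ Y₂ : C} (f : X₁ ⟶ Y₁) (g : X₂ ⟶ Y₂),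
    (f ⊗ₘ g)† = f† ⊗ₘ g†
  unitary_associator : ∀ X Y Z : C, IsUnitaryHom (α_ X Y Z).hom
  unitary_leftUnitor : ∀ X : C, IsUnitaryHom (λ_ X).hom
  unitary_rightUnitor : ∀ X : C, IsUnitaryHom (ρ_ X).hom
  exists_directSum : ∀ X Y : C, ∃ (Z : C) (i : X ⟶ Z) (j : Y ⟶ Z),
    i ≫ i† = 𝟙 X ∧ j ≫ j† = 𝟙 Y ∧ i† ≫ i + j† ≫ j = 𝟙 Z
  exists_subobject : ∀ {X : C} (p : X ⟶ X), p ≫ p = p → p† = p →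
    ∃ (Y : C) (i : Y ⟶ X), i ≫ i† = 𝟙 Y ∧ i† ≫ i = p

section
variable {C : Type u} [Category.{v} C] [Preadditive C] [Linear ℂ C]
    [MonoidalCategory C] [MonoidalPreadditive C] [MonoidalLinear ℂ C] [CStarTensorCategory C]

/-- A solution `(bar, s, t)` of the conjugate equations for `X`. -/
structure ConjugateSolution (X : C) where
  /-- the conjugate object -/
  bar : C
  s : 𝟙_ C ⟶ X ⊗ bar
  t : 𝟙_ C ⟶ bar ⊗ X
  /-- `(t† ⊗ 1)(1 ⊗ s) = 1` on `bar` -/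
  conj_bar : (ρ_ bar).inv ≫ (bar ◁ s) ≫ (α_ bar X bar).inv ≫ (t† ▷ bar) ≫ (λ_ bar).hom = 𝟙 bar
  /-- `(s† ⊗ 1)(1 ⊗ t) = 1` on `X` -/
  conj_obj : (ρ_ X).inv ≫ (X ◁ t) ≫ (α_ X bar X).inv ≫ (s† ▷ X) ≫ (λ_ X).hom = 𝟙 X

/-- A standard solution of the conjugate equations:
`t† (1 ⊗ f) t = s† (f ⊗ 1) s` for all `f ∈ End X`. -/
structure StandardSolution (X : C) extends ConjugateSolution X where
  standard : ∀ f : X ⟶ X, t ≫ (bar ◁ f) ≫ t† = s ≫ (f ▷ bar) ≫ s†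

end

/-- A rigid C*-tensor category: the unit is irreducible, every object is a finite direct sum of
irreducible objects, and every object has a conjugate (a two-sided dual). -/
class RigidCStarTensorCategory (C : Type u) [Category.{v} C] [Preadditive C] [Linear ℂ C]
    [MonoidalCategory C] [MonoidalPreadditive C] [MonoidalLinear ℂ C]
    extends CStarTensorCategory C where
  unit_irreducible : IsIrreducible (𝟙_ C)
  semisimple : ∀ X : C, ∃ (n : ℕ) (Y : Fin n → C) (v : ∀ k, Y k ⟶ X),
    (∀ k, IsIrreducible (Y k)) ∧ IsDirectSum v
  exists_conjugate : ∀ X : C, Nonempty (ConjugateSolution X)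

variable {C : Type u} [Category.{v} C] [Preadditive C] [Linear ℂ C]
    [MonoidalCategory C] [MonoidalPreadditive C] [MonoidalLinear ℂ C] [RigidCStarTensorCategory C]

open CStarCategory CStarTensorCategory RigidCStarTensorCategory

theorem dagger_zero (X Y : C) : (0 : X ⟶ Y)† = 0 := by
  have := dagger_smul (0 : ℂ) (0 : X ⟶ Y)
  simpa using this

theorem dagger_id (X : C) : (𝟙 X)† = 𝟙 X := by
  have := dagger_comp (𝟙 X) ((𝟙 X)†)
  simpa [dagger_dagger] using this.symm

theorem dagger_sum {ι : Type*} (F : Finset ι) {X Y : C} (f : ι → (X ⟶ Y)) :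
    (∑ k ∈ F, f k)† = ∑ k ∈ F, (f k)† := by
  induction F using Finset.induction_on with
  | empty => simp [dagger_zero]
  | insert a F ha ih => rw [Finset.sum_insert ha, Finset.sum_insert ha, dagger_add, ih]

theorem dagger_whiskerLeft (X : C) {Y Z : C} (f : Y ⟶ Z) : (X ◁ f)† = X ◁ f† := by
  rw [← id_tensorHom, dagger_tensorHom, dagger_id, id_tensorHom]

theorem dagger_whiskerRight {Y Z : C} (f : Y ⟶ Z) (X : C) : (f ▷ X)† = f† ▷ X := by
  rw [← tensorHom_id, dagger_tensorHom, dagger_id, tensorHom_id]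

theorem dagger_of_unitary {X Y : C} (e : X ≅ Y) (h : IsUnitaryHom e.hom) : e.hom† = e.inv := by
  rw [← cancel_epi e.hom, h.1, e.hom_inv_id]

theorem dagger_of_unitary' {X Y : C} (e : X ≅ Y) (h : IsUnitaryHom e.hom) : e.inv† = e.hom := by
  rw [← dagger_of_unitary e h, dagger_dagger]

theorem eq_zero_of_comp_dagger {X Y : C} (f : X ⟶ Y) (h : f ≫ f† = 0) : f = 0 := by
  have h1 := homNorm_comp_dagger f
  rw [h, (homNorm_eq_zero_iff (0 : X ⟶ X)).2 rfl] at h1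
  exact (homNorm_eq_zero_iff f).1 (pow_eq_zero_iff two_ne_zero |>.1 h1.symm)

theorem IsIrreducible.id_ne_zero {X : C} (h : IsIrreducible X) : (𝟙 X : X ⟶ X) ≠ 0 := by
  intro h0
  obtain ⟨c, _, hc⟩ := h 0
  have h1 := hc 0 (by simp)
  have h2 := hc 1 (by simp [h0])
  exact one_ne_zero (h2.trans h1.symm)

theorem IsIrreducible.smul_injective {X : C} (h : IsIrreducible X) {a b : ℂ}
    (hab : a • 𝟙 X = b • 𝟙 X) : a = b := by
  obtain ⟨c, _, hc⟩ := h (a • 𝟙 X)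
  rw [hc a rfl, hc b hab]

/-- For `f : X ⟶ Y` with `X` irreducible, `f† f` is a nonnegative multiple of `1`. -/
theorem IsIrreducible.exists_nonneg {X Y : C} (h : IsIrreducible X) (f : X ⟶ Y) :
    ∃ r : ℝ, 0 ≤ r ∧ f ≫ f† = (r : ℂ) • 𝟙 X := by
  obtain ⟨g, hg⟩ := comp_dagger_positive f
  obtain ⟨c, hc, _⟩ := h g
  refine ⟨‖c‖ ^ 2, by positivity, ?_⟩
  rw [hg, hc, dagger_smul, dagger_id, Linear.smul_comp, Linear.comp_smul, Category.id_comp,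
    smul_smul, Complex.mul_conj, Complex.normSq_eq_norm_sq]

/-- The scalar `c` with `f = c • 1`, for an endomorphism `f` of the unit object. -/
def unitScalar (f : 𝟙_ C ⟶ 𝟙_ C) : ℂ := Classical.choose (unit_irreducible (C := C) f).exists

theorem unitScalar_spec (f : 𝟙_ C ⟶ 𝟙_ C) : f = unitScalar f • 𝟙 (𝟙_ C) :=
  Classical.choose_spec (unit_irreducible (C := C) f).exists

theorem unitScalar_eq {f : 𝟙_ C ⟶ 𝟙_ C} {c : ℂ} (h : f = c • 𝟙 (𝟙_ C)) : unitScalar f = c :=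
  (unit_irreducible (C := C)).smul_injective ((unitScalar_spec f).symm.trans h)

theorem unitScalar_add (f g : 𝟙_ C ⟶ 𝟙_ C) :
    unitScalar (f + g) = unitScalar f + unitScalar g :=
  unitScalar_eq (by rw [add_smul, ← unitScalar_spec, ← unitScalar_spec])

theorem unitScalar_smul (c : ℂ) (f : 𝟙_ C ⟶ 𝟙_ C) : unitScalar (c • f) = c * unitScalar f :=
  unitScalar_eq (by rw [mul_smul, ← unitScalar_spec])

theorem unitScalar_dagger (f : 𝟙_ C ⟶ 𝟙_ C) :
    unitScalar (f†) = (starRingEnd ℂ) (unitScalar f) := by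
  apply unitScalar_eq
  conv_lhs => rw [unitScalar_spec f]
  rw [dagger_smul, dagger_id]

variable (C) in
/-- A choice of a standard solution `(bar X, s_X, t_X)` for every object `X`. -/
abbrev StandardSolutions := ∀ X : C, StandardSolution X

namespace StandardSolutions

variable (S : StandardSolutions C)

/-- The categorical trace `Tr_X(f) = t† (1 ⊗ f) t`. -/
def tr (X : C) (f : X ⟶ X) : ℂ :=
  unitScalar ((S X).t ≫ ((S X).bar ◁ f) ≫ (S X).t†)

/-- The categorical dimension `d(X) = Tr_X(1)`. -/
def dim (X : C) : ℂ := S.tr X (𝟙 X)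

/-- The partial trace `(Tr_X ⊗ id)(f) = (t† ⊗ 1)(1 ⊗ f)(t ⊗ 1)` of `f : X ⊗ Y ⟶ X ⊗ Z`. -/
def partialTrace (X : C) {Y Z : C} (f : X ⊗ Y ⟶ X ⊗ Z) : Y ⟶ Z :=
  (λ_ Y).inv ≫ ((S X).t ▷ Y) ≫ (α_ (S X).bar X Y).hom ≫ ((S X).bar ◁ f) ≫
    (α_ (S X).bar X Z).inv ≫ ((S X).t† ▷ Z) ≫ (λ_ Z).hom

end StandardSolutions

variable (S : StandardSolutions C)

/-- The space `X ⟶ Y`, to be equipped with the scalar product given by the categorical trace. -/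
def HilbHom (_S : StandardSolutions C) (X Y : C) : Type v := X ⟶ Y

namespace HilbHom

variable {S} {X Y : C}

/-- The underlying morphism. -/
def hom (f : HilbHom S X Y) : X ⟶ Y := f

instance : AddCommGroup (HilbHom S X Y) := inferInstanceAs (AddCommGroup (X ⟶ Y))
instance : Module ℂ (HilbHom S X Y) := inferInstanceAs (Module ℂ (X ⟶ Y))

theorem t_whiskerLeft_eq_zero (f : X ⟶ Y) (h : (S X).t ≫ ((S X).bar ◁ f) = 0) : f = 0 := by
  have h1 := (S X).conj_obj
  calc f = ((ρ_ X).inv ≫ (X ◁ (S X).t) ≫ (α_ X (S X).bar X).inv ≫ ((S X).s† ▷ X) ≫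
        (λ_ X).hom) ≫ f := by rw [h1, Category.id_comp]
    _ = (ρ_ X).inv ≫ (X ◁ ((S X).t ≫ ((S X).bar ◁ f))) ≫ (α_ X (S X).bar Y).inv ≫
        ((S X).s† ▷ Y) ≫ (λ_ Y).hom := by
      simp only [Category.assoc, whiskerLeft_comp, ← leftUnitor_naturality,
        associator_inv_naturality_right_assoc, whisker_exchange_assoc]
    _ = 0 := by rw [h]; simp

/-- The scalar product `⟪f, g⟫ = Tr_X(f† g)`, linear in `g`. -/
abbrev core : InnerProductSpace.Core ℂ (HilbHom S X Y) where
  inner f g := S.tr X (g.hom ≫ f.hom†)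
  conj_inner_symm f g := by
    simp only [StandardSolutions.tr]
    rw [← unitScalar_dagger]
    simp only [dagger_comp, dagger_whiskerLeft, dagger_dagger, Category.assoc]
  re_inner_nonneg f := by
    obtain ⟨r, hr, h⟩ := (unit_irreducible (C := C)).exists_nonneg ((S X).t ≫ ((S X).bar ◁ f.hom))
    have : S.tr X (f.hom ≫ f.hom†) = r := by
      apply unitScalar_eq
      rw [← h]
      simp only [dagger_comp, dagger_whiskerLeft, Category.assoc, whiskerLeft_comp]
    rw [this]
    simpa using hr
  add_left f g h := by
    simp only [StandardSolutions.tr]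
    rw [← unitScalar_add]
    congr 1
    change _ ≫ _ ◁ (h.hom ≫ (f.hom + g.hom)†) ≫ _ = _
    simp [dagger_add]
  smul_left f g c := by
    simp only [StandardSolutions.tr]
    rw [← unitScalar_smul]
    congr 1
    change _ ≫ _ ◁ (g.hom ≫ (c • f.hom)†) ≫ _ = _
    simp [dagger_smul]
  definite f hf := by
    apply t_whiskerLeft_eq_zero (S := S)
    apply eq_zero_of_comp_dagger
    have h1 : S.tr X (f.hom ≫ f.hom†) = 0 := hf
    have h2 := unitScalar_spec ((S X).t ≫ ((S X).bar ◁ (f.hom ≫ f.hom†)) ≫ (S X).t†)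
    rw [show unitScalar _ = (0 : ℂ) from h1, zero_smul] at h2
    rw [← h2]
    change ((S X).t ≫ (S X).bar ◁ f.hom) ≫ ((S X).t ≫ (S X).bar ◁ f.hom)† = _
    simp only [dagger_comp, dagger_whiskerLeft, Category.assoc, whiskerLeft_comp]

instance : NormedAddCommGroup (HilbHom S X Y) := (core (S := S)).toNormedAddCommGroup
instance : InnerProductSpace ℂ (HilbHom S X Y) := InnerProductSpace.ofCore (core (S := S)).toCore

end HilbHom

theorem finiteDimensional_of_irreducible {X Y : C} (hX : IsIrreducible X) (hY : IsIrreducible Y) :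
    FiniteDimensional ℂ (X ⟶ Y) := by
  by_cases h : ∃ f : X ⟶ Y, f ≠ 0
  · obtain ⟨f, hf⟩ := h
    obtain ⟨r, _, hrf⟩ := hX.exists_nonneg f
    have hr0 : (r : ℂ) ≠ 0 := by
      intro h0
      exact hf (eq_zero_of_comp_dagger f (by rw [hrf, h0, zero_smul]))
    refine Module.Finite.of_surjective (LinearMap.toSpanSingleton ℂ (X ⟶ Y) f) fun g => ?_
    obtain ⟨c, hc, _⟩ := hY (f† ≫ g)
    refine ⟨(r : ℂ)⁻¹ * c, ?_⟩
    have h1 : (r : ℂ) • g = c • f := by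
      calc (r : ℂ) • g = ((r : ℂ) • 𝟙 X) ≫ g := by rw [Linear.smul_comp, Category.id_comp]
        _ = f ≫ (f† ≫ g) := by rw [← hrf, Category.assoc]
        _ = c • f := by rw [hc]; simp
    rw [LinearMap.toSpanSingleton_apply, mul_smul, ← h1, smul_smul, inv_mul_cancel₀ hr0, one_smul]
  · push Not at h
    have : Subsingleton (X ⟶ Y) := ⟨fun a b => by rw [h a, h b]⟩
    infer_instance

instance finiteDimensional_hom (X Y : C) : FiniteDimensional ℂ (X ⟶ Y) := by
  obtain ⟨m, A, a, hA, ha⟩ := semisimple X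
  obtain ⟨n, B, b, hB, hb⟩ := semisimple Y
  have := fun k l => finiteDimensional_of_irreducible (hA k) (hB l)
  let φ : (X ⟶ Y) →ₗ[ℂ] (∀ k l, A k ⟶ B l) :=
    { toFun := fun f k l => a k ≫ f ≫ (b l)†
      map_add' := fun f g => by ext; simp
      map_smul' := fun c f => by ext; simp }
  refine FiniteDimensional.of_injective φ ((injective_iff_map_eq_zero φ).2 fun f hf => ?_)
  have h1 : ∀ k l, a k ≫ f ≫ (b l)† = 0 := fun k l => congrFun (congrFun hf k) l
  calc f = (∑ k, (a k)† ≫ a k) ≫ f ≫ (∑ l, (b l)† ≫ b l) := by rw [ha.2, hb.2]; simp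
    _ = ∑ k, ∑ l, (a k)† ≫ (a k ≫ f ≫ (b l)†) ≫ b l := by
      rw [Preadditive.sum_comp]
      simp only [Preadditive.comp_sum, Category.assoc]
    _ = 0 := by simp [h1]

instance (X Y : C) : FiniteDimensional ℂ (HilbHom S X Y) :=
  inferInstanceAs (FiniteDimensional ℂ (X ⟶ Y))

instance (X Y : C) : CompleteSpace (HilbHom S X Y) := FiniteDimensional.complete ℂ _

/-! ### Existence of standard solutions -/

theorem exists_directSum_fin (n : ℕ) (Y : Fin n → C) :
    ∃ (A : C) (a : ∀ k, Y k ⟶ A), IsDirectSum a := by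
  induction n with
  | zero =>
    obtain ⟨Z, i, h1, h2⟩ := exists_subobject (0 : 𝟙_ C ⟶ 𝟙_ C) (by simp) (dagger_zero _ _)
    refine ⟨Z, fun k => k.elim0, ⟨fun k => k.elim0, fun k => k.elim0⟩, ?_⟩
    rw [Finset.univ_eq_empty, Finset.sum_empty]
    calc (0 : Z ⟶ Z) = i ≫ (i† ≫ i) ≫ i† := by rw [h2]; simp
      _ = 𝟙 Z := by simp [h1]
  | succ n ih =>
    obtain ⟨A, a, ⟨ha1, ha2⟩, ha3⟩ := ih (fun k => Y k.succ)
    obtain ⟨Z, i, j, hi, hj, hij⟩ := exists_directSum (Y 0) A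
    have h0 : i ≫ j† = 0 := by
      have h1 : i ≫ j† ≫ j = 0 := by
        have h2 : i ≫ (i† ≫ i + j† ≫ j) = i := by rw [hij, Category.comp_id]
        rw [Preadditive.comp_add, ← Category.assoc, hi, Category.id_comp] at h2
        exact add_eq_left.1 h2
      calc i ≫ j† = (i ≫ j† ≫ j) ≫ j† := by rw [Category.assoc, Category.assoc, hj, Category.comp_id]
        _ = 0 := by rw [h1, Limits.zero_comp]
    have h0' : j ≫ i† = 0 := by
      rw [← dagger_dagger (j ≫ i†), dagger_comp, dagger_dagger, h0, dagger_zero]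
    refine ⟨Z, Fin.cons i (fun k => a k ≫ j), ⟨?_, ?_⟩, ?_⟩
    · intro k _
      refine Fin.cases ?_ (fun k => ?_) k
      · exact hi
      · simp only [Fin.cons_succ, dagger_comp, Category.assoc]
        rw [reassoc_of% hj, ha1 k (Finset.mem_univ _)]
    · intro k _ l _
      refine Fin.cases ?_ (fun k => ?_) k <;> refine Fin.cases ?_ (fun l => ?_) l
      · intro h; exact absurd rfl h
      · intro _
        simp only [Fin.cons_succ, Fin.cons_zero, dagger_comp]
        rw [reassoc_of% h0, Limits.zero_comp]
      · intro _
        simp only [Fin.cons_succ, Fin.cons_zero, dagger_comp, Category.assoc]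
        rw [h0', Limits.comp_zero]
      · intro h
        simp only [Fin.cons_succ, dagger_comp, Category.assoc]
        rw [reassoc_of% hj, ha2 k (Finset.mem_univ _) l (Finset.mem_univ _) (fun h' => h (by rw [h']))]
    · rw [Fin.sum_univ_succ]
      simp only [Fin.cons_succ, Fin.cons_zero, dagger_comp, Category.assoc]
      rw [← hij]
      congr 1
      calc ∑ k, j† ≫ (a k)† ≫ a k ≫ j = j† ≫ (∑ k, (a k)† ≫ a k) ≫ j := by
            simp only [Preadditive.comp_sum, Preadditive.sum_comp, Category.assoc]
        _ = j† ≫ j := by rw [ha3, Category.id_comp]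


theorem exists_standard_of_irreducible (X : C) (hX : IsIrreducible X) :
    Nonempty (StandardSolution X) := by
  obtain ⟨R⟩ := exists_conjugate X
  obtain ⟨a, ha0, ha⟩ := (unit_irreducible (C := C)).exists_nonneg R.s
  obtain ⟨b, hb0, hb⟩ := (unit_irreducible (C := C)).exists_nonneg R.t
  have hs : R.s ≠ 0 := by
    intro h
    have := R.conj_obj
    rw [h, dagger_zero] at this
    exact hX.id_ne_zero (by simpa using this.symm)
  have ht : R.t ≠ 0 := by
    intro h
    have := R.conj_obj
    rw [h] at this
    exact hX.id_ne_zero (by simpa using this.symm)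
  have ha' : 0 < a := by
    refine lt_of_le_of_ne ha0 fun h => hs (eq_zero_of_comp_dagger _ ?_)
    rw [ha, ← h]; simp
  have hb' : 0 < b := by
    refine lt_of_le_of_ne hb0 fun h => ht (eq_zero_of_comp_dagger _ ?_)
    rw [hb, ← h]; simp
  obtain ⟨r, hr, hrab⟩ : ∃ r : ℝ, 0 < r ∧ r * r * a = r⁻¹ * r⁻¹ * b := by
    refine ⟨Real.sqrt (Real.sqrt (b / a)), by positivity, ?_⟩
    have h1 : Real.sqrt (Real.sqrt (b / a)) * Real.sqrt (Real.sqrt (b / a)) = Real.sqrt (b / a) :=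
      Real.mul_self_sqrt (by positivity)
    have h2 : Real.sqrt (b / a) * Real.sqrt (b / a) = b / a := Real.mul_self_sqrt (by positivity)
    have h3 : 0 < Real.sqrt (b / a) := by positivity
    rw [← mul_inv, h1]
    field_simp
    rw [pow_two, h2]
    field_simp
  have hr1 : (r : ℂ) * (r : ℂ)⁻¹ = 1 := mul_inv_cancel₀ (by exact_mod_cast hr.ne')
  have hr2 : (r : ℂ)⁻¹ * (r : ℂ) = 1 := inv_mul_cancel₀ (by exact_mod_cast hr.ne')
  refine ⟨⟨⟨R.bar, (r : ℂ) • R.s, (r : ℂ)⁻¹ • R.t, ?_, ?_⟩, ?_⟩⟩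
  · have := R.conj_bar
    simp only [dagger_smul, MonoidalLinear.whiskerLeft_smul, MonoidalLinear.smul_whiskerRight,
      Linear.smul_comp, Linear.comp_smul, smul_smul, map_inv₀, Complex.conj_ofReal, hr1, hr2,
      one_smul, this]
  · have := R.conj_obj
    simp only [dagger_smul, MonoidalLinear.whiskerLeft_smul, MonoidalLinear.smul_whiskerRight,
      Linear.smul_comp, Linear.comp_smul, smul_smul, map_inv₀, Complex.conj_ofReal, hr1, hr2,
      one_smul, this]
  · intro f
    obtain ⟨c, rfl, _⟩ := hX f
    simp only [dagger_smul, MonoidalLinear.whiskerLeft_smul, MonoidalLinear.smul_whiskerRight,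
      Linear.smul_comp, Linear.comp_smul, smul_smul, map_inv₀, Complex.conj_ofReal,
      MonoidalCategory.whiskerLeft_id, id_whiskerRight, Category.id_comp, ha, hb]
    congr 1
    have := congrArg (fun x : ℝ => (x : ℂ)) hrab
    push_cast at this
    linear_combination -c * this

theorem snake_bar {B X Y B₁ B₂ Y₁ : C} (s : 𝟙_ C ⟶ Y ⊗ B₁) (f : Y ⟶ X) (z : B₁ ⟶ B)
    (y : B ⟶ B₂) (g : X ⟶ Y₁) (h : B₂ ⊗ Y₁ ⟶ 𝟙_ C) :
    (ρ_ B).inv ≫ (B ◁ (s ≫ (f ⊗ₘ z))) ≫ (α_ B X B).inv ≫ (((y ⊗ₘ g) ≫ h) ▷ B) ≫ (λ_ B).hom =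
      y ≫ (ρ_ B₂).inv ≫ (B₂ ◁ (s ≫ ((f ≫ g) ▷ B₁))) ≫ (α_ B₂ Y₁ B₁).inv ≫ (h ▷ B₁) ≫
        (λ_ B₁).hom ≫ z := by
  simp only [MonoidalCategory.tensorHom_def, whiskerLeft_comp, comp_whiskerRight, Category.assoc]
  have h1 : ∀ {D : C} (q : (B₂ ⊗ Y₁) ⊗ B ⟶ D), B ◁ X ◁ z ≫ (α_ B X B).inv ≫ y ▷ X ▷ B ≫
      (B₂ ◁ g) ▷ B ≫ q = (y ▷ (X ⊗ B₁)) ≫ (B₂ ◁ (g ▷ B₁)) ≫ (α_ B₂ Y₁ B₁).inv ≫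
        ((B₂ ⊗ Y₁) ◁ z) ≫ q := by
    intro D q
    rw [associator_inv_naturality_right_assoc, whisker_exchange_assoc, whisker_exchange_assoc,
      ← associator_inv_naturality_left_assoc, ← associator_inv_naturality_middle_assoc]
  rw [h1, ← leftUnitor_naturality, whisker_exchange_assoc, whisker_exchange_assoc,
    whisker_exchange_assoc, ← rightUnitor_inv_naturality_assoc]

theorem snake_obj {B X Y B₁ B₂ Y₁ : C} (t : 𝟙_ C ⟶ B₁ ⊗ Y) (z : B₁ ⟶ B) (f : Y ⟶ X)
    (g : X ⟶ Y₁) (y : B ⟶ B₂) (h : Y₁ ⊗ B₂ ⟶ 𝟙_ C) :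
    (ρ_ X).inv ≫ (X ◁ (t ≫ (z ⊗ₘ f))) ≫ (α_ X B X).inv ≫ (((g ⊗ₘ y) ≫ h) ▷ X) ≫ (λ_ X).hom =
      g ≫ (ρ_ Y₁).inv ≫ (Y₁ ◁ (t ≫ ((z ≫ y) ▷ Y))) ≫ (α_ Y₁ B₂ Y).inv ≫ (h ▷ Y) ≫
        (λ_ Y).hom ≫ f :=
  snake_bar t z f g y h

/-- Every object admits a standard solution of the conjugate equations. -/
theorem nonempty_standardSolution (X : C) : Nonempty (StandardSolution X) := by
  obtain ⟨n, Y, w, hY, ⟨hw1, hw2⟩, hw3⟩ := semisimple X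
  have R : ∀ k, StandardSolution (Y k) := fun k =>
    Classical.choice (exists_standard_of_irreducible (Y k) (hY k))
  obtain ⟨B, z, ⟨hz1, hz2⟩, hz3⟩ := exists_directSum_fin n (fun k => (R k).bar)
  have hs : (∑ k, (R k).s ≫ (w k ⊗ₘ z k))† = ∑ k, ((w k)† ⊗ₘ (z k)†) ≫ (R k).s† := by
    simp only [dagger_sum, dagger_comp, dagger_tensorHom]
  have ht : (∑ k, (R k).t ≫ (z k ⊗ₘ w k))† = ∑ k, ((z k)† ⊗ₘ (w k)†) ≫ (R k).t† := by
    simp only [dagger_sum, dagger_comp, dagger_tensorHom]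
  refine ⟨⟨⟨B, ∑ k, (R k).s ≫ (w k ⊗ₘ z k), ∑ k, (R k).t ≫ (z k ⊗ₘ w k), ?_, ?_⟩, ?_⟩⟩
  · rw [ht]
    simp only [whiskerLeft_sum, sum_whiskerRight, Preadditive.sum_comp, Preadditive.comp_sum,
      snake_bar]
    rw [← hz3]
    refine Finset.sum_congr rfl fun k _ => ?_
    rw [Finset.sum_eq_single k]
    · rw [hw1 k (Finset.mem_univ _), id_whiskerRight, Category.comp_id]
      have h := congrArg (fun q => (z k)† ≫ q ≫ z k) (R k).conj_bar
      simpa only [Category.assoc, Category.id_comp] using h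
    · intro l _ hl
      rw [hw2 _ (Finset.mem_univ _) _ (Finset.mem_univ _) hl]
      simp
    · simp
  · rw [hs]
    simp only [whiskerLeft_sum, sum_whiskerRight, Preadditive.sum_comp, Preadditive.comp_sum,
      snake_obj]
    rw [← hw3]
    refine Finset.sum_congr rfl fun k _ => ?_
    rw [Finset.sum_eq_single k]
    · rw [hz1 k (Finset.mem_univ _), id_whiskerRight, Category.comp_id]
      have h := congrArg (fun q => (w k)† ≫ q ≫ w k) (R k).conj_obj
      simpa only [Category.assoc, Category.id_comp] using h
    · intro l _ hl
      rw [hz2 _ (Finset.mem_univ _) _ (Finset.mem_univ _) hl]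
      simp
    · simp
  · intro f
    have mid1 : ∀ k l, (z k ⊗ₘ w k) ≫ (B ◁ f) ≫ ((z l)† ⊗ₘ (w l)†) =
        (z k ≫ (z l)†) ⊗ₘ (w k ≫ f ≫ (w l)†) := fun k l => by
      rw [← id_tensorHom, tensorHom_comp_tensorHom, tensorHom_comp_tensorHom, Category.id_comp]
    have mid2 : ∀ k l, (w k ⊗ₘ z k) ≫ (f ▷ B) ≫ ((w l)† ⊗ₘ (z l)†) =
        (w k ≫ f ≫ (w l)†) ⊗ₘ (z k ≫ (z l)†) := fun k l => by
      rw [← tensorHom_id, tensorHom_comp_tensorHom, tensorHom_comp_tensorHom, Category.id_comp]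
    have e1 : (∑ k, (R k).t ≫ (z k ⊗ₘ w k)) ≫ (B ◁ f) ≫ (∑ k, (R k).t ≫ (z k ⊗ₘ w k))† =
        ∑ k, (R k).t ≫ ((R k).bar ◁ (w k ≫ f ≫ (w k)†)) ≫ (R k).t† := by
      rw [ht, Preadditive.sum_comp]
      refine Finset.sum_congr rfl fun k _ => ?_
      rw [Preadditive.comp_sum, Preadditive.comp_sum, Finset.sum_eq_single k]
      · have := mid1 k k
        rw [hz1 k (Finset.mem_univ _), id_tensorHom] at this
        rw [← this]
        simp only [Category.assoc]
      · intro l _ hl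
        have := mid1 k l
        rw [hz2 _ (Finset.mem_univ _) _ (Finset.mem_univ _) hl.symm] at this
        rw [Category.assoc, reassoc_of% this]
        simp [MonoidalCategory.tensorHom_def]
      · simp
    have e2 : (∑ k, (R k).s ≫ (w k ⊗ₘ z k)) ≫ (f ▷ B) ≫ (∑ k, (R k).s ≫ (w k ⊗ₘ z k))† =
        ∑ k, (R k).s ≫ ((w k ≫ f ≫ (w k)†) ▷ (R k).bar) ≫ (R k).s† := by
      rw [hs, Preadditive.sum_comp]
      refine Finset.sum_congr rfl fun k _ => ?_
      rw [Preadditive.comp_sum, Preadditive.comp_sum, Finset.sum_eq_single k]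
      · have := mid2 k k
        rw [hz1 k (Finset.mem_univ _), tensorHom_id] at this
        rw [← this]
        simp only [Category.assoc]
      · intro l _ hl
        have := mid2 k l
        rw [hz2 _ (Finset.mem_univ _) _ (Finset.mem_univ _) hl.symm] at this
        rw [Category.assoc, reassoc_of% this]
        simp [MonoidalCategory.tensorHom_def]
      · simp
    rw [e1, e2]
    exact Finset.sum_congr rfl fun k _ => (R k).standard _

/-- A set of representatives of the irreducible objects up to isomorphism. -/
def IsIrr (I : Set C) : Prop :=
  (∀ i ∈ I, IsIrreducible i) ∧ ∀ X : C, IsIrreducible X → ∃! i, i ∈ I ∧ Nonempty (X ≅ i)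

/-! ### The tube algebra -/

/-- The underlying vector space `⨁_{i, j, α ∈ I} (iα, αj)` of the tube algebra, where `(iα, αj)` is
the space of morphisms from `α ⊗ j` to `i ⊗ α`. The index `(i, j, α)` is a nested pair. -/
def TubeAlgebra (_S : StandardSolutions C) (I : Set C) : Type (max u v) :=
  DirectSum (I × I × I) fun t => (t.2.2.1 ⊗ t.2.1.1 ⟶ t.1.1 ⊗ t.2.2.1)

namespace TubeAlgebra

variable {I : Set C}

instance : AddCommGroup (TubeAlgebra S I) :=
  inferInstanceAs (AddCommGroup
    (DirectSum (I × I × I) fun t => (t.2.2.1 ⊗ t.2.1.1 ⟶ t.1.1 ⊗ t.2.2.1)))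

instance : Module ℂ (TubeAlgebra S I) :=
  inferInstanceAs (Module ℂ
    (DirectSum (I × I × I) fun t => (t.2.2.1 ⊗ t.2.1.1 ⟶ t.1.1 ⊗ t.2.2.1)))

/-- The element of the direct summand `(iα, αj)` given by `V`, for `i, j, α ∈ I`. -/
def of (i j α : I) (V : α.1 ⊗ j.1 ⟶ i.1 ⊗ α.1) : TubeAlgebra S I :=
  DirectSum.of (fun t : I × I × I => (t.2.2.1 ⊗ t.2.1.1 ⟶ t.1.1 ⊗ t.2.2.1)) (i, j, α) V

variable {S} in
/-- The component of `a` in `(iα, αj)`. -/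
def component (a : TubeAlgebra S I) (i j α : I) : α.1 ⊗ j.1 ⟶ i.1 ⊗ α.1 :=
  (show DirectSum (I × I × I) fun t => (t.2.2.1 ⊗ t.2.1.1 ⟶ t.1.1 ⊗ t.2.2.1) from a) (i, j, α)

variable {S} in
/-- The finite set of indices `(i, j, α)` of the nonzero components of `a`. -/
def support (a : TubeAlgebra S I) : Finset (I × I × I) :=
  DFinsupp.support
    (show DirectSum (I × I × I) fun t => (t.2.2.1 ⊗ t.2.1.1 ⟶ t.1.1 ⊗ t.2.2.1) from a)

/-- The element of the tube algebra defined by `V ∈ (iβ, βj)`, for an arbitrary object `β`: its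
component in `(iα, αj)` is `∑_U d(α) (1 ⊗ U†) V (U ⊗ 1)`, where `U` runs over an orthonormal basis
of `(β, α)`, the space of morphisms `α ⟶ β`. Only finitely many components are nonzero, since `β`
is a finite direct sum of irreducible objects. -/
def ofObj (i j : I) (β : C) (V : β ⊗ j.1 ⟶ i.1 ⊗ β) : TubeAlgebra S I :=
  ∑ᶠ α : I, of S i j α (∑ m, S.dim α.1 •
    (((stdOrthonormalBasis ℂ (HilbHom S α.1 β) m).hom ▷ j.1) ≫ V ≫
      (i.1 ◁ (stdOrthonormalBasis ℂ (HilbHom S α.1 β) m).hom†)))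

variable {S}

/-- The morphism `(V ⊗ 1)(1 ⊗ W) ∈ (i(αβ), (αβ)j)` for `V ∈ (iα, αk)` and `W ∈ (kβ, βj)`. -/
def mulHom {i j k α β : C} (V : α ⊗ k ⟶ i ⊗ α) (W : β ⊗ j ⟶ k ⊗ β) :
    (α ⊗ β) ⊗ j ⟶ i ⊗ (α ⊗ β) :=
  (α_ α β j).hom ≫ (α ◁ W) ≫ (α_ α k β).inv ≫ (V ▷ β) ≫ (α_ i α β).hom

/-- The morphism `V^# = (t_α† ⊗ 1 ⊗ 1)(1 ⊗ V† ⊗ 1)(1 ⊗ 1 ⊗ s_α) ∈ (jᾱ, ᾱi)` for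
`V ∈ (iα, αj)`. -/
def sharpHom (S : StandardSolutions C) {i j α : C} (V : α ⊗ j ⟶ i ⊗ α) :
    (S α).bar ⊗ i ⟶ j ⊗ (S α).bar :=
  (ρ_ _).inv ≫ (((S α).bar ⊗ i) ◁ (S α).s) ≫ (α_ (S α).bar i (α ⊗ (S α).bar)).hom ≫
    ((S α).bar ◁ ((α_ i α (S α).bar).inv ≫ (V† ▷ (S α).bar) ≫ (α_ α j (S α).bar).hom)) ≫
    (α_ (S α).bar α (j ⊗ (S α).bar)).inv ≫ ((S α).t† ▷ (j ⊗ (S α).bar)) ≫ (λ_ _).hom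

/-- The product of the tube algebra: `V · W = δ_{k,k'} (V ⊗ 1)(1 ⊗ W)` for `V ∈ (iα, αk)` and
`W ∈ (k'β, βj)`, extended bilinearly. -/
instance : Mul (TubeAlgebra S I) where
  mul a b := ∑ p ∈ a.support, ∑ q ∈ b.support,
    if q.1 = p.2.1 then
      ofObj S p.1 q.2.1 (p.2.2.1 ⊗ q.2.2.1)
        (mulHom (a.component p.1 p.2.1 p.2.2) (b.component p.2.1 q.2.1 q.2.2))
    else 0

/-- The involution of the tube algebra: the antilinear extension of `V ↦ V^#`. -/
def sharp (a : TubeAlgebra S I) : TubeAlgebra S I :=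
  ∑ p ∈ a.support,
    ofObj S p.2.1 p.1 (S p.2.2.1).bar (sharpHom S (a.component p.1 p.2.1 p.2.2))

variable (S)

/-- The projection `p_i`, given by `1 ∈ (iε, εi)`. -/
def proj (i : I) : TubeAlgebra S I := ofObj S i i (𝟙_ C) ((λ_ i.1).hom ≫ (ρ_ i.1).inv)

end TubeAlgebra

/-- A right Hilbert module over the tube algebra: a `*`-anti-homomorphism `V ↦ act V` to the
bounded operators on the Hilbert space `K`; `act V ξ` is `ξ · V`. -/
structure RightHilbertModule (S : StandardSolutions C) (I : Set C) (K : Type w)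
    [NormedAddCommGroup K] [InnerProductSpace ℂ K] [CompleteSpace K] where
  act : TubeAlgebra S I →ₗ[ℂ] (K →L[ℂ] K)
  act_mul : ∀ (a b : TubeAlgebra S I) (ξ : K), act (a * b) ξ = act b (act a ξ)
  act_sharp : ∀ (a : TubeAlgebra S I) (ξ η : K),
    inner ℂ (act (TubeAlgebra.sharp a) ξ) η = inner ℂ ξ (act a η)

/-- `K · A` has dense linear span. -/
def RightHilbertModule.Nondegenerate {S : StandardSolutions C} {I : Set C} {K : Type w}
    [NormedAddCommGroup K] [InnerProductSpace ℂ K] [CompleteSpace K]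
    (M : RightHilbertModule S I K) : Prop :=
  Dense (Submodule.span ℂ {x : K | ∃ a ξ, M.act a ξ = x} : Set K)

/-! ### Ind-objects -/

/-- An ind-object: a possibly infinite (formal, orthogonal) direct sum `⨁_{k ∈ ι} X_k` of objects.
The morphisms of ind-objects are the bounded matrices of morphisms, with the composition and the
adjoint defined below; an object is identified with the corresponding sum with one term. -/
structure IndObj (C : Type u) where
  ι : Type w
  obj : ι → C

/-- Matrices `T = (T k l)` of morphisms `T k l : X_l ⟶ Y_k`. -/
def IndMat (X : IndObj.{w} C) (Y : IndObj.{w'} C) := ∀ (k : Y.ι) (l : X.ι), X.obj l ⟶ Y.obj k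

namespace IndMat

/-- The matrix defines a bounded morphism between the infinite direct sums: its finite corners,
viewed as morphisms `A ⟶ B` where `A` and `B` contain the finite direct sums `⨁_{l ∈ F} X_l` and
`⨁_{k ∈ G} Y_k`, are uniformly bounded in norm. -/
def IsBounded {X : IndObj.{w} C} {Y : IndObj.{w'} C} (T : IndMat X Y) : Prop :=
  ∃ c : ℝ, ∀ (F : Finset X.ι) (G : Finset Y.ι) (A B : C) (a : ∀ l, X.obj l ⟶ A)
    (b : ∀ k, Y.obj k ⟶ B), IsOrthogonalFamily F a → IsOrthogonalFamily G b →
      ‖∑ l ∈ F, ∑ k ∈ G, (a l)† ≫ T k l ≫ b k‖ ≤ c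

/-- The identity matrix. -/
def id (X : IndObj.{w} C) : IndMat X X :=
  fun k l => if h : l = k then eqToHom (congrArg X.obj h) else 0

/-- The adjoint matrix. -/
def adj {X : IndObj.{w} C} {Y : IndObj.{w'} C} (T : IndMat X Y) : IndMat Y X :=
  fun l k => (T k l)†

/-- The composition `R T`, with entries `∑_m R_{km} T_{ml}`; for bounded matrices the sum is
absolutely convergent in the (finite dimensional) space of morphisms. -/
def comp {X : IndObj.{w} C} {Y : IndObj.{w'} C} {Z : IndObj.{w} C}
    (R : IndMat Y Z) (T : IndMat X Y) : IndMat X Z :=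
  fun k l => ∑' m, T m l ≫ R k m

/-- `T† T = 1` and `T T† = 1`. -/
def IsUnitary {X : IndObj.{w} C} {Y : IndObj.{w'} C} (T : IndMat X Y) : Prop :=
  T.adj.comp T = id X ∧ comp T T.adj = id Y

end IndMat

/-- The isometric inclusion of a summand in a Hilbert space direct sum. -/
def lpIncl {J : Type*} (E : J → Type*) [∀ j, NormedAddCommGroup (E j)]
    [∀ j, InnerProductSpace ℂ (E j)] (j : J) : E j →ₗᵢ[ℂ] lp E 2 where
  toLinearMap := lp.lsingle 2 j
  norm_map' ξ := lp.norm_single (by norm_num) j ξ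

namespace IndObj

/-- The ind-object `α X`. -/
def tensorLeft (α : C) (X : IndObj.{w} C) : IndObj.{w} C := ⟨X.ι, fun k => α ⊗ X.obj k⟩

/-- The ind-object `X α`. -/
def tensorRight (X : IndObj.{w} C) (α : C) : IndObj.{w} C := ⟨X.ι, fun k => X.obj k ⊗ α⟩

/-- The Hilbert space `(X, i)` of morphisms `ξ : i ⟶ X`, given by square summable families
`ξ_k : i ⟶ X_k`, with the scalar product `⟪ξ, η⟫ = Tr_i(ξ† η) = ∑_k Tr_i(ξ_k† η_k)`. -/
def HomSpace (S : StandardSolutions C) (X : IndObj.{w} C) (i : C) : Type (max w v) :=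
  lp (fun k : X.ι => HilbHom S i (X.obj k)) 2

instance (X : IndObj.{w} C) (i : C) : NormedAddCommGroup (X.HomSpace S i) :=
  inferInstanceAs (NormedAddCommGroup (lp (fun k : X.ι => HilbHom S i (X.obj k)) 2))

instance (X : IndObj.{w} C) (i : C) : InnerProductSpace ℂ (X.HomSpace S i) :=
  inferInstanceAs (InnerProductSpace ℂ (lp (fun k : X.ι => HilbHom S i (X.obj k)) 2))

instance (X : IndObj.{w} C) (i : C) : CompleteSpace (X.HomSpace S i) :=
  inferInstanceAs (CompleteSpace (lp (fun k : X.ι => HilbHom S i (X.obj k)) 2))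

variable {S} in
/-- The component `ξ_k : i ⟶ X_k` of `ξ ∈ (X, i)`. -/
def HomSpace.component {X : IndObj.{w} C} {i : C} (ξ : X.HomSpace S i) (k : X.ι) :
    i ⟶ X.obj k :=
  HilbHom.hom ((show lp (fun k : X.ι => HilbHom S i (X.obj k)) 2 from ξ) k)

/-- The orthogonal direct sum of the Hilbert spaces `(X, i)`, `i ∈ I`. -/
abbrev Total (S : StandardSolutions C) (I : Set C) (X : IndObj.{w} C) : Type (max w v u) :=
  lp (fun i : I => HomSpace S X i.1) 2

/-- The inclusion of `(X, i)` in the direct sum. -/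
def incl (S : StandardSolutions C) (I : Set C) (X : IndObj.{w} C) (i : I) :
    HomSpace S X i.1 →ₗᵢ[ℂ] Total S I X :=
  lpIncl (fun i : I => HomSpace S X i.1) i

end IndObj

/-- A unitary half braiding on the ind-object `X`: bounded unitary morphisms `σ α : αX ⟶ Xα`, with
matrix entries `σ α k l : α ⊗ X_l ⟶ X_k ⊗ α`. -/
structure UnitaryHalfBraiding (X : IndObj.{w} C) where
  σ : ∀ α : C, IndMat (X.tensorLeft α) (X.tensorRight α)
  bounded : ∀ α, (σ α).IsBounded
  unitary : ∀ α, (σ α).IsUnitary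
  /-- `(1 ⊗ V) σ_α = σ_β (V ⊗ 1)` for all `V : α ⟶ β` -/
  naturality : ∀ {α β : C} (V : α ⟶ β) (k l : X.ι),
    σ α k l ≫ (X.obj k ◁ V) = (V ▷ X.obj l) ≫ σ β k l
  /-- `σ_ε = id` -/
  unit : ∀ k l : X.ι,
    σ (𝟙_ C) k l = (λ_ (X.obj l)).hom ≫ IndMat.id X k l ≫ (ρ_ (X.obj k)).inv
  /-- `σ_{αβ} = (σ_α ⊗ 1)(1 ⊗ σ_β)` -/
  multiplicativity : ∀ (α β : C) (k l : X.ι),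
    σ (α ⊗ β) k l = (α_ α β (X.obj l)).hom ≫
      (∑' m : X.ι, (α ◁ σ β m l) ≫ (α_ α (X.obj m) β).inv ≫ (σ α k m ▷ β)) ≫
        (α_ (X.obj k) α β).hom

namespace UnitaryHalfBraiding

variable {S}

/-- The components `α ⊗ j ⟶ α ⊗ X_k` of the morphism `σ_α† (ξ ⊗ 1) V : αj ⟶ αX`, for
`ξ ∈ (X, i)` and `V ∈ (iα, αj)`. -/
def rotate {X : IndObj.{w} C} (σ : UnitaryHalfBraiding X) {i j α : C} (ξ : X.HomSpace S i)
    (V : α ⊗ j ⟶ i ⊗ α) (k : X.ι) : α ⊗ j ⟶ α ⊗ X.obj k :=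
  ∑' l : X.ι, V ≫ (ξ.component l ▷ α) ≫ (σ.σ α l k)†

/-- The scalar `Tr_{αj}((1 ⊗ η†) σ_α† (ξ ⊗ 1) V)`, for `ξ ∈ (X, i)`, `η ∈ (X, j)` and
`V ∈ (iα, αj)`. -/
def coefficient {X : IndObj.{w} C} (σ : UnitaryHalfBraiding X) {i j α : C} (ξ : X.HomSpace S i)
    (η : X.HomSpace S j) (V : α ⊗ j ⟶ i ⊗ α) : ℂ :=
  S.tr (α ⊗ j) (∑' k : X.ι, σ.rotate ξ V k ≫ (α ◁ (η.component k)†))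

variable {I : Set C}

/-- The module structure on `⨁_i (X, i)` is given by
`ξ · V = (Tr_α ⊗ id)(σ_α† (ξ ⊗ 1) V) ∈ (X, j)` for `ξ ∈ (X, i)` and `V ∈ (iα, αj)`. -/
def Induces {X : IndObj.{w} C} (σ : UnitaryHalfBraiding X)
    (M : RightHilbertModule S I (X.Total S I)) : Prop :=
  ∀ (i j α : I) (ξ : X.HomSpace S i.1) (V : α.1 ⊗ j.1 ⟶ i.1 ⊗ α.1),
    ∃ ζ : X.HomSpace S j.1,
      (∀ k, ζ.component k = S.partialTrace α.1 (σ.rotate ξ V k)) ∧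
      M.act (TubeAlgebra.of S i j α V) (X.incl S I i ξ) = X.incl S I j ζ

/-- `T : X ⟶ Y` is a morphism of half braidings: it is bounded and
`(T ⊗ 1) σ_α = ρ_α (1 ⊗ T)` for all `α`. -/
def IsMorphism {X Y : IndObj.{w} C} (σ : UnitaryHalfBraiding X) (ρ : UnitaryHalfBraiding Y)
    (T : IndMat X Y) : Prop :=
  T.IsBounded ∧ ∀ (α : C) (k : Y.ι) (l : X.ι),
    ∑' m : X.ι, σ.σ α m l ≫ (T k m ▷ α) = ∑' m : Y.ι, (α ◁ T m l) ≫ ρ.σ α k m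

end UnitaryHalfBraiding

/-- The morphisms `φ i : (X, i) ⟶ K` identify the Hilbert spaces `(X, i)` with `K · p_i`. -/
def RightHilbertModule.IsRealizedBy {S : StandardSolutions C} {I : Set C} {K : Type w}
    [NormedAddCommGroup K] [InnerProductSpace ℂ K] [CompleteSpace K]
    (M : RightHilbertModule S I K) {X : IndObj.{w'} C}
    (φ : ∀ i : I, X.HomSpace S i.1 →ₗᵢ[ℂ] K) : Prop :=
  ∀ i, Set.range (φ i) = Set.range (M.act (TubeAlgebra.proj S i))

/-- `Tr_{αj}((1 ⊗ η†) σ_α† (ξ ⊗ 1) V) = ⟨ξ · V, η⟩`. -/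
def RightHilbertModule.Determines {S : StandardSolutions C} {I : Set C} {K : Type w}
    [NormedAddCommGroup K] [InnerProductSpace ℂ K] [CompleteSpace K]
    (M : RightHilbertModule S I K) {X : IndObj.{w'} C}
    (φ : ∀ i : I, X.HomSpace S i.1 →ₗᵢ[ℂ] K) (σ : UnitaryHalfBraiding X) : Prop :=
  ∀ (i j α : I) (ξ : X.HomSpace S i.1) (η : X.HomSpace S j.1) (V : α.1 ⊗ j.1 ⟶ i.1 ⊗ α.1),
    σ.coefficient ξ η V = inner ℂ (φ j η) (M.act (TubeAlgebra.of S i j α V) (φ i ξ))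

/-- A bounded operator commuting with the right actions. -/
def RightHilbertModule.IsMorphism {S : StandardSolutions C} {I : Set C} {K : Type w} {L : Type w'}
    [NormedAddCommGroup K] [InnerProductSpace ℂ K] [CompleteSpace K]
    [NormedAddCommGroup L] [InnerProductSpace ℂ L] [CompleteSpace L]
    (M : RightHilbertModule S I K) (N : RightHilbertModule S I L) (F : K →L[ℂ] L) : Prop :=
  ∀ a ξ, F (M.act a ξ) = N.act a (F ξ)

/-- `F` is the operator `⨁_i (X, i) ⟶ ⨁_i (Y, i)` given by composition with `T : X ⟶ Y`. -/
def IndMat.Implements {S : StandardSolutions C} {I : Set C} {X Y : IndObj.{w} C} (T : IndMat X Y)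
    (F : X.Total S I →L[ℂ] Y.Total S I) : Prop :=
  ∀ (i : I) (ξ : X.HomSpace S i.1), ∃ ζ : Y.HomSpace S i.1,
    (∀ k, ζ.component k = ∑' l : X.ι, ξ.component l ≫ T k l) ∧ F (X.incl S I i ξ) = Y.incl S I i ζ

end
end TubeRep

namespace TubeRep

noncomputable section

open scoped Classical
open CStarCategory CStarTensorCategory RigidCStarTensorCategory

variable {C : Type u} [Category.{v} C] [Preadditive C] [Linear ℂ C]
    [MonoidalCategory C] [MonoidalPreadditive C] [MonoidalLinear ℂ C] [RigidCStarTensorCategory C]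

/-! ### C*-norms of morphisms and their action on Hilbert spaces of morphisms. -/

section

section CStarNorm

variable {C : Type u} [Category.{v} C] [Preadditive C] [Linear ℂ C] [CStarCategory C]

/-! Put `R_α = σ_α†`, a unitary Xα ⟶ αX. For arbitrary objects a, b, α, every V : α ⊗ b ⟶ a ⊗ α
defines an operator (X, a) ⟶ (X, b), namely ξ ↦ (Tr_α ⊗ id)(R_α (ξ ⊗ 1) V). The axioms of a unitary
half braiding translate into relations between these operators. Naturality becomes the sliding
relation, by which u : α ⟶ β is moved around the annulus; multiplicativity gives the product V · W;
σ_ε = id gives the unit; unitarity gives the adjoint V^#. A family of operators with these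
properties is an `AnnularAction`.

The way back is Frobenius reciprocity. A morphism f : γ ⟶ α ⊗ Z is recovered by bending from the
partial trace of s_α† ⊗ 1 followed by f (`cup_partialTrace`). An annular action therefore prescribes
the value of R_α on (ξ ⊗ 1) V; this value is `transport`. The adjoint relation and sliding show that
the prescription preserves scalar products (`inner_transport`), so an isometric R_α exists. Its
range contains all vectors 1 ⊗ η (`transport_contract`), so it is unitary. The scalar products fit
together because the trace of a standard solution is tracial, which is derived from the equality of
left and right traces by showing that the double transpose is the identity (`doubleTranspose_eq`).

Two reductions make this precise. First, a bounded matrix between ind-objects is the same as a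
uniformly bounded natural family of operators (X, γ) ⟶ (Y, γ), a `NatOp`: the C*-norm of a morphism
f with source A equals the norm of composition with f on the Hilbert space (A, A)
(`norm_postHilb_self`). Infinite matrices, their adjoints and products are thus handled as Hilbert
space operators. Second, the tube algebra only involves objects of I. Decomposing objects into
members of I (`exists_resolution`) extends the module relations to an arbitrary middle object α
(`act_ofObj_ofObj`, `inner_act_ofObj`), and then the action to arbitrary outer objects
(`IrrAction.exists_extension`). The extension is unique, and this gives the uniqueness of σ.

A module is realized by the ind-object that contains one copy of i for each vector of an orthonormal
basis of K · p_i. For naturality, a module map commutes with every p_i, so it consists of uniformly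
bounded operators (X, i) ⟶ (Y, i). By Schur's lemma these extend to a natural family, and
intertwining the actions is equivalent to intertwining the half braidings (`isMorphism_mat_iff`). -/

theorem norm_dagger_le {X Y : C} (f : X ⟶ Y) : ‖f‖ ≤ ‖f†‖ := by
  have h1 : ‖f ≫ f†‖ = ‖f‖ ^ 2 := homNorm_comp_dagger f
  have h2 : ‖f ≫ f†‖ ≤ ‖f‖ * ‖f†‖ := homNorm_comp_le f (f†)
  rcases (norm_nonneg f).eq_or_lt with h | h
  · rw [← h]; exact norm_nonneg _
  · rw [h1, pow_two] at h2
    exact le_of_mul_le_mul_left h2 h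

theorem norm_dagger {X Y : C} (f : X ⟶ Y) : ‖f†‖ = ‖f‖ := by
  refine le_antisymm ?_ (norm_dagger_le f)
  have := norm_dagger_le (f†)
  rwa [dagger_dagger] at this

theorem norm_comp_le {X Y Z : C} (f : X ⟶ Y) (g : Y ⟶ Z) : ‖f ≫ g‖ ≤ ‖f‖ * ‖g‖ :=
  homNorm_comp_le f g

theorem norm_sq_eq {X Y : C} (f : X ⟶ Y) : ‖f‖ ^ 2 = ‖f ≫ f†‖ := (homNorm_comp_dagger f).symm

instance (X : C) : CompleteSpace (X ⟶ X) := by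
  refine Metric.complete_of_cauchySeq_tendsto fun x hx => ?_
  rw [Metric.cauchySeq_iff] at hx
  obtain ⟨f, hf⟩ := homNorm_complete x (fun ε hε => by
    obtain ⟨N, hN⟩ := hx ε hε
    refine ⟨N, fun m hm n hn => ?_⟩
    have := hN m hm n hn
    rwa [dist_eq_norm] at this)
  refine ⟨f, Metric.tendsto_atTop.2 fun ε hε => ?_⟩
  obtain ⟨N, hN⟩ := hf ε hε
  refine ⟨N, fun n hn => ?_⟩
  rw [dist_eq_norm]
  exact hN n hn

/-- The endomorphisms of `X`, as a C*-algebra with the product `f * g = g ≫ f`. -/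
def EndAlg (X : C) : Type v := X ⟶ X

namespace EndAlg
variable {X : C}

instance : Ring (EndAlg X) := inferInstanceAs (Ring (End X))
instance : Algebra ℂ (EndAlg X) := inferInstanceAs (Algebra ℂ (End X))
instance : NormedAddCommGroup (EndAlg X) := homNormedAddCommGroup X X
instance : CompleteSpace (EndAlg X) := inferInstanceAs (CompleteSpace (X ⟶ X))

instance : NormedRing (EndAlg X) where
  dist_eq a b := dist_eq_norm_neg_add a b
  norm_mul_le a b := by
    have := norm_comp_le (show X ⟶ X from b) (show X ⟶ X from a)
    rw [mul_comm] at this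
    exact this

instance : NormedAlgebra ℂ (EndAlg X) where
  norm_smul_le c f := (homNorm_smul c (show X ⟶ X from f)).le

instance : StarRing (EndAlg X) where
  star f := (show X ⟶ X from f)†
  star_involutive f := dagger_dagger (show X ⟶ X from f)
  star_mul f g := dagger_comp (show X ⟶ X from g) (show X ⟶ X from f)
  star_add f g := dagger_add (show X ⟶ X from f) (show X ⟶ X from g)

instance : StarModule ℂ (EndAlg X) where
  star_smul c f := dagger_smul c (show X ⟶ X from f)

instance : CStarRing (EndAlg X) where
  norm_mul_self_le f := by
    have h := norm_sq_eq (show X ⟶ X from f)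
    rw [pow_two] at h
    exact h.le

instance : CStarAlgebra (EndAlg X) where

end EndAlg
end CStarNorm

section Hilb
variable {C : Type u} [Category.{v} C] [Preadditive C] [Linear ℂ C]
    [MonoidalCategory C] [MonoidalPreadditive C] [MonoidalLinear ℂ C] [RigidCStarTensorCategory C]

/-- Whiskering is a unital `*`-homomorphism between the C*-algebras End X and End (X ⊗ Z), hence
contractive; the C*-identity reduces a general f to f ≫ f†. -/
theorem norm_whiskerRight_le {X Y : C} (f : X ⟶ Y) (Z : C) : ‖f ▷ Z‖ ≤ ‖f‖ := by
  let φ : EndAlg X →⋆ₐ[ℂ] EndAlg (X ⊗ Z) :=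
    { toFun := fun g => (show X ⟶ X from g) ▷ Z
      map_one' := id_whiskerRight X Z
      map_mul' := fun g h => comp_whiskerRight (show X ⟶ X from h) (show X ⟶ X from g) Z
      map_zero' := MonoidalPreadditive.zero_whiskerRight
      map_add' := fun g h => MonoidalPreadditive.add_whiskerRight (show X ⟶ X from g) _
      commutes' := fun c => by
        rw [Algebra.algebraMap_eq_smul_one, Algebra.algebraMap_eq_smul_one]
        exact (MonoidalLinear.smul_whiskerRight c (𝟙 X) Z).trans
          (congrArg (c • ·) (id_whiskerRight X Z))
      map_star' := fun g => (dagger_whiskerRight (show X ⟶ X from g) Z).symm }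
  have h : ‖(f ≫ f†) ▷ Z‖ ≤ ‖f ≫ f†‖ := NonUnitalStarAlgHom.norm_apply_le (A := EndAlg X) φ (f ≫ f†)
  rw [← norm_sq_eq, comp_whiskerRight, ← dagger_whiskerRight, ← norm_sq_eq] at h
  exact le_of_sq_le_sq h (norm_nonneg _)

variable (S : StandardSolutions C)

variable {S} in
theorem HilbHom.inner_def {X Y : C} (f g : HilbHom S X Y) :
    inner ℂ f g = S.tr X (g.hom ≫ f.hom†) := rfl

/-- A morphism, as an element of the Hilbert space of morphisms. -/
def toHilb {X Y : C} (f : X ⟶ Y) : HilbHom S X Y := f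

theorem hom_toHilb {X Y : C} (f : X ⟶ Y) : (toHilb S f).hom = f := rfl

/-- Composition with `f : X ⟶ Y`, on the Hilbert spaces of morphisms from `γ`. -/
def postHilb (γ : C) {X Y : C} (f : X ⟶ Y) : HilbHom S γ X →L[ℂ] HilbHom S γ Y :=
  LinearMap.toContinuousLinearMap
    { toFun := fun x => toHilb S (x.hom ≫ f)
      map_add' := fun x y => Preadditive.add_comp _ _ _ x.hom y.hom f
      map_smul' := fun c x => Linear.smul_comp _ _ _ c x.hom f }

theorem postHilb_apply (γ : C) {X Y : C} (f : X ⟶ Y) (x : HilbHom S γ X) :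
    postHilb S γ f x = toHilb S (x.hom ≫ f) := rfl

theorem adjoint_postHilb (γ : C) {X Y : C} (f : X ⟶ Y) :
    (postHilb S γ f).adjoint = postHilb S γ (f†) := by
  symm
  rw [ContinuousLinearMap.eq_adjoint_iff]
  intro x y
  simp only [HilbHom.inner_def, postHilb_apply, hom_toHilb, dagger_comp, dagger_dagger,
    Category.assoc]

/-- The representation of the endomorphisms of `X` on the morphisms from `γ`. -/
def postRep (γ X : C) : EndAlg X →⋆ₐ[ℂ] (HilbHom S γ X →L[ℂ] HilbHom S γ X) where
  toFun f := postHilb S γ (show X ⟶ X from f)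
  map_one' := by
    ext x
    exact Category.comp_id x.hom
  map_mul' f g := by
    ext x
    exact (Category.assoc x.hom (show X ⟶ X from g) (show X ⟶ X from f)).symm
  map_zero' := by
    ext x
    exact Limits.comp_zero
  map_add' f g := by
    ext x
    exact Preadditive.comp_add _ _ _ x.hom (show X ⟶ X from f) _
  commutes' c := by
    ext x
    rw [Algebra.algebraMap_eq_smul_one, Algebra.algebraMap_eq_smul_one]
    exact (Linear.comp_smul _ _ _ x.hom c (𝟙 X)).trans (congrArg (c • ·) (Category.comp_id x.hom))
  map_star' f := by
    rw [ContinuousLinearMap.star_eq_adjoint, adjoint_postHilb]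
    rfl

theorem norm_postHilb_sq (γ : C) {X Y : C} (f : X ⟶ Y) :
    ‖postHilb S γ f‖ ^ 2 = ‖postRep S γ X (f ≫ f†)‖ := by
  have h : postRep S γ X (f ≫ f†) = (postHilb S γ f).adjoint ∘L postHilb S γ f := by
    rw [adjoint_postHilb]
    ext x
    exact (Category.assoc x.hom f (f†)).symm
  rw [h, ContinuousLinearMap.norm_adjoint_comp_self, pow_two]

theorem norm_postHilb_le (γ : C) {X Y : C} (f : X ⟶ Y) : ‖postHilb S γ f‖ ≤ ‖f‖ := by
  refine le_of_sq_le_sq ?_ (norm_nonneg _)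
  rw [norm_postHilb_sq, norm_sq_eq]
  exact NonUnitalStarAlgHom.norm_apply_le (A := EndAlg X) (postRep S γ X) (f ≫ f†)

/-- The representation of End X on the Hilbert space (X, X) is faithful, as evaluation at the
identity shows, and an injective `*`-homomorphism of C*-algebras is isometric. This recovers the
C*-norm from the trace scalar product. -/
theorem norm_postHilb_self {X Y : C} (f : X ⟶ Y) : ‖postHilb S X f‖ = ‖f‖ := by
  have h : ‖postHilb S X f‖ ^ 2 = ‖f‖ ^ 2 := by
    rw [norm_postHilb_sq, norm_sq_eq]
    refine NonUnitalStarAlgHom.norm_map (A := EndAlg X) (postRep S X X) (fun a b hab => ?_) (f ≫ f†)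
    have := DFunLike.congr_fun hab (toHilb S (𝟙 X))
    exact (Category.id_comp (show X ⟶ X from a)).symm.trans
      (this.trans (Category.id_comp (show X ⟶ X from b)))
  exact (sq_eq_sq₀ (norm_nonneg (postHilb S X f)) (norm_nonneg f)).1 h

theorem norm_toHilb_comp_le {γ X Y : C} (x : γ ⟶ X) (f : X ⟶ Y) :
    ‖toHilb S (x ≫ f)‖ ≤ ‖f‖ * ‖toHilb S x‖ :=
  ((postHilb S γ f).le_opNorm (toHilb S x)).trans
    (mul_le_mul_of_nonneg_right (norm_postHilb_le S γ f) (norm_nonneg _))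

theorem norm_le_of_comp_le {X Y : C} (f : X ⟶ Y) {c : ℝ} (hc : 0 ≤ c)
    (h : ∀ g : X ⟶ X, ‖toHilb S (g ≫ f)‖ ≤ c * ‖toHilb S g‖) : ‖f‖ ≤ c := by
  rw [← norm_postHilb_self S f]
  exact ContinuousLinearMap.opNorm_le_bound _ hc fun x => h x.hom

end Hilb

end

/-! ### Conjugate equations, transposes, and traciality of standard solutions. -/

section

namespace ConjugateSolution
variable {X Y Z : C}

/-- The conjugate equation with associators and unitors absorbed in `⊗≫`. In this form a graphical
computation alternates between `monoidal`, a rewriting by a zigzag, and the interchange law. -/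
theorem zigzag_obj (R : ConjugateSolution X) : X ◁ R.t ⊗≫ R.s† ▷ X = ⊗𝟙.hom := by
  calc _ = (ρ_ X).hom ≫ ((ρ_ X).inv ≫ (X ◁ R.t) ≫ (α_ X R.bar X).inv ≫ (R.s† ▷ X) ≫
        (λ_ X).hom) ≫ (λ_ X).inv := by monoidal
    _ = _ := by rw [R.conj_obj]; monoidal

theorem zigzag_bar (R : ConjugateSolution X) : R.bar ◁ R.s ⊗≫ R.t† ▷ R.bar = ⊗𝟙.hom := by
  calc _ = (ρ_ R.bar).hom ≫ ((ρ_ R.bar).inv ≫ (R.bar ◁ R.s) ≫ (α_ R.bar X R.bar).inv ≫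
        (R.t† ▷ R.bar) ≫ (λ_ R.bar).hom) ≫ (λ_ R.bar).inv := by monoidal
    _ = _ := by rw [R.conj_bar]; monoidal

/-- Obtained by taking adjoints in the conjugate equation; the constraints are unitary, so their
adjoints are their inverses. -/
theorem zigzag_obj' (R : ConjugateSolution X) : R.s ▷ X ⊗≫ X ◁ R.t† = ⊗𝟙.hom := by
  have h := congrArg (fun f => f†) R.conj_obj
  simp only [dagger_comp, dagger_whiskerLeft, dagger_whiskerRight, dagger_dagger, dagger_id,
    dagger_of_unitary' _ (unitary_rightUnitor X), dagger_of_unitary _ (unitary_leftUnitor X),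
    dagger_of_unitary' _ (unitary_associator _ _ _), Category.assoc] at h
  calc _ = (λ_ X).hom ≫ ((λ_ X).inv ≫ R.s ▷ X ≫ (α_ X R.bar X).hom ≫ X ◁ R.t† ≫
        (ρ_ X).hom) ≫ (ρ_ X).inv := by monoidal
    _ = _ := by rw [h]; monoidal

theorem zigzag_bar' (R : ConjugateSolution X) : R.t ▷ R.bar ⊗≫ R.bar ◁ R.s† = ⊗𝟙.hom := by
  have h := congrArg (fun f => f†) R.conj_bar
  simp only [dagger_comp, dagger_whiskerLeft, dagger_whiskerRight, dagger_dagger, dagger_id,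
    dagger_of_unitary' _ (unitary_rightUnitor R.bar), dagger_of_unitary _ (unitary_leftUnitor R.bar),
    dagger_of_unitary' _ (unitary_associator _ _ _), Category.assoc] at h
  calc _ = (λ_ R.bar).hom ≫ ((λ_ R.bar).inv ≫ R.t ▷ R.bar ≫ (α_ R.bar X R.bar).hom ≫
        R.bar ◁ R.s† ≫ (ρ_ R.bar).hom) ≫ (ρ_ R.bar).inv := by monoidal
    _ = _ := by rw [h]; monoidal

/-- The solution for the conjugate object obtained by exchanging `s` and `t`. -/
def conj (R : ConjugateSolution X) : ConjugateSolution R.bar where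
  bar := X
  s := R.t
  t := R.s
  conj_bar := R.conj_obj
  conj_obj := R.conj_bar

/-- The transpose `f^∨ : Ȳ ⟶ X̄` of `f : X ⟶ Y`. -/
def transpose (R : ConjugateSolution X) (Q : ConjugateSolution Y) (f : X ⟶ Y) : Q.bar ⟶ R.bar :=
  𝟙 _ ⊗≫ R.t ▷ Q.bar ⊗≫ R.bar ◁ f ▷ Q.bar ⊗≫ R.bar ◁ Q.s† ⊗≫ 𝟙 _

/-- For arbitrary solutions a morphism passes through the cup `t` and the cap `s†` as its transpose.
Passing through `s` or `t†` brings in a double transpose, which can be ignored only for standard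
solutions. -/
theorem t_transpose (R : ConjugateSolution X) (Q : ConjugateSolution Y) (f : X ⟶ Y) :
    Q.t ≫ transpose R Q f ▷ Y = R.t ≫ R.bar ◁ f := by
  unfold transpose
  calc _ = 𝟙 _ ⊗≫ (𝟙_ C ◁ Q.t ≫ (R.t ≫ R.bar ◁ f) ▷ (Q.bar ⊗ Y)) ⊗≫ R.bar ◁ Q.s† ▷ Y ⊗≫
        𝟙 _ := by monoidal
    _ = R.t ⊗≫ R.bar ◁ f ⊗≫ R.bar ◁ (Y ◁ Q.t ⊗≫ Q.s† ▷ Y) ⊗≫ 𝟙 _ := by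
      rw [whisker_exchange]; monoidal
    _ = _ := by rw [zigzag_obj]; monoidal

theorem transpose_s_dagger (R : ConjugateSolution X) (Q : ConjugateSolution Y) (f : X ⟶ Y) :
    X ◁ transpose R Q f ≫ R.s† = f ▷ Q.bar ≫ Q.s† := by
  unfold transpose
  calc _ = 𝟙 _ ⊗≫ X ◁ R.t ▷ Q.bar ⊗≫ ((X ⊗ R.bar) ◁ (f ▷ Q.bar ≫ Q.s†) ≫ R.s† ▷ 𝟙_ C) ⊗≫
        𝟙 _ := by monoidal
    _ = 𝟙 _ ⊗≫ (X ◁ R.t ⊗≫ R.s† ▷ X) ▷ Q.bar ⊗≫ f ▷ Q.bar ⊗≫ Q.s† := by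
      rw [whisker_exchange]; monoidal
    _ = _ := by rw [zigzag_obj]; monoidal

theorem transpose_add (R : ConjugateSolution X) (Q : ConjugateSolution Y) (f g : X ⟶ Y) :
    transpose R Q (f + g) = transpose R Q f + transpose R Q g := by
  simp [transpose, monoidalComp]

theorem transpose_smul (R : ConjugateSolution X) (Q : ConjugateSolution Y) (c : ℂ) (f : X ⟶ Y) :
    transpose R Q (c • f) = c • transpose R Q f := by
  simp [transpose, monoidalComp]

theorem transpose_id (R : ConjugateSolution X) : transpose R R (𝟙 X) = 𝟙 R.bar := by
  unfold transpose
  calc _ = 𝟙 _ ⊗≫ (R.t ▷ R.bar ⊗≫ R.bar ◁ R.s†) ⊗≫ 𝟙 _ := by monoidal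
    _ = _ := by rw [zigzag_bar']; monoidal

theorem transpose_comp (R : ConjugateSolution X) (Q : ConjugateSolution Y) (P : ConjugateSolution Z)
    (f : X ⟶ Y) (g : Y ⟶ Z) :
    transpose R P (f ≫ g) = transpose Q P g ≫ transpose R Q f := by
  symm
  calc transpose Q P g ≫ transpose R Q f
      = 𝟙 _ ⊗≫ (𝟙_ C ◁ transpose Q P g ≫ (R.t ≫ R.bar ◁ f) ▷ Q.bar) ⊗≫ R.bar ◁ Q.s† ⊗≫ 𝟙 _ := by
        conv_lhs => rw [transpose.eq_def R Q f]
        monoidal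
    _ = 𝟙 _ ⊗≫ (R.t ≫ R.bar ◁ f) ▷ P.bar ⊗≫ R.bar ◁ (Y ◁ transpose Q P g ≫ Q.s†) ⊗≫ 𝟙 _ := by
        rw [whisker_exchange]; monoidal
    _ = _ := by
        rw [transpose_s_dagger, transpose]; monoidal

theorem transpose_surjective (R : ConjugateSolution X) (g : R.bar ⟶ R.bar) :
    ∃ f : X ⟶ X, transpose R R f = g := by
  -- The transpose in the opposite direction; the zigzags undo both bendings.
  refine ⟨𝟙 _ ⊗≫ X ◁ R.t ⊗≫ X ◁ g ▷ X ⊗≫ R.s† ▷ X ⊗≫ 𝟙 _, ?_⟩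
  unfold transpose
  calc _ = 𝟙 _ ⊗≫ R.t ▷ R.bar ⊗≫ R.bar ◁ X ◁ (R.t ≫ g ▷ X) ▷ R.bar ⊗≫
        R.bar ◁ (R.s† ▷ (X ⊗ R.bar) ≫ 𝟙_ C ◁ R.s†) ⊗≫ 𝟙 _ := by monoidal
    _ = 𝟙 _ ⊗≫ R.t ▷ R.bar ⊗≫ (R.bar ⊗ X) ◁ (R.t ▷ R.bar ⊗≫ (g ▷ (X ⊗ R.bar) ≫ R.bar ◁ R.s†)) ⊗≫
        R.bar ◁ R.s† ⊗≫ 𝟙 _ := by rw [← whisker_exchange]; monoidal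
    _ = 𝟙 _ ⊗≫ R.t ▷ R.bar ⊗≫ (R.bar ⊗ X) ◁ ((R.t ▷ R.bar ⊗≫ R.bar ◁ R.s†) ⊗≫ g) ⊗≫
        R.bar ◁ R.s† ⊗≫ 𝟙 _ := by rw [← whisker_exchange]; monoidal
    _ = 𝟙 _ ⊗≫ (R.t ▷ R.bar ≫ (R.bar ⊗ X) ◁ g) ⊗≫ R.bar ◁ R.s† ⊗≫ 𝟙 _ := by
        rw [zigzag_bar']; monoidal
    _ = g ⊗≫ (R.t ▷ R.bar ⊗≫ R.bar ◁ R.s†) ⊗≫ 𝟙 _ := by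
        rw [← whisker_exchange]; monoidal
    _ = g := by rw [zigzag_bar']; monoidal

/-- The left trace `t† (1 ⊗ f) t`. -/
def leftTrace (R : ConjugateSolution X) (f : X ⟶ X) : ℂ :=
  unitScalar (R.t ≫ (R.bar ◁ f) ≫ R.t†)

/-- The right trace `s† (f ⊗ 1) s`. -/
def rightTrace (R : ConjugateSolution X) (f : X ⟶ X) : ℂ :=
  unitScalar (R.s ≫ (f ▷ R.bar) ≫ R.s†)

theorem leftTrace_add (R : ConjugateSolution X) (f g : X ⟶ X) :
    R.leftTrace (f + g) = R.leftTrace f + R.leftTrace g := by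
  rw [leftTrace, leftTrace, leftTrace, ← unitScalar_add]; simp

theorem leftTrace_smul (R : ConjugateSolution X) (c : ℂ) (f : X ⟶ X) :
    R.leftTrace (c • f) = c * R.leftTrace f := by
  rw [leftTrace, leftTrace, ← unitScalar_smul]; simp

/-- The double transpose. -/
def doubleTranspose (R : ConjugateSolution X) (Q : ConjugateSolution Y) (f : X ⟶ Y) : X ⟶ Y :=
  transpose Q.conj R.conj (transpose R Q f)

/-- The morphism f leaves through `t` as its transpose and comes back through `t†` as its double
transpose, so the trace property holds up to this twist. In `rightTrace_comp` the twist occurs in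
the opposite direction. -/
theorem leftTrace_comp (R : ConjugateSolution X) (Q : ConjugateSolution Y) (f : X ⟶ Y)
    (g : Y ⟶ X) : R.leftTrace (f ≫ g) = Q.leftTrace (g ≫ doubleTranspose R Q f) := by
  have h2 : Q.bar ◁ doubleTranspose R Q f ≫ Q.t† = transpose R Q f ▷ X ≫ R.t† :=
    transpose_s_dagger Q.conj R.conj (transpose R Q f)
  rw [leftTrace, leftTrace, whiskerLeft_comp, whiskerLeft_comp, Category.assoc, Category.assoc, h2,
    whisker_exchange_assoc, reassoc_of% t_transpose R Q f]

theorem rightTrace_comp (R : ConjugateSolution X) (Q : ConjugateSolution Y) (f : X ⟶ Y)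
    (g : Y ⟶ X) : Q.rightTrace (g ≫ f) = R.rightTrace (doubleTranspose R Q f ≫ g) := by
  have h1 : R.s ≫ doubleTranspose R Q f ▷ R.bar = Q.s ≫ Y ◁ transpose R Q f :=
    t_transpose Q.conj R.conj (transpose R Q f)
  rw [rightTrace, rightTrace, comp_whiskerRight, comp_whiskerRight, Category.assoc, Category.assoc,
    reassoc_of% h1, whisker_exchange_assoc, transpose_s_dagger]

/-- The partial trace `(t† ⊗ 1)(1 ⊗ f)(t ⊗ 1)` of `f : X ⊗ Y ⟶ X ⊗ Z`. -/
def ptr (R : ConjugateSolution X) (f : X ⊗ Y ⟶ X ⊗ Z) : Y ⟶ Z :=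
  (λ_ Y).inv ≫ (R.t ▷ Y) ≫ (α_ R.bar X Y).hom ≫ (R.bar ◁ f) ≫
    (α_ R.bar X Z).inv ≫ (R.t† ▷ Z) ≫ (λ_ Z).hom

/-- The partial trace `(1 ⊗ s†)(f ⊗ 1)(1 ⊗ s)` of `f : Y ⊗ X ⟶ Z ⊗ X`. -/
def rptr (R : ConjugateSolution X) (f : Y ⊗ X ⟶ Z ⊗ X) : Y ⟶ Z :=
  (ρ_ Y).inv ≫ (Y ◁ R.s) ≫ (α_ Y X R.bar).inv ≫ (f ▷ R.bar) ≫
    (α_ Z X R.bar).hom ≫ (Z ◁ R.s†) ≫ (ρ_ Z).hom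

theorem ptr_comp_left (R : ConjugateSolution X) {W : C} (g : W ⟶ Y) (f : X ⊗ Y ⟶ X ⊗ Z) :
    R.ptr (X ◁ g ≫ f) = g ≫ R.ptr f := by
  simp only [ptr, whiskerLeft_comp, Category.assoc, ← leftUnitor_inv_naturality_assoc]
  rw [← associator_naturality_right_assoc, ← whisker_exchange_assoc, leftUnitor_inv_naturality_assoc]

theorem ptr_comp_right (R : ConjugateSolution X) {W : C} (f : X ⊗ Y ⟶ X ⊗ Z) (g : Z ⟶ W) :
    R.ptr (f ≫ X ◁ g) = R.ptr f ≫ g := by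
  simp only [ptr, whiskerLeft_comp, Category.assoc]
  rw [associator_inv_naturality_right_assoc, whisker_exchange_assoc, leftUnitor_naturality]

theorem ptr_add (R : ConjugateSolution X) (f g : X ⊗ Y ⟶ X ⊗ Z) :
    R.ptr (f + g) = R.ptr f + R.ptr g := by
  simp [ptr]

theorem ptr_smul (R : ConjugateSolution X) (c : ℂ) (f : X ⊗ Y ⟶ X ⊗ Z) :
    R.ptr (c • f) = c • R.ptr f := by
  simp [ptr]

/-- The solution for a tensor product. -/
def tensor (R : ConjugateSolution X) (Q : ConjugateSolution Y) : ConjugateSolution (X ⊗ Y) where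
  bar := Q.bar ⊗ R.bar
  s := R.s ≫ X ◁ (λ_ _).inv ≫ X ◁ Q.s ▷ R.bar ≫ X ◁ (α_ _ _ _).hom ≫ (α_ _ _ _).inv
  t := Q.t ≫ Q.bar ◁ (λ_ _).inv ≫ Q.bar ◁ R.t ▷ Y ≫ Q.bar ◁ (α_ _ _ _).hom ≫ (α_ _ _ _).inv
  conj_bar := by
    simp only [dagger_comp, dagger_whiskerLeft, dagger_whiskerRight, dagger_dagger, dagger_id,
      dagger_of_unitary' _ (unitary_leftUnitor _), dagger_of_unitary _ (unitary_associator _ _ _),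
      dagger_of_unitary' _ (unitary_associator _ _ _), Category.assoc]
    calc _ = 𝟙 _ ⊗≫ Q.bar ◁ R.bar ◁ R.s ⊗≫ Q.bar ◁ ((R.bar ⊗ X) ◁ Q.s ≫ R.t† ▷ (Y ⊗ Q.bar)) ▷ R.bar
          ⊗≫ Q.t† ▷ (Q.bar ⊗ R.bar) ⊗≫ 𝟙 _ := by monoidal
      _ = 𝟙 _ ⊗≫ Q.bar ◁ (R.bar ◁ R.s ⊗≫ R.t† ▷ R.bar) ⊗≫ (Q.bar ◁ Q.s ⊗≫ Q.t† ▷ Q.bar) ▷ R.bar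
          ⊗≫ 𝟙 _ := by rw [whisker_exchange]; monoidal
      _ = _ := by rw [zigzag_bar, zigzag_bar]; monoidal
  conj_obj := by
    simp only [dagger_comp, dagger_whiskerLeft, dagger_whiskerRight, dagger_dagger, dagger_id,
      dagger_of_unitary' _ (unitary_leftUnitor _), dagger_of_unitary _ (unitary_associator _ _ _),
      dagger_of_unitary' _ (unitary_associator _ _ _), Category.assoc]
    calc _ = 𝟙 _ ⊗≫ X ◁ Y ◁ Q.t ⊗≫ X ◁ ((Y ⊗ Q.bar) ◁ R.t ≫ Q.s† ▷ (R.bar ⊗ X)) ▷ Y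
          ⊗≫ R.s† ▷ (X ⊗ Y) ⊗≫ 𝟙 _ := by monoidal
      _ = 𝟙 _ ⊗≫ X ◁ (Y ◁ Q.t ⊗≫ Q.s† ▷ Y) ⊗≫ (X ◁ R.t ⊗≫ R.s† ▷ X) ▷ Y
          ⊗≫ 𝟙 _ := by rw [whisker_exchange]; monoidal
      _ = _ := by rw [zigzag_obj, zigzag_obj]; monoidal

theorem tensor_t_dagger (R : ConjugateSolution X) (Q : ConjugateSolution Y) :
    (R.tensor Q).t† = (α_ _ _ _).hom ≫ Q.bar ◁ (α_ _ _ _).inv ≫ Q.bar ◁ R.t† ▷ Y ≫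
      Q.bar ◁ (λ_ _).hom ≫ Q.t† := by
  simp only [tensor, dagger_comp, dagger_whiskerLeft, dagger_whiskerRight, dagger_dagger, dagger_id,
      dagger_of_unitary' _ (unitary_leftUnitor _), dagger_of_unitary _ (unitary_associator _ _ _),
      dagger_of_unitary' _ (unitary_associator _ _ _), Category.assoc]

theorem tensor_s_dagger (R : ConjugateSolution X) (Q : ConjugateSolution Y) :
    (R.tensor Q).s† = (α_ _ _ _).hom ≫ X ◁ (α_ _ _ _).inv ≫ X ◁ Q.s† ▷ R.bar ≫
      X ◁ (λ_ _).hom ≫ R.s† := by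
  simp only [tensor, dagger_comp, dagger_whiskerLeft, dagger_whiskerRight, dagger_dagger, dagger_id,
      dagger_of_unitary' _ (unitary_leftUnitor _), dagger_of_unitary _ (unitary_associator _ _ _),
      dagger_of_unitary' _ (unitary_associator _ _ _), Category.assoc]

theorem ptr_tensor (R : ConjugateSolution X) (Q : ConjugateSolution Y) {A B : C}
    (f : (X ⊗ Y) ⊗ A ⟶ (X ⊗ Y) ⊗ B) :
    (R.tensor Q).ptr f = Q.ptr (R.ptr ((α_ X Y A).inv ≫ f ≫ (α_ X Y B).hom)) := by
  simp only [ptr, tensor_t_dagger]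
  simp only [tensor]
  monoidal

theorem leftTrace_tensor (R : ConjugateSolution X) (Q : ConjugateSolution Y)
    (f : X ⊗ Y ⟶ X ⊗ Y) : (R.tensor Q).leftTrace f = Q.leftTrace (R.ptr f) := by
  simp only [ptr, leftTrace, tensor_t_dagger]
  simp only [tensor]
  congr 1
  monoidal

theorem rightTrace_tensor (R : ConjugateSolution X) (Q : ConjugateSolution Y)
    (f : X ⊗ Y ⟶ X ⊗ Y) : (R.tensor Q).rightTrace f = R.rightTrace (Q.rptr f) := by
  simp only [rptr, rightTrace, tensor_s_dagger]
  simp only [tensor]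
  congr 1
  monoidal

/-- Both sides close the two strands of f, and the interchange law allows the two loops to be closed
in either order. -/
theorem rightTrace_ptr (R : ConjugateSolution X) (Q : ConjugateSolution Y)
    (f : X ⊗ Y ⟶ X ⊗ Y) : Q.rightTrace (R.ptr f) = R.leftTrace (Q.rptr f) := by
  simp only [ptr, rptr, rightTrace, leftTrace]
  congr 1
  calc _ = 𝟙 _ ⊗≫ (𝟙_ C ◁ Q.s ≫ R.t ▷ (Y ⊗ Q.bar)) ⊗≫ R.bar ◁ f ▷ Q.bar ⊗≫
        (R.t† ▷ (Y ⊗ Q.bar) ≫ 𝟙_ C ◁ Q.s†) ⊗≫ 𝟙 _ := by monoidal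
    _ = _ := by rw [whisker_exchange, ← whisker_exchange (R.t†) (Q.s†)]; monoidal

end ConjugateSolution

namespace StandardSolution
variable {X Y Z : C}

open ConjugateSolution

/-- The trace of a standard solution. -/
def trace (R : StandardSolution X) (f : X ⟶ X) : ℂ := R.toConjugateSolution.leftTrace f

theorem rightTrace_eq (R : StandardSolution X) (f : X ⟶ X) :
    R.toConjugateSolution.rightTrace f = R.trace f :=
  congrArg unitScalar (R.standard f).symm

/-- The scalar product on `HilbHom` is built from a choice of solutions for all objects. Completing
a single solution to such a choice makes positivity and definiteness available for it. -/
theorem exists_choice (R : StandardSolution X) : ∃ S : StandardSolutions C, S X = R :=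
  ⟨Function.update (fun Y => Classical.choice (nonempty_standardSolution Y)) X R,
    Function.update_self ..⟩

theorem trace_nonneg (R : StandardSolution X) (f : X ⟶ Y) :
    ∃ r : ℝ, 0 ≤ r ∧ R.trace (f ≫ f†) = r := by
  obtain ⟨S, rfl⟩ := R.exists_choice
  refine ⟨‖toHilb S f‖ ^ 2, by positivity, ?_⟩
  have := inner_self_eq_norm_sq_to_K (𝕜 := ℂ) (toHilb S f)
  rw [HilbHom.inner_def] at this
  push_cast
  exact this

theorem eq_zero_of_trace (R : StandardSolution X) (f : X ⟶ Y) (h : R.trace (f ≫ f†) = 0) :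
    f = 0 := by
  obtain ⟨S, rfl⟩ := R.exists_choice
  exact inner_self_eq_zero (𝕜 := ℂ) (x := toHilb S f).1 h

theorem doubleTranspose_add (R : ConjugateSolution X) (Q : ConjugateSolution Y) (f g : X ⟶ Y) :
    doubleTranspose R Q (f + g) = doubleTranspose R Q f + doubleTranspose R Q g := by
  rw [doubleTranspose, transpose_add, transpose_add]; rfl

theorem doubleTranspose_sub (R : ConjugateSolution X) (Q : ConjugateSolution Y) (f g : X ⟶ Y) :
    doubleTranspose R Q (f - g) = doubleTranspose R Q f - doubleTranspose R Q g := by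
  have := doubleTranspose_add R Q (f - g) g
  rw [sub_add_cancel] at this
  rw [this, add_sub_cancel_right]

theorem trace_sub (R : StandardSolution X) (f g : X ⟶ X) :
    R.trace (f - g) = R.trace f - R.trace g := by
  have := R.leftTrace_add (f - g) g
  rw [sub_add_cancel] at this
  rw [trace, trace, trace, this, add_sub_cancel_right]

/-- Write D for the double transpose. Moving f around by the left trace and then back by the right
trace, which agree by standardness, gives Tr(f g) = Tr(D(D f) g) for all g. Definiteness of the
trace, applied with g the adjoint of the difference, gives D(D f) = f. -/
theorem doubleTranspose_twice (R : StandardSolution X) (Q : StandardSolution Y) (f : X ⟶ Y) :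
    doubleTranspose R.toConjugateSolution Q.toConjugateSolution
      (doubleTranspose R.toConjugateSolution Q.toConjugateSolution f) = f := by
  set D := doubleTranspose R.toConjugateSolution Q.toConjugateSolution
  have key : ∀ g : Y ⟶ X, R.trace (f ≫ g) = R.trace (D (D f) ≫ g) := fun g => by
    rw [trace, leftTrace_comp R.toConjugateSolution Q.toConjugateSolution f g]
    change Q.trace _ = _
    rw [← rightTrace_eq, rightTrace_comp R.toConjugateSolution Q.toConjugateSolution,
      rightTrace_eq]
  have h := key ((f - D (D f))†)
  rw [← sub_eq_zero, ← trace_sub, ← Preadditive.sub_comp] at h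
  exact (sub_eq_zero.1 (R.eq_zero_of_trace _ h)).symm

/-- The double transpose with respect to standard solutions is the identity. -/
theorem doubleTranspose_eq (R : StandardSolution X) (Q : StandardSolution Y) (f : X ⟶ Y) :
    doubleTranspose R.toConjugateSolution Q.toConjugateSolution f = f := by
  set D := doubleTranspose R.toConjugateSolution Q.toConjugateSolution with hD
  -- Since D has square one, q = f - D f satisfies D q = -q. The twisted trace property then reads
  -- Tr(q ≫ q†) = -Tr(q† ≫ q), and both traces are nonnegative, so q = 0.
  have hq : D (f - D f) = -(f - D f) := by
    rw [hD, doubleTranspose_sub, doubleTranspose_twice, neg_sub]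
  have h := leftTrace_comp R.toConjugateSolution Q.toConjugateSolution (f - D f) ((f - D f)†)
  rw [← hD, hq, Preadditive.comp_neg] at h
  obtain ⟨r, hr, h1⟩ := R.trace_nonneg (f - D f)
  obtain ⟨r', hr', h2⟩ := Q.trace_nonneg ((f - D f)†)
  rw [dagger_dagger] at h2
  have h3 : Q.toConjugateSolution.leftTrace (-((f - D f)† ≫ (f - D f))) = -r' := by
    rw [← neg_one_smul ℂ, leftTrace_smul]
    change -1 * Q.trace _ = _
    rw [h2]; ring
  rw [h3] at h
  change R.trace _ = _ at h
  rw [h1] at h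
  have h4 : r = -r' := by exact_mod_cast h
  have h5 : r = 0 := by linarith
  rw [h5, Complex.ofReal_zero] at h1
  exact (sub_eq_zero.1 (R.eq_zero_of_trace _ h1)).symm

/-- The transpose of `f : X ⟶ Y` with respect to standard solutions. -/
abbrev transpose (R : StandardSolution X) (Q : StandardSolution Y) (f : X ⟶ Y) : Q.bar ⟶ R.bar :=
  R.toConjugateSolution.transpose Q.toConjugateSolution f

theorem transpose_t_dagger (R : StandardSolution X) (Q : StandardSolution Y) (f : X ⟶ Y) :
    R.transpose Q f ▷ X ≫ R.t† = Q.bar ◁ f ≫ Q.t† := by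
  have h2 : Q.bar ◁ doubleTranspose _ _ f ≫ Q.t† = R.transpose Q f ▷ X ≫ R.t† :=
    transpose_s_dagger Q.toConjugateSolution.conj R.toConjugateSolution.conj
      (R.toConjugateSolution.transpose Q.toConjugateSolution f)
  rw [← h2, doubleTranspose_eq]

theorem s_transpose (R : StandardSolution X) (Q : StandardSolution Y) (f : X ⟶ Y) :
    Q.s ≫ Y ◁ R.transpose Q f = R.s ≫ f ▷ R.bar := by
  have h1 : R.s ≫ doubleTranspose _ _ f ▷ R.bar = Q.s ≫ Y ◁ R.transpose Q f :=
    t_transpose Q.toConjugateSolution.conj R.toConjugateSolution.conj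
      (R.toConjugateSolution.transpose Q.toConjugateSolution f)
  rw [← h1, doubleTranspose_eq]

theorem trace_comm (R : StandardSolution X) (Q : StandardSolution Y) (f : X ⟶ Y) (g : Y ⟶ X) :
    R.trace (f ≫ g) = Q.trace (g ≫ f) := by
  rw [trace, leftTrace_comp R.toConjugateSolution Q.toConjugateSolution, doubleTranspose_eq, trace]

/-- Traciality was proved for two unrelated solutions, so its case f, 1 : X ⟶ X compares two
solutions for the same object. Traces over α ⊗ β or over a conjugate can therefore be computed with
the product or conjugate solution, whatever solution was chosen for that object. -/
theorem trace_eq (R Q : StandardSolution X) (f : X ⟶ X) : R.trace f = Q.trace f := by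
  have := trace_comm R Q f (𝟙 X)
  rwa [Category.comp_id, Category.id_comp] at this

theorem ptr_slide (R : StandardSolution X) (Q : StandardSolution Y) {A B : C} (f : X ⟶ Y)
    (F : Y ⊗ A ⟶ X ⊗ B) : R.ptr (f ▷ A ≫ F) = Q.ptr (F ≫ f ▷ B) := by
  calc R.ptr (f ▷ A ≫ F)
      = (λ_ A).inv ≫ ((R.t ≫ R.bar ◁ f) ▷ A) ≫ (α_ R.bar Y A).hom ≫ (R.bar ◁ F) ≫
        (α_ R.bar X B).inv ≫ (R.t† ▷ B) ≫ (λ_ B).hom := by rw [ptr]; monoidal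
    _ = (λ_ A).inv ≫ (Q.t ▷ A) ≫ (α_ Q.bar Y A).hom ≫ (R.transpose Q f ▷ (Y ⊗ A) ≫ R.bar ◁ F) ≫
        (α_ R.bar X B).inv ≫ (R.t† ▷ B) ≫ (λ_ B).hom := by
          rw [← t_transpose R.toConjugateSolution Q.toConjugateSolution, StandardSolution.transpose]
          monoidal
    _ = (λ_ A).inv ≫ (Q.t ▷ A) ≫ (α_ Q.bar Y A).hom ≫ Q.bar ◁ F ≫
        (α_ Q.bar X B).inv ≫ ((R.transpose Q f ▷ X ≫ R.t†) ▷ B) ≫ (λ_ B).hom := by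
          rw [← whisker_exchange, StandardSolution.transpose]; monoidal
    _ = _ := by rw [transpose_t_dagger, ptr]; monoidal

theorem ptr_eq (R Q : StandardSolution X) {A B : C} (F : X ⊗ A ⟶ X ⊗ B) : R.ptr F = Q.ptr F := by
  have := ptr_slide R Q (𝟙 X) F
  simpa using this

/-- The standard solution for a tensor product. -/
def tensor (R : StandardSolution X) (Q : StandardSolution Y) : StandardSolution (X ⊗ Y) where
  toConjugateSolution := R.toConjugateSolution.tensor Q.toConjugateSolution
  standard f := by
    -- The left trace closes X before Y, the right trace closes Y before X. Each factor has equal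
    -- left and right traces, and `rightTrace_ptr` exchanges the order of closing.
    have h : (R.toConjugateSolution.tensor Q.toConjugateSolution).leftTrace f =
        (R.toConjugateSolution.tensor Q.toConjugateSolution).rightTrace f := by
      rw [leftTrace_tensor, rightTrace_tensor, rightTrace_eq]
      change Q.trace _ = _
      rw [← rightTrace_eq, rightTrace_ptr]
      rfl
    rw [unitScalar_spec (_ ≫ _ ≫ (R.toConjugateSolution.tensor Q.toConjugateSolution).t†),
      unitScalar_spec (_ ≫ _ ≫ (R.toConjugateSolution.tensor Q.toConjugateSolution).s†)]
    exact congrArg (· • 𝟙 (𝟙_ C)) h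

/-- The standard solution for the conjugate object. -/
def conj (R : StandardSolution X) : StandardSolution R.bar where
  toConjugateSolution := R.toConjugateSolution.conj
  standard g := by
    -- Every endomorphism of the conjugate is a transpose, and transposition carries the required
    -- equality to the standardness of R.
    obtain ⟨f, rfl⟩ : ∃ f : X ⟶ X, R.transpose R f = g := transpose_surjective _ g
    change R.s ≫ X ◁ _ ≫ R.s† = R.t ≫ _ ▷ X ≫ R.t†
    rw [← Category.assoc, s_transpose, ← Category.assoc, t_transpose, Category.assoc, Category.assoc,
      R.standard]

/-- The standard solution for the unit object. -/
def unit : StandardSolution (𝟙_ C) where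
  bar := 𝟙_ C
  s := (λ_ (𝟙_ C)).inv
  t := (λ_ (𝟙_ C)).inv
  conj_bar := by
    rw [dagger_of_unitary' _ (unitary_leftUnitor _)]; monoidal
  conj_obj := by
    rw [dagger_of_unitary' _ (unitary_leftUnitor _)]; monoidal
  standard f := by
    rw [dagger_of_unitary' _ (unitary_leftUnitor _)]; monoidal

end StandardSolution

end

/-! ### Calculus of the trace, the partial traces and Frobenius reciprocity. -/

section

namespace StandardSolutions
variable (S : StandardSolutions C) {X Y Z W : C}

open ConjugateSolution

theorem tr_comm (f : X ⟶ Y) (g : Y ⟶ X) : S.tr X (f ≫ g) = S.tr Y (g ≫ f) :=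
  StandardSolution.trace_comm (S X) (S Y) f g

theorem tr_add (f g : X ⟶ X) : S.tr X (f + g) = S.tr X f + S.tr X g :=
  (S X).leftTrace_add f g

theorem tr_smul (c : ℂ) (f : X ⟶ X) : S.tr X (c • f) = c * S.tr X f :=
  (S X).leftTrace_smul c f

variable (X) in
/-- The trace as a linear functional. -/
def trₗ : (X ⟶ X) →ₗ[ℂ] ℂ where
  toFun := S.tr X
  map_add' := S.tr_add
  map_smul' := S.tr_smul

/-- The right partial trace `(id ⊗ Tr_X)(f)`. -/
def rightPartialTrace (X : C) {Y Z : C} (f : Y ⊗ X ⟶ Z ⊗ X) : Y ⟶ Z :=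
  (S X).toConjugateSolution.rptr f

theorem partialTrace_eq (R : StandardSolution X) (f : X ⊗ Y ⟶ X ⊗ Z) :
    S.partialTrace X f = R.ptr f := StandardSolution.ptr_eq (S X) R f

theorem tr_eq (R : StandardSolution X) (f : X ⟶ X) : S.tr X f = R.trace f :=
  StandardSolution.trace_eq (S X) R f

theorem tr_tensor_left (f : X ⊗ Y ⟶ X ⊗ Y) : S.tr (X ⊗ Y) f = S.tr Y (S.partialTrace X f) := by
  rw [tr_eq S ((S X).tensor (S Y))]
  exact leftTrace_tensor _ _ f

theorem tr_tensor_right (f : X ⊗ Y ⟶ X ⊗ Y) :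
    S.tr (X ⊗ Y) f = S.tr X (S.rightPartialTrace Y f) := by
  rw [tr_eq S ((S X).tensor (S Y)), ← StandardSolution.rightTrace_eq]
  refine (rightTrace_tensor _ _ f).trans ?_
  rw [StandardSolution.rightTrace_eq]; rfl

theorem partialTrace_tensor {A B : C} (f : (X ⊗ Y) ⊗ A ⟶ (X ⊗ Y) ⊗ B) :
    S.partialTrace (X ⊗ Y) f =
      S.partialTrace Y (S.partialTrace X ((α_ X Y A).inv ≫ f ≫ (α_ X Y B).hom)) := by
  rw [partialTrace_eq S ((S X).tensor (S Y))]
  exact ptr_tensor _ _ f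

theorem partialTrace_unit {A B : C} (f : 𝟙_ C ⊗ A ⟶ 𝟙_ C ⊗ B) :
    S.partialTrace (𝟙_ C) f = (λ_ A).inv ≫ f ≫ (λ_ B).hom := by
  rw [partialTrace_eq S StandardSolution.unit, ptr]
  simp only [StandardSolution.unit, dagger_of_unitary' _ (unitary_leftUnitor _)]
  monoidal

theorem partialTrace_slide {A B : C} (f : X ⟶ Y) (F : Y ⊗ A ⟶ X ⊗ B) :
    S.partialTrace X (f ▷ A ≫ F) = S.partialTrace Y (F ≫ f ▷ B) :=
  StandardSolution.ptr_slide (S X) (S Y) f F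

theorem partialTrace_comp_left (g : W ⟶ Y) (f : X ⊗ Y ⟶ X ⊗ Z) :
    S.partialTrace X (X ◁ g ≫ f) = g ≫ S.partialTrace X f := ptr_comp_left _ g f

theorem partialTrace_comp_right (f : X ⊗ Y ⟶ X ⊗ Z) (g : Z ⟶ W) :
    S.partialTrace X (f ≫ X ◁ g) = S.partialTrace X f ≫ g := ptr_comp_right _ f g

variable (X Y Z) in
/-- The partial trace as a linear map. -/
def partialTraceₗ : (X ⊗ Y ⟶ X ⊗ Z) →ₗ[ℂ] (Y ⟶ Z) where
  toFun := S.partialTrace X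
  map_add' := ptr_add (S X).toConjugateSolution
  map_smul' := ptr_smul (S X).toConjugateSolution

theorem partialTrace_id : S.partialTrace X (𝟙 (X ⊗ Y)) = S.dim X • 𝟙 Y := by
  change (S X).toConjugateSolution.ptr (𝟙 _) = _
  have h := unitScalar_spec ((S X).t ≫ (S X).bar ◁ (𝟙 X) ≫ (S X).t†)
  have h' : (S X).t ≫ (S X).t† = S.dim X • 𝟙 (𝟙_ C) := by
    rw [MonoidalCategory.whiskerLeft_id, Category.id_comp] at h
    rw [h, dim, tr, MonoidalCategory.whiskerLeft_id, Category.id_comp]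
  calc _ = (λ_ Y).inv ≫ ((S X).t ≫ (S X).t†) ▷ Y ≫ (λ_ Y).hom := by rw [ptr]; monoidal
    _ = _ := by
      rw [h', MonoidalLinear.smul_whiskerRight, Linear.smul_comp, Linear.comp_smul]
      simp

theorem partialTrace_whiskerLeft (g : Y ⟶ Z) :
    S.partialTrace X (X ◁ g) = S.dim X • g := by
  have := S.partialTrace_comp_right (𝟙 (X ⊗ Y)) g
  rw [Category.id_comp, partialTrace_id, Linear.smul_comp, Category.id_comp] at this
  exact this

theorem tr_whiskerLeft (g : Y ⟶ Y) : S.tr (X ⊗ Y) (X ◁ g) = S.dim X * S.tr Y g := by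
  rw [tr_tensor_left, partialTrace_whiskerLeft, tr_smul]

theorem rightPartialTrace_comp_left (g : W ⟶ Y) (f : Y ⊗ X ⟶ Z ⊗ X) :
    S.rightPartialTrace X (g ▷ X ≫ f) = g ≫ S.rightPartialTrace X f := by
  simp only [rightPartialTrace, rptr]
  calc _ = (ρ_ W).inv ≫ (W ◁ (S X).s ≫ g ▷ (X ⊗ (S X).bar)) ≫ (α_ Y X (S X).bar).inv ≫
        f ▷ (S X).bar ≫ (α_ Z X (S X).bar).hom ≫ (Z ◁ (S X).s†) ≫ (ρ_ Z).hom := by monoidal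
    _ = _ := by rw [whisker_exchange]; monoidal

theorem rightPartialTrace_id : S.rightPartialTrace X (𝟙 (Y ⊗ X)) = S.dim X • 𝟙 Y := by
  have h := unitScalar_spec ((S X).s ≫ (𝟙 X) ▷ (S X).bar ≫ (S X).s†)
  have h' : (S X).s ≫ (S X).s† = S.dim X • 𝟙 (𝟙_ C) := by
    rw [id_whiskerRight, Category.id_comp] at h
    rw [h, dim, tr, (S X).standard, id_whiskerRight, Category.id_comp]
  calc _ = (ρ_ Y).inv ≫ Y ◁ ((S X).s ≫ (S X).s†) ≫ (ρ_ Y).hom := by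
          rw [rightPartialTrace, rptr]; monoidal
    _ = _ := by
      rw [h', MonoidalLinear.whiskerLeft_smul, Linear.smul_comp, Linear.comp_smul]
      simp

theorem rightPartialTrace_whiskerRight (g : Y ⟶ Z) :
    S.rightPartialTrace X (g ▷ X) = S.dim X • g := by
  have := S.rightPartialTrace_comp_left g (𝟙 (Z ⊗ X))
  rw [Category.comp_id, rightPartialTrace_id, Linear.comp_smul, Category.comp_id] at this
  exact this

theorem tr_whiskerRight (g : Y ⟶ Y) : S.tr (Y ⊗ X) (g ▷ X) = S.dim X * S.tr Y g := by
  rw [tr_tensor_right, rightPartialTrace_whiskerRight, tr_smul]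

theorem tr_whiskerRight_comp (h : Y ⟶ Z) (F : Z ⊗ X ⟶ Y ⊗ X) :
    S.tr (Y ⊗ X) (h ▷ X ≫ F) = S.tr Y (h ≫ S.rightPartialTrace X F) := by
  rw [tr_tensor_right, rightPartialTrace_comp_left]

variable (X Y) in
/-- The morphism `s ⊗ 1 : Y ⟶ X X̄ Y`. -/
def cup : Y ⟶ X ⊗ ((S X).bar ⊗ Y) :=
  (λ_ Y).inv ≫ (S X).s ▷ Y ≫ (α_ X (S X).bar Y).hom

variable (X Y) in
/-- The morphism `s† ⊗ 1 : X X̄ Y ⟶ Y`. -/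
def cap : X ⊗ ((S X).bar ⊗ Y) ⟶ Y :=
  (α_ X (S X).bar Y).inv ≫ (S X).s† ▷ Y ≫ (λ_ Y).hom

theorem cup_dagger : (S.cup X Y)† = S.cap X Y := by
  simp only [cup, cap, dagger_comp, dagger_whiskerRight,
      dagger_of_unitary' _ (unitary_leftUnitor _), dagger_of_unitary _ (unitary_associator _ _ _),
      Category.assoc]

theorem cap_naturality (f : Y ⟶ Z) : S.cap X Y ≫ f = X ◁ (S X).bar ◁ f ≫ S.cap X Z := by
  simp only [cap, Category.assoc]
  calc _ = (α_ X (S X).bar Y).inv ≫ ((S X).s† ▷ Y ≫ 𝟙_ C ◁ f) ≫ (λ_ Z).hom := by monoidal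
    _ = _ := by rw [← whisker_exchange]; monoidal

theorem partialTrace_cap (f : Y ⟶ X ⊗ Z) : S.partialTrace X (S.cap X Y ≫ f) =
    (S X).bar ◁ f ≫ (α_ (S X).bar X Z).inv ≫ (S X).t† ▷ Z ≫ (λ_ Z).hom := by
  rw [cap_naturality, partialTrace_comp_left]
  congr 1
  change (S X).toConjugateSolution.ptr _ = _
  rw [ptr, cap]
  calc _ = 𝟙 _ ⊗≫ ((S X).t ▷ (S X).bar ⊗≫ (S X).bar ◁ (S X).s†) ▷ (X ⊗ Z) ⊗≫
        (S X).t† ▷ Z ⊗≫ 𝟙 _ := by monoidal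
    _ = _ := by rw [zigzag_bar']; monoidal

/-- Frobenius reciprocity: the partial trace of `cap` followed by f is the mate X̄ ⊗ Y ⟶ Z of f
(`partialTrace_cap`), and bending X̄ back by `cup` returns f. -/
theorem cup_partialTrace (f : Y ⟶ X ⊗ Z) :
    S.cup X Y ≫ X ◁ S.partialTrace X (S.cap X Y ≫ f) = f := by
  rw [partialTrace_cap, cup]
  calc _ = 𝟙 _ ⊗≫ ((S X).s ▷ Y ≫ (X ⊗ (S X).bar) ◁ f) ⊗≫ X ◁ (S X).t† ▷ Z ⊗≫ 𝟙 _ := by monoidal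
    _ = f ⊗≫ ((S X).s ▷ X ⊗≫ X ◁ (S X).t†) ▷ Z ⊗≫ 𝟙 _ := by
      rw [← whisker_exchange]; monoidal
    _ = _ := by rw [zigzag_obj']; monoidal

/-- The pair `s`, `s†` is the cup and cap of the conjugate solution for X̄, so the left side is an
iterated trace over X̄ ⊗ Y. Consequently bending with `cup` preserves the trace scalar product. -/
theorem tr_cup_cap (h : (S X).bar ⊗ Y ⟶ (S X).bar ⊗ Y) :
    S.tr Y (S.cup X Y ≫ X ◁ h ≫ S.cap X Y) = S.tr ((S X).bar ⊗ Y) h := by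
  rw [tr_tensor_left, partialTrace_eq S (S X).conj]
  simp only [cup, cap, Category.assoc]
  rfl

/-- The dimension is the trace of a positive morphism, hence a nonnegative real; its norm can stand
for it under square roots. -/
theorem dim_eq_trace (X : C) : S.dim X = ‖S.dim X‖ := by
  obtain ⟨r, hr, h⟩ := (S X).trace_nonneg (𝟙 X)
  rw [dagger_id, Category.comp_id] at h
  change S.dim X = r at h
  rw [h, Complex.norm_real, Real.norm_of_nonneg hr]

end StandardSolutions

section
variable (S : StandardSolutions C) {X Y Z W : C}

theorem inner_toHilb (f g : X ⟶ Y) : inner ℂ (toHilb S f) (toHilb S g) = S.tr X (g ≫ f†) := rfl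

theorem norm_toHilb_dagger (f : X ⟶ Y) : ‖toHilb S (f†)‖ = ‖toHilb S f‖ := by
  have h : ∀ {X Y : C} (f : X ⟶ Y), ‖toHilb S f‖ ^ 2 = RCLike.re (S.tr X (f ≫ f†)) :=
    fun f => (inner_self_eq_norm_sq (𝕜 := ℂ) (toHilb S f)).symm
  rw [← sq_eq_sq₀ (norm_nonneg _) (norm_nonneg _), h, h, dagger_dagger, S.tr_comm]

theorem norm_toHilb_comp_le' (g : W ⟶ X) (f : X ⟶ Y) :
    ‖toHilb S (g ≫ f)‖ ≤ ‖g‖ * ‖toHilb S f‖ := by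
  rw [← norm_toHilb_dagger, dagger_comp, ← norm_toHilb_dagger S f, ← norm_dagger g]
  exact norm_toHilb_comp_le S _ _

theorem inner_whiskerLeft (f g : X ⟶ Y) :
    inner ℂ (toHilb S (Z ◁ f)) (toHilb S (Z ◁ g)) = S.dim Z * inner ℂ (toHilb S f) (toHilb S g) := by
  rw [inner_toHilb, inner_toHilb, dagger_whiskerLeft, ← whiskerLeft_comp, S.tr_whiskerLeft]

theorem inner_whiskerRight (f g : X ⟶ Y) :
    inner ℂ (toHilb S (f ▷ Z)) (toHilb S (g ▷ Z)) = S.dim Z * inner ℂ (toHilb S f) (toHilb S g) := by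
  rw [inner_toHilb, inner_toHilb, dagger_whiskerRight, ← comp_whiskerRight, S.tr_whiskerRight]

theorem inner_whiskerLeft_right (f : Z ⊗ X ⟶ Z ⊗ Y) (g : X ⟶ Y) :
    inner ℂ (toHilb S (Z ◁ g)) (toHilb S f) =
      inner ℂ (toHilb S g) (toHilb S (S.partialTrace Z f)) := by
  rw [inner_toHilb, inner_toHilb, dagger_whiskerLeft, S.tr_tensor_left, S.partialTrace_comp_right]

theorem norm_whiskerLeft_toHilb (f : X ⟶ Y) :
    ‖toHilb S (Z ◁ f)‖ = √‖S.dim Z‖ * ‖toHilb S f‖ := by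
  rw [← sq_eq_sq₀ (by positivity) (by positivity), mul_pow, Real.sq_sqrt (norm_nonneg _)]
  have h1 := inner_self_eq_norm_sq_to_K (𝕜 := ℂ) (toHilb S (Z ◁ f))
  rw [inner_whiskerLeft, inner_self_eq_norm_sq_to_K, S.dim_eq_trace] at h1
  simp only [Complex.coe_algebraMap] at h1
  exact_mod_cast h1.symm

theorem norm_whiskerRight_toHilb (f : X ⟶ Y) :
    ‖toHilb S (f ▷ Z)‖ = √‖S.dim Z‖ * ‖toHilb S f‖ := by
  rw [← sq_eq_sq₀ (by positivity) (by positivity), mul_pow, Real.sq_sqrt (norm_nonneg _)]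
  have h1 := inner_self_eq_norm_sq_to_K (𝕜 := ℂ) (toHilb S (f ▷ Z))
  rw [inner_whiskerRight, inner_self_eq_norm_sq_to_K, S.dim_eq_trace] at h1
  simp only [Complex.coe_algebraMap] at h1
  exact_mod_cast h1.symm

/-- The partial trace is the adjoint of g ↦ 1 ⊗ g, which multiplies trace norms by the square root
of the dimension. -/
theorem norm_partialTrace_toHilb_le (f : Z ⊗ X ⟶ Z ⊗ Y) :
    ‖toHilb S (S.partialTrace Z f)‖ ≤ √‖S.dim Z‖ * ‖toHilb S f‖ := by
  rcases (norm_nonneg (toHilb S (S.partialTrace Z f))).eq_or_lt with h | h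
  · rw [← h]; positivity
  · have h1 : ‖toHilb S (S.partialTrace Z f)‖ ^ 2 ≤
        ‖toHilb S (Z ◁ S.partialTrace Z f)‖ * ‖toHilb S f‖ := by
      rw [← inner_self_eq_norm_sq (𝕜 := ℂ), ← inner_whiskerLeft_right]
      exact (RCLike.re_le_norm _).trans (norm_inner_le_norm _ _)
    rw [norm_whiskerLeft_toHilb] at h1
    nlinarith

theorem norm_whiskerLeft_le (Z : C) (f : X ⟶ Y) : ‖Z ◁ f‖ ≤ ‖f‖ := by
  let φ : EndAlg X →⋆ₐ[ℂ] EndAlg (Z ⊗ X) :=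
    { toFun := fun g => Z ◁ (show X ⟶ X from g)
      map_one' := MonoidalCategory.whiskerLeft_id Z X
      map_mul' := fun g h => whiskerLeft_comp Z (show X ⟶ X from h) (show X ⟶ X from g)
      map_zero' := MonoidalPreadditive.whiskerLeft_zero
      map_add' := fun g h => MonoidalPreadditive.whiskerLeft_add (show X ⟶ X from g) _
      commutes' := fun c => by
        rw [Algebra.algebraMap_eq_smul_one, Algebra.algebraMap_eq_smul_one]
        exact (MonoidalLinear.whiskerLeft_smul Z c (𝟙 X)).trans
          (congrArg (c • ·) (MonoidalCategory.whiskerLeft_id Z X))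
      map_star' := fun g => (dagger_whiskerLeft Z (show X ⟶ X from g)).symm }
  have h : ‖Z ◁ (f ≫ f†)‖ ≤ ‖f ≫ f†‖ :=
    NonUnitalStarAlgHom.norm_apply_le (A := EndAlg X) φ (f ≫ f†)
  rw [← norm_sq_eq, whiskerLeft_comp, ← dagger_whiskerLeft, ← norm_sq_eq] at h
  exact le_of_sq_le_sq h (norm_nonneg _)

end

end

/-! ### Hilbert space direct sums and operators on the spaces (X, γ). -/

section

theorem hasSum_of_eq {J M : Type*} [AddCommMonoid M] [TopologicalSpace M] {f g : J → M} {a : M}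
    (h : HasSum f a) (e : ∀ k, f k = g k) : HasSum g a := funext e ▸ h

section lpLift
variable {J : Type*} {E : J → Type*} [∀ j, NormedAddCommGroup (E j)] [∀ j, InnerProductSpace ℂ (E j)]
  {F : Type*} [NormedAddCommGroup F] [InnerProductSpace ℂ F] [CompleteSpace F]

theorem lp_sum_sq_le (x : lp E 2) (s : Finset J) : ∑ j ∈ s, ‖x j‖ ^ 2 ≤ ‖x‖ ^ 2 := by
  have := lp.sum_rpow_le_norm_rpow (p := 2) (by norm_num) x s
  simpa using this

theorem lp_hasSum_sq (x : lp E 2) : HasSum (fun j => ‖x j‖ ^ 2) (‖x‖ ^ 2) := by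
  have := lp.hasSum_norm (p := 2) (by norm_num) x
  simpa using this

theorem lp_norm_le_of_sum_sq_le {x : lp E 2} {c : ℝ} (hc : 0 ≤ c)
    (h : ∀ s : Finset J, ∑ j ∈ s, ‖x j‖ ^ 2 ≤ c ^ 2) : ‖x‖ ≤ c :=
  lp.norm_le_of_forall_sum_le (p := 2) (by norm_num) hc (by simpa using h)

theorem memlp_of_sum_sq_le {x : ∀ j, E j} {c : ℝ}
    (h : ∀ s : Finset J, ∑ j ∈ s, ‖x j‖ ^ 2 ≤ c) : Memℓp x 2 :=
  memℓp_gen' (C := c) (by simpa using h)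

variable (f : ∀ j, E j →ₗ[ℂ] F) (c : ℝ)
  (h : ∀ (s : Finset J) (x : ∀ j, E j), ‖∑ j ∈ s, f j (x j)‖ ^ 2 ≤ c * ∑ j ∈ s, ‖x j‖ ^ 2)

include h in
theorem summable_lpLift (x : lp E 2) : Summable fun j => f j (x j) := by
  rw [summable_iff_vanishing_norm]
  intro ε hε
  have h1 := (lp_hasSum_sq x).summable
  rw [summable_iff_vanishing_norm] at h1
  obtain ⟨s, hs⟩ := h1 (ε ^ 2 / (|c| + 1)) (by positivity)
  refine ⟨s, fun t ht => ?_⟩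
  have h2 := hs t ht
  rw [Real.norm_of_nonneg (Finset.sum_nonneg fun _ _ => by positivity), lt_div_iff₀ (by positivity)] at h2
  have h3 := h t (fun j => x j)
  have h4 : (0 : ℝ) ≤ ∑ j ∈ t, ‖x j‖ ^ 2 := Finset.sum_nonneg fun _ _ => by positivity
  refine lt_of_pow_lt_pow_left₀ 2 hε.le (lt_of_le_of_lt h3 (lt_of_le_of_lt ?_ h2))
  nlinarith [le_abs_self c]

/-- The bounded operator on a Hilbert space direct sum with given restrictions to the summands. -/
def lpLift : lp E 2 →L[ℂ] F :=
  LinearMap.mkContinuous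
    { toFun := fun x => ∑' j, f j (x j)
      map_add' := fun x y => by
        rw [← (summable_lpLift f c h x).tsum_add (summable_lpLift f c h y)]
        simp
      map_smul' := fun a x => by
        rw [RingHom.id_apply, ← (summable_lpLift f c h x).tsum_const_smul]
        simp } (√c) (fun x => by
      have h1 := (summable_lpLift f c h x).hasSum
      refine le_of_tendsto h1.norm (Filter.Eventually.of_forall fun s => ?_)
      have h3 : ‖∑ j ∈ s, f j (x j)‖ ^ 2 ≤ c * ∑ j ∈ s, ‖x j‖ ^ 2 := h s (fun j => x j)
      have h4 := lp_sum_sq_le x s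
      have h5 : (0 : ℝ) ≤ ∑ j ∈ s, ‖x j‖ ^ 2 := Finset.sum_nonneg fun _ _ => by positivity
      -- The constant is not assumed nonnegative; a negative one forces all these partial sums to
      -- vanish.
      rcases le_or_gt 0 c with hc | hc
      · refine le_of_sq_le_sq (h3.trans ?_) (by positivity)
        rw [mul_pow, Real.sq_sqrt hc]
        gcongr
      · have : ‖∑ j ∈ s, f j (x j)‖ ^ 2 ≤ 0 := by nlinarith
        have h6 : ‖∑ j ∈ s, f j (x j)‖ = 0 := by
          have := le_antisymm this (by positivity)
          exact pow_eq_zero_iff two_ne_zero |>.1 this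
        rw [h6]
        positivity)

theorem hasSum_lpLift (x : lp E 2) : HasSum (fun j => f j (x j)) (lpLift f c h x) :=
  (summable_lpLift f c h x).hasSum

theorem lpLift_single (j : J) (x : E j) : lpLift f c h (lp.single 2 j x) = f j x := by
  refine (hasSum_lpLift f c h _).unique ?_
  have := hasSum_ite_eq j (f j x)
  convert this using 2 with l
  by_cases hl : l = j
  · subst hl; simp
  · simp [lp.single_apply_ne _ _ _ hl, hl]

theorem norm_lpLift_le : ‖lpLift f c h‖ ≤ √c :=
  LinearMap.mkContinuous_norm_le _ (Real.sqrt_nonneg _) _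

end lpLift

namespace IndObj.HomSpace
variable {S : StandardSolutions C} {X Y : IndObj.{w} C} {γ δ : C}



theorem ext' {ξ η : X.HomSpace S γ} (h : ∀ k, ξ.component k = η.component k) : ξ = η :=
  lp.ext (funext h)

/-- The vector with given components. -/
def mk (f : ∀ k, γ ⟶ X.obj k) (h : Memℓp (fun k => toHilb S (f k)) 2) : X.HomSpace S γ :=
  ⟨fun k => toHilb S (f k), h⟩

variable (S X γ) in
/-- The component as a continuous linear map. -/
def componentL (k : X.ι) : X.HomSpace S γ →L[ℂ] HilbHom S γ (X.obj k) :=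
  lp.evalCLM ℂ (fun k : X.ι => HilbHom S γ (X.obj k)) 2 k

theorem hasSum_inner (ξ η : X.HomSpace S γ) :
    HasSum (fun k => S.tr γ (η.component k ≫ (ξ.component k)†)) (inner ℂ ξ η) :=
  lp.hasSum_inner (G := fun k : X.ι => HilbHom S γ (X.obj k)) ξ η

variable (S X) in
/-- The vector with one nonzero component. -/
def single (k : X.ι) (x : γ ⟶ X.obj k) : X.HomSpace S γ :=
  lp.single (E := fun k : X.ι => HilbHom S γ (X.obj k)) 2 k (toHilb S x)

theorem single_component_self (k : X.ι) (x : γ ⟶ X.obj k) : (single S X k x).component k = x :=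
  lp.single_apply_self (E := fun k : X.ι => HilbHom S γ (X.obj k)) 2 k (toHilb S x)

theorem single_component_ne {k l : X.ι} (x : γ ⟶ X.obj k) (h : l ≠ k) :
    (single S X k x).component l = 0 :=
  lp.single_apply_ne (E := fun k : X.ι => HilbHom S γ (X.obj k)) 2 k (toHilb S x) h

theorem single_component (k l : X.ι) (x : γ ⟶ X.obj k) :
    (single S X k x).component l = x ≫ IndMat.id X l k := by
  unfold IndMat.id
  split_ifs with h
  · subst h; rw [single_component_self]; simp
  · rw [single_component_ne _ (Ne.symm h)]; simp

theorem inner_single_left (k : X.ι) (x : γ ⟶ X.obj k) (ξ : X.HomSpace S γ) :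
    inner ℂ (single S X k x) ξ = inner ℂ (toHilb S x) (toHilb S (ξ.component k)) :=
  lp.inner_single_left (G := fun k : X.ι => HilbHom S γ (X.obj k)) k (toHilb S x) ξ

theorem inner_single_right (k : X.ι) (x : γ ⟶ X.obj k) (ξ : X.HomSpace S γ) :
    inner ℂ ξ (single S X k x) = inner ℂ (toHilb S (ξ.component k)) (toHilb S x) :=
  lp.inner_single_right (G := fun k : X.ι => HilbHom S γ (X.obj k)) k (toHilb S x) ξ

theorem hasSum_single (ξ : X.HomSpace S γ) :
    HasSum (fun k => single S X k (ξ.component k)) ξ :=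
  lp.hasSum_single (E := fun k : X.ι => HilbHom S γ (X.obj k)) (by norm_num) ξ

variable (S X) in
/-- The vector given by the inclusion of a summand. -/
def unitVec (k : X.ι) : X.HomSpace S (X.obj k) := single S X k (𝟙 _)

theorem clm_ext {F : Type*} [NormedAddCommGroup F] [NormedSpace ℂ F]
    {A B : X.HomSpace S γ →L[ℂ] F} (h : ∀ k x, A (single S X k x) = B (single S X k x)) :
    A = B := by
  ext ξ
  have h1 := (A.hasSum (hasSum_single ξ))
  simp only [h] at h1
  exact h1.unique (B.hasSum (hasSum_single ξ))

end IndObj.HomSpace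

open IndObj.HomSpace

section Diagonal
variable {S : StandardSolutions C} {X Y : IndObj.{w} C} {γ δ : C}

theorem sum_diag_sq_le {J : Type w} {A B : J → C} (f : ∀ k : J, (γ ⟶ A k) →ₗ[ℂ] (δ ⟶ B k)) (c : ℝ)
    (h : ∀ k x, ‖toHilb S (f k x)‖ ≤ c * ‖toHilb S x‖) (ξ : IndObj.HomSpace S ⟨J, A⟩ γ)
    (s : Finset J) : ∑ k ∈ s, ‖toHilb S (f k (ξ.component k))‖ ^ 2 ≤ (|c| * ‖ξ‖) ^ 2 := by
  calc ∑ k ∈ s, ‖toHilb S (f k (ξ.component k))‖ ^ 2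
      ≤ ∑ k ∈ s, |c| ^ 2 * ‖toHilb S (ξ.component k)‖ ^ 2 := by
        refine Finset.sum_le_sum fun k _ => ?_
        rw [← mul_pow]
        have := (h k (ξ.component k)).trans
          (mul_le_mul_of_nonneg_right (le_abs_self c) (norm_nonneg _))
        gcongr
    _ ≤ _ := by
        rw [← Finset.mul_sum, mul_pow]
        gcongr
        exact lp_sum_sq_le (E := fun k : J => HilbHom S γ (A k)) ξ s

/-- The operator given by uniformly bounded linear maps between the components of two ind-objects
with the same index set. -/
def diagOp {J : Type w} {A B : J → C} (f : ∀ k : J, (γ ⟶ A k) →ₗ[ℂ] (δ ⟶ B k)) (c : ℝ)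
    (h : ∀ k x, ‖toHilb S (f k x)‖ ≤ c * ‖toHilb S x‖) :
    IndObj.HomSpace S ⟨J, A⟩ γ →L[ℂ] IndObj.HomSpace S ⟨J, B⟩ δ :=
  LinearMap.mkContinuous
    { toFun := fun ξ => IndObj.HomSpace.mk (X := ⟨J, B⟩) (fun k => f k (ξ.component k))
        (memlp_of_sum_sq_le (sum_diag_sq_le f c h ξ))
      map_add' := fun ξ η => ext' fun k => (f k).map_add _ _
      map_smul' := fun a ξ => ext' fun k => (f k).map_smul _ _ } (|c|)
    (fun ξ => lp_norm_le_of_sum_sq_le (E := fun k : J => HilbHom S δ (B k)) (by positivity)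
      (sum_diag_sq_le f c h ξ))

theorem norm_diagOp_le {J : Type w} {A B : J → C} (f : ∀ k : J, (γ ⟶ A k) →ₗ[ℂ] (δ ⟶ B k)) (c : ℝ)
    (h : ∀ k x, ‖toHilb S (f k x)‖ ≤ c * ‖toHilb S x‖) : ‖diagOp f c h‖ ≤ |c| :=
  ContinuousLinearMap.opNorm_le_bound _ (abs_nonneg _) fun ξ =>
    lp_norm_le_of_sum_sq_le (E := fun k : J => HilbHom S δ (B k)) (by positivity)
      (sum_diag_sq_le f c h ξ)

theorem diagOp_single {J : Type w} {A B : J → C} (f : ∀ k : J, (γ ⟶ A k) →ₗ[ℂ] (δ ⟶ B k)) (c : ℝ)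
    (h : ∀ k x, ‖toHilb S (f k x)‖ ≤ c * ‖toHilb S x‖) (k : J) (x : γ ⟶ A k) :
    diagOp f c h (single S ⟨J, A⟩ k x) = single S ⟨J, B⟩ k (f k x) := by
  refine ext' fun l => ?_
  by_cases hl : l = k
  · subst hl
    exact (congrArg (f l) (single_component_self (X := ⟨J, A⟩) l x)).trans
      (single_component_self (X := ⟨J, B⟩) l (f l x)).symm
  · exact (congrArg (f l) (single_component_ne (X := ⟨J, A⟩) x hl)).trans
      ((map_zero _).trans (single_component_ne (X := ⟨J, B⟩) (f k x) hl).symm)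

variable (S X) in
/-- Composition with `g : δ ⟶ γ`, as an operator `(X, γ) ⟶ (X, δ)`. -/
def pre (g : δ ⟶ γ) : X.HomSpace S γ →L[ℂ] X.HomSpace S δ :=
  diagOp (fun k => Linear.leftComp ℂ (X.obj k) g) ‖g‖ (fun _ x => norm_toHilb_comp_le' S g x)

theorem pre_component (g : δ ⟶ γ) (ξ : X.HomSpace S γ) (k : X.ι) :
    (pre S X g ξ).component k = g ≫ ξ.component k := rfl

variable (S X) in
/-- The operator `ξ ↦ 1 ⊗ ξ`. -/
def whiskL (α γ : C) : X.HomSpace S γ →L[ℂ] (X.tensorLeft α).HomSpace S (α ⊗ γ) :=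
  diagOp (fun _ =>
    { toFun := fun x => α ◁ x
      map_add' := fun _ _ => MonoidalPreadditive.whiskerLeft_add _ _
      map_smul' := fun _ _ => MonoidalLinear.whiskerLeft_smul _ _ _ }) (√‖S.dim α‖)
    (fun _ x => (norm_whiskerLeft_toHilb S x).le)

variable (S X) in
/-- The operator `ξ ↦ ξ ⊗ 1`. -/
def whiskR (α γ : C) : X.HomSpace S γ →L[ℂ] (X.tensorRight α).HomSpace S (γ ⊗ α) :=
  diagOp (fun _ =>
    { toFun := fun x => x ▷ α
      map_add' := fun _ _ => MonoidalPreadditive.add_whiskerRight _ _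
      map_smul' := fun _ _ => MonoidalLinear.smul_whiskerRight _ _ _ }) (√‖S.dim α‖)
    (fun _ x => (norm_whiskerRight_toHilb S x).le)

variable (S X) in
/-- The partial trace, as an operator `(αX, αγ) ⟶ (X, γ)`. -/
def ptOp (α γ : C) : (X.tensorLeft α).HomSpace S (α ⊗ γ) →L[ℂ] X.HomSpace S γ :=
  diagOp (fun k => S.partialTraceₗ α γ (X.obj k)) (√‖S.dim α‖)
    (fun _ x => norm_partialTrace_toHilb_le S x)

theorem pre_pre {ε : C} (g : δ ⟶ γ) (h : ε ⟶ δ) (ξ : X.HomSpace S γ) :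
    pre S X h (pre S X g ξ) = pre S X (h ≫ g) ξ :=
  ext' fun _ => (Category.assoc _ _ _).symm

theorem pre_id (ξ : X.HomSpace S γ) : pre S X (𝟙 γ) ξ = ξ := ext' fun _ => Category.id_comp _

theorem pre_add_hom (g h : δ ⟶ γ) (ξ : X.HomSpace S γ) :
    pre S X (g + h) ξ = pre S X g ξ + pre S X h ξ :=
  ext' fun _ => Preadditive.add_comp _ _ _ _ _ _

theorem pre_smul_hom (a : ℂ) (g : δ ⟶ γ) (ξ : X.HomSpace S γ) :
    pre S X (a • g) ξ = a • pre S X g ξ :=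
  ext' fun _ => Linear.smul_comp _ _ _ _ _ _

theorem pre_single (g : δ ⟶ γ) (k : X.ι) (x : γ ⟶ X.obj k) :
    pre S X g (single S X k x) = single S X k (g ≫ x) :=
  ext' fun l => by rw [pre_component, single_component, single_component, Category.assoc]

theorem single_eq_pre (k : X.ι) (x : γ ⟶ X.obj k) : single S X k x = pre S X x (unitVec S X k) := by
  rw [unitVec, pre_single, Category.comp_id]

theorem inner_pre_left (g : δ ⟶ γ) (ξ : X.HomSpace S γ) (η : X.HomSpace S δ) :
    inner ℂ (pre S X g ξ) η = inner ℂ ξ (pre S X (g†) η) := by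
  refine (hasSum_inner _ _).unique (hasSum_of_eq (hasSum_inner ξ (pre S X (g†) η)) fun k => ?_)
  rw [pre_component, pre_component, dagger_comp, Category.assoc, S.tr_comm, Category.assoc]

theorem inner_pre_right (g : δ ⟶ γ) (ξ : X.HomSpace S γ) (η : X.HomSpace S δ) :
    inner ℂ η (pre S X g ξ) = inner ℂ (pre S X (g†) η) ξ := by
  rw [inner_pre_left, dagger_dagger]

theorem inner_whiskL_left (α : C) (ξ : X.HomSpace S γ) (η : (X.tensorLeft α).HomSpace S (α ⊗ γ)) :
    inner ℂ (whiskL S X α γ ξ) η = inner ℂ ξ (ptOp S X α γ η) := by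
  refine (hasSum_inner _ _).unique (hasSum_of_eq (hasSum_inner ξ (ptOp S X α γ η)) fun k => ?_)
  exact (inner_whiskerLeft_right S (η.component k) (ξ.component k)).symm

theorem pre_whiskL (α : C) (g : δ ⟶ γ) (ξ : X.HomSpace S γ) :
    pre S _ (α ◁ g) (whiskL S X α γ ξ) = whiskL S X α δ (pre S X g ξ) :=
  ext' fun _ => (whiskerLeft_comp _ _ _).symm

theorem pre_whiskR (α : C) (g : δ ⟶ γ) (ξ : X.HomSpace S γ) :
    pre S _ (g ▷ α) (whiskR S X α γ ξ) = whiskR S X α δ (pre S X g ξ) :=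
  ext' fun _ => (comp_whiskerRight _ _ _).symm

theorem ptOp_pre (α : C) (g : δ ⟶ γ) (ξ : (X.tensorLeft α).HomSpace S (α ⊗ γ)) :
    ptOp S X α δ (pre S _ (α ◁ g) ξ) = pre S X g (ptOp S X α γ ξ) :=
  ext' fun _ => S.partialTrace_comp_left _ _

/-- Precomposition with the cap brings an arbitrary source γ into the form α ⊗ (ᾱ ⊗ γ) needed for
the partial trace, and by Frobenius reciprocity nothing is lost. Hence the operators of an action
determine the rotation behind them. -/
theorem ptOp_injective (α : C) {ξ η : (X.tensorLeft α).HomSpace S γ}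
    (h : ptOp S X α _ (pre S _ (S.cap α γ) ξ) = ptOp S X α _ (pre S _ (S.cap α γ) η)) : ξ = η := by
  refine ext' fun k => ?_
  have h1 := congrArg (fun ζ => S.cup α γ ≫ α ◁ ζ.component k) h
  exact (S.cup_partialTrace (ξ.component k)).symm.trans (h1.trans (S.cup_partialTrace _))

theorem pre_cup_whiskL_ptOp (α : C) (ξ : (X.tensorLeft α).HomSpace S γ) :
    pre S _ (S.cup α γ) (whiskL S X α _ (ptOp S X α _ (pre S _ (S.cap α γ) ξ))) = ξ :=
  ext' fun k => S.cup_partialTrace (ξ.component k)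

/-- `⟪ζ ⊗ 1, (ξ ⊗ 1) V⟫`, computed with the right partial trace. -/
theorem inner_whiskR (α : C) {a b : C} (ξ : X.HomSpace S a) (ζ : X.HomSpace S b)
    (V : b ⊗ α ⟶ a ⊗ α) :
    inner ℂ (whiskR S X α b ζ) (pre S _ V (whiskR S X α a ξ)) =
      inner ℂ ζ (pre S X (S.rightPartialTrace α V) ξ) := by
  refine (hasSum_inner _ _).unique (hasSum_of_eq (hasSum_inner ζ (pre S X (S.rightPartialTrace α V) ξ)) fun k => ?_)
  change S.tr b ((S.rightPartialTrace α V ≫ ξ.component k) ≫ (ζ.component k)†) =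
    S.tr (b ⊗ α) ((V ≫ ξ.component k ▷ α) ≫ (ζ.component k ▷ α)†)
  rw [dagger_whiskerRight, Category.assoc V, ← comp_whiskerRight, S.tr_comm V,
    S.tr_whiskerRight_comp, S.tr_comm _ (S.rightPartialTrace α V), Category.assoc]

/-- The cup is isometric up to the partial trace. -/
theorem inner_pre_cup_whiskL (α : C) (ξ η : X.HomSpace S ((S α).bar ⊗ γ)) :
    inner ℂ (pre S _ (S.cup α γ) (whiskL S X α _ ξ)) (pre S _ (S.cup α γ) (whiskL S X α _ η)) =
      inner ℂ ξ η := by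
  refine (hasSum_inner _ _).unique (hasSum_of_eq (hasSum_inner ξ η) fun k => ?_)
  change _ = S.tr γ ((S.cup α γ ≫ α ◁ η.component k) ≫ (S.cup α γ ≫ α ◁ ξ.component k)†)
  rw [dagger_comp, dagger_whiskerLeft, S.cup_dagger, ← S.tr_cup_cap, whiskerLeft_comp]
  simp only [Category.assoc]

end Diagonal

end

/-! ### Bounded matrices as natural families of operators. -/

section

open IndObj.HomSpace

section Orthogonal
variable (S : StandardSolutions C)

theorem norm_sum_orthogonal {ι : Type w} {F : Finset ι} {Y : ι → C} {A γ : C} {a : ∀ k, Y k ⟶ A}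
    (ha : IsOrthogonalFamily F a) (x : ∀ k, γ ⟶ Y k) :
    ‖toHilb S (∑ k ∈ F, x k ≫ a k)‖ ^ 2 = ∑ k ∈ F, ‖toHilb S (x k)‖ ^ 2 := by
  have h : ∀ {γ B : C} (f : γ ⟶ B), ((‖toHilb S f‖ ^ 2 : ℝ) : ℂ) = S.trₗ γ (f ≫ f†) := fun f => by
    push_cast
    exact (inner_self_eq_norm_sq_to_K (𝕜 := ℂ) (toHilb S f)).symm
  apply Complex.ofReal_injective
  rw [h, Complex.ofReal_sum, dagger_sum, Preadditive.sum_comp, map_sum]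
  refine Finset.sum_congr rfl fun k hk => ?_
  rw [h, Preadditive.comp_sum, Finset.sum_eq_single k]
  · rw [dagger_comp, Category.assoc, reassoc_of% ha.1 k hk]
  · intro l hl hlk
    rw [dagger_comp, Category.assoc, reassoc_of% ha.2 k hk l hl hlk.symm]
    simp
  · exact fun h => absurd hk h

theorem sum_comp_orthogonal {ι : Type w} {F : Finset ι} {Y : ι → C} {A γ B : C} {a : ∀ k, Y k ⟶ A}
    (ha : IsOrthogonalFamily F a) (x : ∀ k, γ ⟶ Y k) (y : ∀ k, Y k ⟶ B) :
    (∑ k ∈ F, x k ≫ a k) ≫ (∑ k ∈ F, (a k)† ≫ y k) = ∑ k ∈ F, x k ≫ y k := by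
  rw [Preadditive.sum_comp]
  refine Finset.sum_congr rfl fun k hk => ?_
  rw [Preadditive.comp_sum, Finset.sum_eq_single k]
  · rw [Category.assoc, reassoc_of% ha.1 k hk]
  · intro l hl hlk
    rw [Category.assoc, reassoc_of% ha.2 k hk l hl hlk.symm]
    simp
  · exact fun h => absurd hk h

/-- Bessel's inequality: the left side is the squared norm of g followed by the projection onto the
ranges of the a k. -/
theorem sum_norm_comp_dagger_le {ι : Type w} {F : Finset ι} {Y : ι → C} {A γ : C}
    {a : ∀ k, Y k ⟶ A} (ha : IsOrthogonalFamily F a) (g : γ ⟶ A) :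
    ∑ k ∈ F, ‖toHilb S (g ≫ (a k)†)‖ ^ 2 ≤ ‖toHilb S g‖ ^ 2 := by
  rw [← norm_sum_orthogonal S ha]
  set p := ∑ k ∈ F, (g ≫ (a k)†) ≫ a k with hp
  -- This expresses that p is g followed by a projection; Cauchy–Schwarz then gives ‖p‖² ≤ ‖g‖ ‖p‖.
  have h1 : p ≫ p† = p ≫ g† := by
    have : p† = ∑ k ∈ F, (a k)† ≫ (a k ≫ g†) := by
      rw [hp, dagger_sum]
      simp only [dagger_comp, dagger_dagger]
    rw [this, hp, sum_comp_orthogonal ha, Preadditive.sum_comp]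
    simp only [Category.assoc]
  have h2 : ‖toHilb S p‖ ^ 2 ≤ ‖toHilb S g‖ * ‖toHilb S p‖ := by
    rw [← inner_self_eq_norm_sq (𝕜 := ℂ), inner_toHilb, h1, ← inner_toHilb]
    exact (RCLike.re_le_norm _).trans (norm_inner_le_norm _ _)
  have h3 : ‖toHilb S p‖ ≤ ‖toHilb S g‖ := by
    rcases (norm_nonneg (toHilb S p)).eq_or_lt with h | h
    · rw [← h]; positivity
    · nlinarith
  gcongr

theorem exists_orthogonalFamily {ι : Type w} (F : Finset ι) (Y : ι → C) :
    ∃ (A : C) (a : ∀ k, Y k ⟶ A), IsOrthogonalFamily F a := by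
  obtain ⟨A, a, ⟨h1, h2⟩, -⟩ := exists_directSum_fin F.card (fun n => Y (F.equivFin.symm n))
  have hY : ∀ (k : ι) (h : k ∈ F), Y k = Y (F.equivFin.symm (F.equivFin ⟨k, h⟩)) := fun k h => by
    rw [Equiv.symm_apply_apply]
  -- Nothing is required outside F, so the value there is zero. The index obtained by numbering F
  -- and returning equals k only propositionally, hence the `eqToHom`.
  let b : ∀ k, Y k ⟶ A := fun k =>
    if h : k ∈ F then eqToHom (hY k h) ≫ a (F.equivFin ⟨k, h⟩) else 0
  have hd : ∀ {X Y : C} (h : X = Y), (eqToHom h)† = eqToHom h.symm := by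
    intro X Y h; subst h; exact dagger_id _
  refine ⟨A, b, fun k hk => ?_, fun k hk l hl hkl => ?_⟩
  · simp only [b, dif_pos hk, dagger_comp, hd, Category.assoc]
    rw [reassoc_of% h1 _ (Finset.mem_univ _)]
    simp
  · simp only [b, dif_pos hk, dif_pos hl, dagger_comp, hd, Category.assoc]
    rw [reassoc_of% h2 _ (Finset.mem_univ _) _ (Finset.mem_univ _)
      (fun h => hkl (congrArg Subtype.val (F.equivFin.injective h)))]
    simp

end Orthogonal

/-- A uniformly bounded natural family of operators `(X, γ) ⟶ (Y, γ)`. -/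
structure NatOp (S : StandardSolutions C) (X Y : IndObj.{w} C) where
  op : ∀ γ : C, X.HomSpace S γ →L[ℂ] Y.HomSpace S γ
  op_pre : ∀ {γ δ : C} (g : δ ⟶ γ) (ξ : X.HomSpace S γ), op δ (pre S X g ξ) = pre S Y g (op γ ξ)
  bounded : ∃ c : ℝ, ∀ γ, ‖op γ‖ ≤ c

namespace NatOp
variable {S : StandardSolutions C} {X Y Z : IndObj.{w} C}

/-- The matrix of a natural family. -/
def mat (F : NatOp S X Y) : IndMat X Y := fun k l => (F.op _ (unitVec S X l)).component k

theorem op_single (F : NatOp S X Y) {γ : C} (l : X.ι) (x : γ ⟶ X.obj l) (k : Y.ι) :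
    (F.op γ (single S X l x)).component k = x ≫ F.mat k l := by
  rw [single_eq_pre, F.op_pre]; rfl

theorem ext_op {F G : NatOp S X Y} (h : ∀ γ, F.op γ = G.op γ) : F = G := by
  cases F; cases G
  have := funext h
  simp only at this
  subst this
  rfl

theorem op_ext {F G : NatOp S X Y} (h : ∀ l, F.op _ (unitVec S X l) = G.op _ (unitVec S X l)) :
    F = G := by
  refine ext_op fun γ => clm_ext fun k x => ?_
  rw [single_eq_pre, F.op_pre, G.op_pre, h]

theorem mat_injective {F G : NatOp S X Y} (h : F.mat = G.mat) : F = G :=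
  op_ext fun l => ext' fun k => congrFun (congrFun h k) l

theorem hasSum_op (F : NatOp S X Y) {γ : C} (ξ : X.HomSpace S γ) (k : Y.ι) :
    HasSum (fun l => ξ.component l ≫ F.mat k l) ((F.op γ ξ).component k) := by
  have h1 := (componentL S Y γ k ∘L F.op γ).hasSum (hasSum_single ξ)
  have h2 : Continuous (fun x : HilbHom S γ (Y.obj k) => x.hom) :=
    LinearMap.continuous_of_finiteDimensional
      ({ toFun := fun x => x.hom, map_add' := fun _ _ => rfl, map_smul' := fun _ _ => rfl } :
        HilbHom S γ (Y.obj k) →ₗ[ℂ] (γ ⟶ Y.obj k))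
  have h3 := h1.map ({ toFun := fun x => x.hom, map_zero' := rfl, map_add' := fun _ _ => rfl } :
        HilbHom S γ (Y.obj k) →+ (γ ⟶ Y.obj k)) h2
  exact hasSum_of_eq h3 fun l => F.op_single l (ξ.component l) k

theorem isBounded (F : NatOp S X Y) : F.mat.IsBounded := by
  obtain ⟨c, hc⟩ := F.bounded
  refine ⟨c, fun s t A B a b ha hb => ?_⟩
  have hc0 : 0 ≤ c := (norm_nonneg _).trans (hc A)
  refine norm_le_of_comp_le S _ hc0 fun g => ?_
  -- The C*-norm of a corner is tested on morphisms g : A ⟶ A. Cutting g by the a l gives a vector η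
  -- of norm at most that of g by Bessel, and the corner maps g to finitely many components of F η.
  set η : X.HomSpace S A := ∑ l ∈ s, single S X l (g ≫ (a l)†) with hη
  have h1 : g ≫ ∑ l ∈ s, ∑ k ∈ t, (a l)† ≫ F.mat k l ≫ b k =
      ∑ k ∈ t, (F.op A η).component k ≫ b k := by
    rw [Finset.sum_comm, Preadditive.comp_sum]
    refine Finset.sum_congr rfl fun k _ => ?_
    have : (F.op A η).component k = ∑ l ∈ s, (g ≫ (a l)†) ≫ F.mat k l := by
      rw [hη, map_sum]
      simp only [← F.op_single]
      exact map_sum (componentL S Y A k) _ _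
    rw [this, Preadditive.comp_sum, Preadditive.sum_comp]
    simp only [Category.assoc]
  have h2 : ‖η‖ ^ 2 ≤ ‖toHilb S g‖ ^ 2 := by
    refine le_trans (le_of_eq ?_) (sum_norm_comp_dagger_le S ha g)
    have := lp.norm_sum_single (E := fun k : X.ι => HilbHom S A (X.obj k)) (p := 2) (by norm_num)
      (fun l => toHilb S (g ≫ (a l)†)) s
    simp only [ENNReal.toReal_ofNat, Real.rpow_ofNat] at this
    exact this
  have h3 : ‖F.op A η‖ ≤ c * ‖η‖ := (F.op A).le_of_opNorm_le (hc A) η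
  rw [h1]
  refine le_of_sq_le_sq ?_ (by positivity)
  rw [norm_sum_orthogonal S hb]
  refine (lp_sum_sq_le (E := fun k : Y.ι => HilbHom S A (Y.obj k)) (F.op A η) t).trans ?_
  calc ‖F.op A η‖ ^ 2 ≤ (c * ‖η‖) ^ 2 := by gcongr
    _ = c ^ 2 * ‖η‖ ^ 2 := mul_pow _ _ _
    _ ≤ c ^ 2 * ‖toHilb S g‖ ^ 2 := by gcongr
    _ = _ := (mul_pow _ _ _).symm

end NatOp

/-- A vector with components x l becomes the single morphism ∑ x l ≫ a l of the same norm, on which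
the corner acts by composition. A bound in one realization of the corner suffices; this weak form is
needed for T ⊗ 1, whose corners are estimated inside objects A ⊗ α. -/
theorem IndMat.sum_norm_sq_le {S : StandardSolutions C} {X Y : IndObj.{w} C} {T : IndMat X Y}
    {c : ℝ} {s : Finset X.ι} {t : Finset Y.ι}
    (hT : ∃ (A B : C) (a : ∀ l, X.obj l ⟶ A) (b : ∀ k, Y.obj k ⟶ B), IsOrthogonalFamily s a ∧
      IsOrthogonalFamily t b ∧ ‖∑ l ∈ s, ∑ k ∈ t, (a l)† ≫ T k l ≫ b k‖ ≤ c) {γ : C}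
    (x : ∀ l, γ ⟶ X.obj l) :
    ∑ k ∈ t, ‖toHilb S (∑ l ∈ s, x l ≫ T k l)‖ ^ 2 ≤ c ^ 2 * ∑ l ∈ s, ‖toHilb S (x l)‖ ^ 2 := by
  obtain ⟨A, B, a, b, ha, hb, h⟩ := hT
  have hc : 0 ≤ c := (norm_nonneg _).trans h
  have h1 : (∑ l ∈ s, x l ≫ a l) ≫ (∑ l ∈ s, ∑ k ∈ t, (a l)† ≫ T k l ≫ b k) =
      ∑ k ∈ t, (∑ l ∈ s, x l ≫ T k l) ≫ b k := by
    have : ∀ l, ∑ k ∈ t, (a l)† ≫ T k l ≫ b k = (a l)† ≫ ∑ k ∈ t, T k l ≫ b k := fun l => by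
      rw [Preadditive.comp_sum]
    simp only [this]
    rw [sum_comp_orthogonal ha]
    simp only [Preadditive.comp_sum, Preadditive.sum_comp, Category.assoc]
    rw [Finset.sum_comm]
  rw [← norm_sum_orthogonal S hb, ← norm_sum_orthogonal S ha, ← h1, ← mul_pow]
  have := norm_toHilb_comp_le S (∑ l ∈ s, x l ≫ a l) (∑ l ∈ s, ∑ k ∈ t, (a l)† ≫ T k l ≫ b k)
  have h2 : ‖toHilb S ((∑ l ∈ s, x l ≫ a l) ≫ (∑ l ∈ s, ∑ k ∈ t, (a l)† ≫ T k l ≫ b k))‖ ≤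
      c * ‖toHilb S (∑ l ∈ s, x l ≫ a l)‖ :=
    this.trans (mul_le_mul_of_nonneg_right h (norm_nonneg _))
  gcongr

/-- A matrix whose finite corners are uniformly bounded defines a natural family of operators. -/
theorem IndMat.exists_natOp_of_corners (S : StandardSolutions C) {X Y : IndObj.{w} C}
    (T : IndMat X Y) (c : ℝ)
    (hT : ∀ (s : Finset X.ι) (t : Finset Y.ι), ∃ (A B : C) (a : ∀ l, X.obj l ⟶ A)
      (b : ∀ k, Y.obj k ⟶ B), IsOrthogonalFamily s a ∧
      IsOrthogonalFamily t b ∧ ‖∑ l ∈ s, ∑ k ∈ t, (a l)† ≫ T k l ≫ b k‖ ≤ c) :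
    ∃ F : NatOp S X Y, F.mat = T ∧ ∀ γ, ‖F.op γ‖ ≤ |c| := by
  have key : ∀ {γ : C} (s : Finset X.ι) (t : Finset Y.ι) (x : ∀ l, γ ⟶ X.obj l),
      ∑ k ∈ t, ‖toHilb S (∑ l ∈ s, x l ≫ T k l)‖ ^ 2 ≤ c ^ 2 * ∑ l ∈ s, ‖toHilb S (x l)‖ ^ 2 :=
    fun s t x => IndMat.sum_norm_sq_le (hT s t) x
  have mem : ∀ {γ : C} (l : X.ι) (x : γ ⟶ X.obj l), Memℓp (fun k => toHilb S (x ≫ T k l)) 2 := by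
    intro γ l x
    refine memlp_of_sum_sq_le (c := c ^ 2 * ‖toHilb S x‖ ^ 2) fun t => ?_
    -- The corner estimate with one column: the family is x at the index l, transported along the
    -- equality of indices, and zero elsewhere.
    have := key {l} t (fun l' => if h : l' = l then x ≫ eqToHom (by rw [h]) else 0)
    simpa using this
  let f : ∀ (γ : C) (l : X.ι), HilbHom S γ (X.obj l) →ₗ[ℂ] Y.HomSpace S γ := fun γ l =>
    { toFun := fun x => IndObj.HomSpace.mk (fun k => x.hom ≫ T k l) (mem l x.hom)
      map_add' := fun x y => ext' fun k => Preadditive.add_comp _ _ _ x.hom y.hom (T k l)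
      map_smul' := fun a x => ext' fun k => Linear.smul_comp _ _ _ a x.hom (T k l) }
  have hf : ∀ (γ : C) (s : Finset X.ι) (x : ∀ l, HilbHom S γ (X.obj l)),
      ‖∑ l ∈ s, f γ l (x l)‖ ^ 2 ≤ c ^ 2 * ∑ l ∈ s, ‖x l‖ ^ 2 := fun γ s x => by
    have h0 : 0 ≤ c ^ 2 * ∑ l ∈ s, ‖x l‖ ^ 2 :=
      mul_nonneg (sq_nonneg c) (Finset.sum_nonneg fun _ _ => by positivity)
    rw [← Real.sq_sqrt h0]
    gcongr
    refine lp_norm_le_of_sum_sq_le (E := fun k : Y.ι => HilbHom S γ (Y.obj k))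
      (Real.sqrt_nonneg _) fun t => ?_
    rw [Real.sq_sqrt h0]
    refine le_trans (le_of_eq (Finset.sum_congr rfl fun k _ => ?_)) (key s t fun l => (x l).hom)
    congr 2
    exact map_sum (componentL S Y γ k) (fun l => f γ l (x l)) s
  let F : ∀ γ, X.HomSpace S γ →L[ℂ] Y.HomSpace S γ := fun γ => lpLift (f γ) (c ^ 2) (hf γ)
  have hF : ∀ {γ : C} (l : X.ι) (x : γ ⟶ X.obj l) (k : Y.ι),
      (F γ (single S X l x)).component k = x ≫ T k l := fun {γ} l x k =>
    congrArg (fun ξ : Y.HomSpace S γ => ξ.component k)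
      (lpLift_single (f γ) (c ^ 2) (hf γ) l (toHilb S x))
  have hn : ∀ γ, ‖F γ‖ ≤ |c| := fun γ => by
    rw [← Real.sqrt_sq_eq_abs]
    exact norm_lpLift_le (f γ) (c ^ 2) (hf γ)
  refine ⟨⟨F, @fun γ δ g ξ => ?_, ⟨|c|, hn⟩⟩, ?_, hn⟩
  · have : F δ ∘L pre S X g = pre S Y g ∘L F γ := clm_ext fun l x => ext' fun k => by
      change (F δ (pre S X g (single S X l x))).component k = g ≫ (F γ (single S X l x)).component k
      rw [pre_single, hF, hF, Category.assoc]
    exact DFunLike.congr_fun this ξ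
  · funext k l
    exact (hF l (𝟙 _) k).trans (Category.id_comp _)

theorem IndMat.IsBounded.exists_natOp (S : StandardSolutions C) {X Y : IndObj.{w} C}
    {T : IndMat X Y} (h : T.IsBounded) : ∃ F : NatOp S X Y, F.mat = T := by
  obtain ⟨c, hc⟩ := h
  obtain ⟨F, hF, -⟩ := IndMat.exists_natOp_of_corners S T c fun s t => by
    obtain ⟨A, a, ha⟩ := exists_orthogonalFamily s X.obj
    obtain ⟨B, b, hb⟩ := exists_orthogonalFamily t Y.obj
    exact ⟨A, B, a, b, ha, hb, hc s t A B a b ha hb⟩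
  exact ⟨F, hF⟩

/-- The natural family of operators of a bounded matrix. -/
def IndMat.natOp (S : StandardSolutions C) {X Y : IndObj.{w} C} {T : IndMat X Y}
    (h : T.IsBounded) : NatOp S X Y := Classical.choose (h.exists_natOp S)

theorem IndMat.mat_natOp (S : StandardSolutions C) {X Y : IndObj.{w} C} {T : IndMat X Y}
    (h : T.IsBounded) : (IndMat.natOp S h).mat = T := Classical.choose_spec (h.exists_natOp S)

namespace NatOp
variable {S : StandardSolutions C} {X Y Z : IndObj.{w} C}

/-- The composition `R T`. -/
def comp (R : NatOp S Y Z) (T : NatOp S X Y) : NatOp S X Z where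
  op γ := R.op γ ∘L T.op γ
  op_pre g ξ := by simp [T.op_pre, R.op_pre]
  bounded := by
    obtain ⟨c, hc⟩ := R.bounded
    obtain ⟨d, hd⟩ := T.bounded
    refine ⟨c * d, fun γ => (ContinuousLinearMap.opNorm_comp_le _ _).trans ?_⟩
    exact mul_le_mul (hc γ) (hd γ) (norm_nonneg _) ((norm_nonneg _).trans (hc γ))

theorem comp_op (R : NatOp S Y Z) (T : NatOp S X Y) {γ : C} (ξ : X.HomSpace S γ) :
    (R.comp T).op γ ξ = R.op γ (T.op γ ξ) := rfl

variable (S X) in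
/-- The identity. -/
def id : NatOp S X X where
  op _ := ContinuousLinearMap.id ℂ _
  op_pre _ _ := rfl
  bounded := ⟨1, fun _ => ContinuousLinearMap.norm_id_le⟩

/-- The adjoint. -/
def adj (T : NatOp S X Y) : NatOp S Y X where
  op γ := (T.op γ).adjoint
  op_pre g ξ := by
    refine ext_inner_left ℂ fun η => ?_
    rw [ContinuousLinearMap.adjoint_inner_right, inner_pre_right, inner_pre_right,
      ContinuousLinearMap.adjoint_inner_right, T.op_pre]
  bounded := by
    obtain ⟨c, hc⟩ := T.bounded
    refine ⟨c, fun γ => ?_⟩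
    rw [LinearIsometryEquiv.norm_map]
    exact hc γ

theorem adj_inner_left (T : NatOp S X Y) {γ : C} (ξ : X.HomSpace S γ) (η : Y.HomSpace S γ) :
    inner ℂ (T.adj.op γ η) ξ = inner ℂ η (T.op γ ξ) := ContinuousLinearMap.adjoint_inner_left _ _ _

theorem adj_inner_right (T : NatOp S X Y) {γ : C} (ξ : X.HomSpace S γ) (η : Y.HomSpace S γ) :
    inner ℂ ξ (T.adj.op γ η) = inner ℂ (T.op γ ξ) η := ContinuousLinearMap.adjoint_inner_right _ _ _

theorem adj_adj (T : NatOp S X Y) : T.adj.adj = T :=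
  ext_op fun γ => ContinuousLinearMap.adjoint_adjoint (T.op γ)

theorem mat_comp (R : NatOp S Y Z) (T : NatOp S X Y) : (R.comp T).mat = R.mat.comp T.mat := by
  funext k l
  exact (R.hasSum_op (T.op _ (unitVec S X l)) k).tsum_eq.symm

theorem mat_id : (id S X).mat = IndMat.id X := by
  funext k l
  refine (single_component (S := S) l k (𝟙 _)).trans (Category.id_comp _)

theorem mat_adj (T : NatOp S X Y) : T.adj.mat = T.mat.adj := by
  funext k l
  have h : ∀ x : Y.obj l ⟶ X.obj k, inner ℂ (toHilb S x) (toHilb S (T.adj.mat k l)) =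
      inner ℂ (toHilb S x) (toHilb S (T.mat.adj k l)) := fun x => by
    have h1 : inner ℂ (toHilb S x) (toHilb S (T.adj.mat k l)) =
        inner ℂ (single S X k x) (T.adj.op _ (unitVec S Y l)) :=
      (inner_single_left k x (T.adj.op _ (unitVec S Y l))).symm
    rw [h1, adj_inner_right, unitVec, inner_single_right, T.op_single, inner_toHilb, inner_toHilb,
      dagger_comp, Category.id_comp]
    rfl
  exact ext_inner_left ℂ (E := HilbHom S _ _) h

theorem isUnitary_mat_iff (T : NatOp S X Y) :
    T.mat.IsUnitary ↔ T.adj.comp T = id S X ∧ T.comp T.adj = id S Y := by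
  unfold IndMat.IsUnitary
  rw [← mat_adj, ← mat_comp, ← mat_comp, ← mat_id (S := S), ← mat_id (S := S)]
  exact and_congr ⟨fun h => mat_injective h, fun h => h ▸ rfl⟩
    ⟨fun h => mat_injective h, fun h => h ▸ rfl⟩

end NatOp

end

/-! ### Graphical identities for cups, caps, products and the involution. -/

section

namespace StandardSolutions
variable (S : StandardSolutions C)
open ConjugateSolution TubeAlgebra
variable {α a b γ : C}

/-- The morphism `1 ⊗ t : αb ⟶ (αbᾱ)α`. -/
def coevR (α γ : C) : γ ⟶ (γ ⊗ (S α).bar) ⊗ α :=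
  (ρ_ γ).inv ≫ γ ◁ (S α).t ≫ (α_ γ (S α).bar α).inv

/-- The morphism `t† ⊗ 1 ⊗ 1 : ᾱ(αbᾱ) ⟶ bᾱ`. -/
def contract (α b : C) : (S α).bar ⊗ ((α ⊗ b) ⊗ (S α).bar) ⟶ b ⊗ (S α).bar :=
  (S α).bar ◁ (α_ α b (S α).bar).hom ≫ (α_ (S α).bar α (b ⊗ (S α).bar)).inv ≫
    (S α).t† ▷ (b ⊗ (S α).bar) ≫ (λ_ _).hom

/-- The morphism `t† ⊗ 1 : ᾱαb ⟶ b`. -/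
def evL (α b : C) : (S α).bar ⊗ (α ⊗ b) ⟶ b :=
  (α_ (S α).bar α b).inv ≫ (S α).t† ▷ b ≫ (λ_ b).hom

theorem cup_evL (α b : C) : S.cup α (α ⊗ b) ≫ α ◁ S.evL α b = 𝟙 _ := by
  rw [cup, evL]
  calc _ = 𝟙 _ ⊗≫ ((S α).s ▷ α ⊗≫ α ◁ (S α).t†) ▷ b ⊗≫ 𝟙 _ := by monoidal
    _ = _ := by rw [zigzag_obj']; monoidal

/-- The factor `t` at the end is what matters: in an action, sliding moves it to the beginning,
where `t_whisker_cap_evL` straightens the zigzag and leaves only an action of the unit object. -/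
theorem mulHom_contract (α b : C) :
    mulHom (S.contract α b) (S.cap α (α ⊗ b) ≫ S.coevR α (α ⊗ b)) =
      ((α_ _ _ _).hom ≫ (S α).bar ◁ S.cap α (α ⊗ b) ≫ S.evL α b ≫ (ρ_ b).inv) ≫ b ◁ (S α).t := by
  rw [mulHom, contract, coevR, evL]
  calc _ = 𝟙 _ ⊗≫ (S α).bar ◁ S.cap α (α ⊗ b) ⊗≫ (((S α).bar ⊗ α) ◁ b ◁ (S α).t ≫
        (S α).t† ▷ (b ⊗ ((S α).bar ⊗ α))) ⊗≫ 𝟙 _ := by monoidal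
    _ = _ := by rw [whisker_exchange]; monoidal

theorem t_whisker_cap_evL (α b : C) :
    (S α).t ▷ ((S α).bar ⊗ (α ⊗ b)) ≫
      ((α_ _ _ _).hom ≫ (S α).bar ◁ S.cap α (α ⊗ b) ≫ S.evL α b ≫ (ρ_ b).inv) =
      𝟙_ C ◁ S.evL α b ≫ (λ_ b).hom ≫ (ρ_ b).inv := by
  rw [cap, evL]
  calc _ = 𝟙 _ ⊗≫ ((S α).t ▷ (S α).bar ⊗≫ (S α).bar ◁ (S α).s†) ▷ (α ⊗ b) ⊗≫
        (S α).t† ▷ b ⊗≫ 𝟙 _ := by monoidal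
    _ = _ := by rw [zigzag_bar']; monoidal

theorem rightPartialTrace_dagger {Y Z : C} (f : Y ⊗ α ⟶ Z ⊗ α) :
    (S.rightPartialTrace α f)† = S.rightPartialTrace α (f†) := by
  simp only [rightPartialTrace, rptr, dagger_comp, dagger_whiskerLeft, dagger_whiskerRight,
    dagger_dagger, dagger_of_unitary' _ (unitary_rightUnitor _),
    dagger_of_unitary _ (unitary_rightUnitor _), dagger_of_unitary _ (unitary_associator _ _ _),
    dagger_of_unitary' _ (unitary_associator _ _ _), Category.assoc]

/-- This writes V^# as a contraction preceded by the adjoint of a right partial trace. That is the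
form in which the adjoint of the action comes out of the unitarity of R_α. -/
theorem sharpHom_eq (V : α ⊗ b ⟶ a ⊗ α) :
    (S α).bar ◁ (S.rightPartialTrace α ((S.coevR α (α ⊗ b))† ≫ V))† ≫ S.contract α b =
      sharpHom S V := by
  rw [rightPartialTrace_dagger, dagger_comp, dagger_dagger, coevR, contract, rightPartialTrace,
    rptr, sharpHom]
  calc _ = 𝟙 _ ⊗≫ (S α).bar ◁ a ◁ (S α).s ⊗≫ (S α).bar ◁ V† ▷ (S α).bar ⊗≫
        (S α).bar ◁ (α ⊗ b) ◁ ((S α).t ▷ (S α).bar ⊗≫ (S α).bar ◁ (S α).s†) ⊗≫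
        (S α).t† ▷ (b ⊗ (S α).bar) ⊗≫ 𝟙 _ := by monoidal
    _ = _ := by rw [zigzag_bar']; monoidal

theorem cap_dagger (α γ : C) : (S.cap α γ)† = S.cup α γ := by
  rw [← cup_dagger, dagger_dagger]

theorem sharpHom_cap (V : γ ⟶ a ⊗ α) :
    sharpHom S (S.cap α γ ≫ V) = (S α).bar ◁ ((ρ_ a).inv ≫ a ◁ (S α).s ≫ (α_ _ _ _).inv ≫
      V† ▷ (S α).bar) ≫ (α_ _ _ _).inv := by
  rw [sharpHom, dagger_comp, cap_dagger, cup]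
  calc _ = 𝟙 _ ⊗≫ (S α).bar ◁ a ◁ (S α).s ⊗≫ (S α).bar ◁ V† ▷ (S α).bar ⊗≫
        ((S α).bar ◁ (S α).s ⊗≫ (S α).t† ▷ (S α).bar) ▷ (γ ⊗ (S α).bar) ⊗≫ 𝟙 _ := by monoidal
    _ = _ := by rw [zigzag_bar]; monoidal

/-- The factor `s†` at the beginning can be slid to the end in an action; there it closes the strand
α and turns V† ≫ W into its right partial trace (`whisker_s_rightPartialTrace`). This computation
underlies the isometry of the rotation. -/
theorem mulHom_sharpHom_cap (V : γ ⟶ a ⊗ α) (W : γ ⟶ b ⊗ α) :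
    mulHom (S.cap α γ ≫ W) (sharpHom S (S.cap α γ ≫ V)) =
      (S α).s† ▷ a ≫ (λ_ a).hom ≫ (ρ_ a).inv ≫ a ◁ (S α).s ≫ (α_ _ _ _).inv ≫
        (V† ≫ W) ▷ (S α).bar ≫ (α_ _ _ _).hom := by
  rw [sharpHom_cap, mulHom, cap]
  calc _ = 𝟙 _ ⊗≫ ((α ⊗ (S α).bar) ◁ ((ρ_ a).inv ≫ a ◁ (S α).s ≫ (α_ _ _ _).inv ≫
      V† ▷ (S α).bar) ≫ (S α).s† ▷ (γ ⊗ (S α).bar)) ⊗≫ W ▷ (S α).bar ⊗≫ 𝟙 _ := by monoidal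
    _ = _ := by rw [whisker_exchange]; monoidal

theorem whisker_s_rightPartialTrace (F : a ⊗ α ⟶ b ⊗ α) :
    ((λ_ a).hom ≫ (ρ_ a).inv ≫ a ◁ (S α).s ≫ (α_ _ _ _).inv ≫ F ▷ (S α).bar ≫ (α_ _ _ _).hom) ≫
      b ◁ (S α).s† = 𝟙_ C ◁ S.rightPartialTrace α F ≫ (λ_ b).hom ≫ (ρ_ b).inv := by
  rw [rightPartialTrace, rptr]
  monoidal

/-- Bending α to the other side shows that every morphism with source α ⊗ b factors through a cap,
so relations need only be checked on caps. -/
theorem exists_whiskerLeft_cap (W : α ⊗ b ⟶ γ) :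
    ∃ w : b ⟶ (S α).bar ⊗ γ, α ◁ w ≫ S.cap α γ = W := by
  refine ⟨(λ_ b).inv ≫ (S α).t ▷ b ≫ (α_ _ _ _).hom ≫ (S α).bar ◁ W, ?_⟩
  rw [cap]
  calc _ = 𝟙 _ ⊗≫ α ◁ (S α).t ▷ b ⊗≫ ((α ⊗ (S α).bar) ◁ W ≫ (S α).s† ▷ γ) ⊗≫ 𝟙 _ := by monoidal
    _ = 𝟙 _ ⊗≫ (α ◁ (S α).t ⊗≫ (S α).s† ▷ α) ▷ b ⊗≫ W := by rw [whisker_exchange]; monoidal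
    _ = _ := by rw [zigzag_obj]; monoidal

theorem partialTrace_cap_cup {Z : C} (f : (S α).bar ⊗ γ ⟶ Z) :
    S.partialTrace α (S.cap α γ ≫ S.cup α γ ≫ α ◁ f) = f := by
  rw [partialTrace_cap, cup]
  calc _ = 𝟙 _ ⊗≫ (S α).bar ◁ (S α).s ▷ γ ⊗≫ (((S α).bar ⊗ α) ◁ f ≫ (S α).t† ▷ Z) ⊗≫ 𝟙 _ := by monoidal
    _ = 𝟙 _ ⊗≫ ((S α).bar ◁ (S α).s ⊗≫ (S α).t† ▷ (S α).bar) ▷ γ ⊗≫ f := by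
      rw [whisker_exchange]; monoidal
    _ = _ := by rw [zigzag_bar]; monoidal

theorem cap_whiskerRight (β : C) : (α_ _ _ _).inv ≫ S.cap α γ ▷ β =
    α ◁ (α_ _ _ _).hom ≫ S.cap α (γ ⊗ β) := by
  rw [cap, cap]; monoidal

theorem cup_naturality {δ : C} (f : γ ⟶ δ) :
    f ≫ S.cup α δ = S.cup α γ ≫ α ◁ (S α).bar ◁ f := by
  have := congrArg (fun x => x†) (S.cap_naturality (X := α) (f†))
  simpa only [dagger_comp, cap_dagger, dagger_dagger, dagger_whiskerLeft] using this

theorem partialTrace_whiskerRight {Y Z : C} (f : α ⊗ Y ⟶ α ⊗ Z) (β : C) :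
    S.partialTrace α ((α_ _ _ _).inv ≫ f ▷ β ≫ (α_ _ _ _).hom) = S.partialTrace α f ▷ β := by
  simp only [partialTrace]; monoidal

end StandardSolutions

end

/-! ### Annular actions and the unitary rotations they define. -/

section

open IndObj.HomSpace StandardSolutions

theorem norm_id_le (X : C) : ‖𝟙 X‖ ≤ 1 := by
  have h := norm_sq_eq (𝟙 X)
  rw [dagger_id, Category.comp_id] at h
  nlinarith [norm_nonneg (𝟙 X)]

theorem norm_le_one_of_isometry {X Y : C} (f : X ⟶ Y) (h : f ≫ f† = 𝟙 X) : ‖f‖ ≤ 1 := by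
  have h1 := norm_sq_eq f
  rw [h] at h1
  nlinarith [norm_id_le X, norm_nonneg f]

theorem IsOrthogonalFamily.whiskerRight {ι : Type w} {F : Finset ι} {Y : ι → C} {A : C}
    {a : ∀ k, Y k ⟶ A} (ha : IsOrthogonalFamily F a) (α : C) :
    IsOrthogonalFamily F (fun k => a k ▷ α) := by
  refine ⟨fun k hk => ?_, fun k hk l hl hkl => ?_⟩
  · rw [dagger_whiskerRight, ← comp_whiskerRight, ha.1 k hk, id_whiskerRight]
  · rw [dagger_whiskerRight, ← comp_whiskerRight, ha.2 k hk l hl hkl]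
    exact MonoidalPreadditive.zero_whiskerRight

namespace NatOp
variable {S : StandardSolutions C} {X Y Z : IndObj.{w} C}

variable (S) in
/-- The diagonal natural family given by uniformly bounded morphisms. -/
def diag {J : Type w} {A B : J → C} (f : ∀ k, A k ⟶ B k) (c : ℝ) (h : ∀ k, ‖f k‖ ≤ c) :
    NatOp S ⟨J, A⟩ ⟨J, B⟩ where
  op γ := diagOp (fun k => Linear.rightComp ℂ γ (f k)) |c| (fun k x =>
    (norm_toHilb_comp_le S x (f k)).trans
      (mul_le_mul_of_nonneg_right ((h k).trans (le_abs_self c)) (norm_nonneg _)))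
  op_pre _ _ := ext' fun _ => Category.assoc _ _ _
  bounded := ⟨|(|c|)|, fun _ => norm_diagOp_le _ _ _⟩

theorem diag_single {J : Type w} {A B : J → C} (f : ∀ k, A k ⟶ B k) (c : ℝ) (h : ∀ k, ‖f k‖ ≤ c)
    {γ : C} (k : J) (x : γ ⟶ A k) :
    (diag S f c h).op γ (single S ⟨J, A⟩ k x) = single S ⟨J, B⟩ k (x ≫ f k) :=
  diagOp_single (fun k => Linear.rightComp ℂ γ (f k)) |c| (fun k x =>
    (norm_toHilb_comp_le S x (f k)).trans
      (mul_le_mul_of_nonneg_right ((h k).trans (le_abs_self c)) (norm_nonneg _))) k x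

theorem exists_tensorRight (T : NatOp S X Y) (α : C) :
    ∃ R : NatOp S (X.tensorRight α) (Y.tensorRight α), R.mat = fun k l => T.mat k l ▷ α := by
  obtain ⟨c, hc⟩ := T.isBounded
  obtain ⟨F, hF, -⟩ := IndMat.exists_natOp_of_corners (X := X.tensorRight α)
    (Y := Y.tensorRight α) S (fun k l => T.mat k l ▷ α) c fun (s : Finset X.ι) (t : Finset Y.ι) => by
    obtain ⟨A, a, ha⟩ := exists_orthogonalFamily s X.obj
    obtain ⟨B, b, hb⟩ := exists_orthogonalFamily t Y.obj
    refine ⟨A ⊗ α, B ⊗ α, fun l => a l ▷ α, fun k => b k ▷ α, ha.whiskerRight α,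
      hb.whiskerRight α, ?_⟩
    have h := (norm_whiskerRight_le _ α).trans (hc s t A B a b ha hb)
    have e : (∑ l ∈ s, ∑ k ∈ t, (a l)† ≫ T.mat k l ≫ b k) ▷ α =
        ∑ l ∈ s, ∑ k ∈ t, (a l ▷ α)† ≫ (T.mat k l ▷ α) ≫ (b k ▷ α) := by
      simp only [sum_whiskerRight, comp_whiskerRight, ← dagger_whiskerRight]
    rw [e] at h
    exact h
  exact ⟨F, hF⟩

/-- The natural family `T ⊗ 1`. -/
def tensorRight (T : NatOp S X Y) (α : C) : NatOp S (X.tensorRight α) (Y.tensorRight α) :=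
  Classical.choose (T.exists_tensorRight α)

theorem mat_tensorRight (T : NatOp S X Y) (α : C) (k : Y.ι) (l : X.ι) :
    (T.tensorRight α).mat k l = T.mat k l ▷ α :=
  congrFun (congrFun (Classical.choose_spec (T.exists_tensorRight α)) k) l

theorem whiskR_single (α : C) {γ : C} (l : X.ι) (x : γ ⟶ X.obj l) :
    whiskR S X α γ (single S X l x) = single S (X.tensorRight α) l (x ▷ α) :=
  diagOp_single _ _ _ l x

theorem whiskL_single (α : C) {γ : C} (l : X.ι) (x : γ ⟶ X.obj l) :
    whiskL S X α γ (single S X l x) = single S (X.tensorLeft α) l (α ◁ x) :=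
  diagOp_single _ _ _ l x

theorem whiskR_unitVec (α : C) (l : X.ι) :
    whiskR S X α _ (unitVec S X l) = unitVec S (X.tensorRight α) l :=
  (whiskR_single α l (𝟙 _)).trans (congrArg (single S (X.tensorRight α) l) (id_whiskerRight _ _))

theorem whiskL_unitVec (α : C) (l : X.ι) :
    whiskL S X α _ (unitVec S X l) = unitVec S (X.tensorLeft α) l :=
  (whiskL_single α l (𝟙 _)).trans
    (congrArg (single S (X.tensorLeft α) l) (MonoidalCategory.whiskerLeft_id _ _))

theorem tensorRight_whiskR (T : NatOp S X Y) (α : C) {γ : C} (ξ : X.HomSpace S γ) :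
    (T.tensorRight α).op _ (whiskR S X α γ ξ) = whiskR S Y α γ (T.op γ ξ) := by
  have : (T.tensorRight α).op _ ∘L whiskR S X α γ = whiskR S Y α γ ∘L T.op γ :=
    clm_ext fun l x => ext' fun k => by
      refine (congrArg (fun ζ => ((T.tensorRight α).op _ ζ).component k)
        (whiskR_single α l x)).trans ((op_single _ _ _ _).trans ?_)
      refine ((congrArg (x ▷ α ≫ ·) (T.mat_tensorRight α k l)).trans
        (comp_whiskerRight _ _ _).symm).trans ?_
      exact congrArg (· ▷ α) (T.op_single l x k).symm
  exact DFunLike.congr_fun this ξ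

/-- Vectors `v l ∈ (Y, X_l)` with the scalar products of the columns of an isometry define an
isometric natural family. -/
theorem exists_isometry (v : ∀ l, Y.HomSpace S (X.obj l))
    (h : ∀ {γ : C} (l m : X.ι) (x : γ ⟶ X.obj l) (y : γ ⟶ X.obj m),
      inner ℂ (pre S Y x (v l)) (pre S Y y (v m)) = inner ℂ (single S X l x) (single S X m y)) :
    ∃ F : NatOp S X Y, (∀ l, F.op _ (unitVec S X l) = v l) ∧ F.adj.comp F = id S X := by
  let f : ∀ (γ : C) (l : X.ι), HilbHom S γ (X.obj l) →ₗ[ℂ] Y.HomSpace S γ := fun γ l =>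
    { toFun := fun x => pre S Y x.hom (v l)
      map_add' := fun x y => pre_add_hom x.hom y.hom (v l)
      map_smul' := fun a x => pre_smul_hom a x.hom (v l) }
  have hf : ∀ (γ : C) (s : Finset X.ι) (x : ∀ l, HilbHom S γ (X.obj l)),
      ‖∑ l ∈ s, f γ l (x l)‖ ^ 2 ≤ 1 * ∑ l ∈ s, ‖x l‖ ^ 2 := fun γ s x => by
    have h1 : ‖∑ l ∈ s, single S X l (x l).hom‖ ^ 2 = ∑ l ∈ s, ‖x l‖ ^ 2 := by
      have := lp.norm_sum_single (E := fun k : X.ι => HilbHom S γ (X.obj k)) (p := 2) (by norm_num)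
        x s
      simp only [ENNReal.toReal_ofNat, Real.rpow_ofNat] at this
      exact this
    rw [one_mul, ← h1, ← inner_self_eq_norm_sq (𝕜 := ℂ), ← inner_self_eq_norm_sq (𝕜 := ℂ)]
    simp only [sum_inner, inner_sum]
    refine le_of_eq (congrArg _ (Finset.sum_congr rfl fun l _ => Finset.sum_congr rfl fun m _ => ?_))
    exact h _ _ (x _).hom (x _).hom
  let F : ∀ γ, X.HomSpace S γ →L[ℂ] Y.HomSpace S γ := fun γ => lpLift (f γ) 1 (hf γ)
  have hF : ∀ {γ : C} (l : X.ι) (x : γ ⟶ X.obj l), F γ (single S X l x) = pre S Y x (v l) :=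
    @fun γ l x => lpLift_single (f γ) 1 (hf γ) l (toHilb S x)
  let N : NatOp S X Y := ⟨F, @fun γ δ g ξ => by
    have : F δ ∘L pre S X g = pre S Y g ∘L F γ := clm_ext fun l x => by
      change F δ (pre S X g (single S X l x)) = pre S Y g (F γ (single S X l x))
      rw [pre_single, hF, hF, pre_pre]
    exact DFunLike.congr_fun this ξ, ⟨√1, fun γ => norm_lpLift_le (f γ) 1 (hf γ)⟩⟩
  refine ⟨N, fun l => (hF l (𝟙 _)).trans (pre_id _), ext_op fun γ => clm_ext fun l x => ?_⟩
  refine ext_inner_left ℂ fun η => ?_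
  have h2 : innerSL ℂ (N.adj.op γ (F γ (single S X l x))) = innerSL ℂ (single S X l x) :=
    clm_ext fun m y => by
      refine (N.adj_inner_left (single S X m y) (F γ (single S X l x))).trans ?_
      refine Eq.trans ?_ (h l m x y)
      rw [← hF, ← hF]
  have h3 : inner ℂ (N.adj.op γ (F γ (single S X l x))) η = inner ℂ (single S X l x) η :=
    DFunLike.congr_fun h2 η
  rw [← inner_conj_symm, ← inner_conj_symm η]
  exact congrArg _ h3

end NatOp

/-- An action of all morphisms `V : α ⊗ b ⟶ a ⊗ α` by bounded operators `(X, a) ⟶ (X, b)`. -/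
structure AnnularAction (S : StandardSolutions C) (X : IndObj.{w} C) where
  act : ∀ {a b α : C}, (α ⊗ b ⟶ a ⊗ α) → (X.HomSpace S a →L[ℂ] X.HomSpace S b)
  act_add : ∀ {a b α : C} (V W : α ⊗ b ⟶ a ⊗ α) (ξ : X.HomSpace S a),
    act (V + W) ξ = act V ξ + act W ξ
  act_smul : ∀ {a b α : C} (c : ℂ) (V : α ⊗ b ⟶ a ⊗ α) (ξ : X.HomSpace S a),
    act (c • V) ξ = c • act V ξ
  act_pre : ∀ {a a' b α : C} (f : a ⟶ a') (V : α ⊗ b ⟶ a ⊗ α) (ξ : X.HomSpace S a'),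
    act V (pre S X f ξ) = act (V ≫ f ▷ α) ξ
  pre_act : ∀ {a b b' α : C} (g : b' ⟶ b) (V : α ⊗ b ⟶ a ⊗ α) (ξ : X.HomSpace S a),
    pre S X g (act V ξ) = act (α ◁ g ≫ V) ξ
  slide : ∀ {a b α β : C} (u : α ⟶ β) (V : β ⊗ b ⟶ a ⊗ α) (ξ : X.HomSpace S a),
    act (u ▷ b ≫ V) ξ = act (V ≫ a ◁ u) ξ
  act_act : ∀ {a b c α β : C} (V : α ⊗ b ⟶ a ⊗ α) (W : β ⊗ c ⟶ b ⊗ β) (ξ : X.HomSpace S a),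
    act W (act V ξ) = act (TubeAlgebra.mulHom V W) ξ
  act_unit : ∀ {a : C} (ξ : X.HomSpace S a), act ((λ_ a).hom ≫ (ρ_ a).inv) ξ = ξ
  inner_act : ∀ {a b α : C} (V : α ⊗ b ⟶ a ⊗ α) (ξ : X.HomSpace S a) (η : X.HomSpace S b),
    inner ℂ η (act V ξ) = inner ℂ (act (TubeAlgebra.sharpHom S V) η) ξ

section Collapse
variable {S : StandardSolutions C} {X : IndObj.{w} C}

/-- The collapse of the contraction against the cup; used for actions which are not yet known to
satisfy the condition on adjoints. -/
theorem act_cap_act_contract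
    (act : ∀ {a b α : C}, (α ⊗ b ⟶ a ⊗ α) → (X.HomSpace S a →L[ℂ] X.HomSpace S b))
    (pre_act : ∀ {a b b' α : C} (g : b' ⟶ b) (V : α ⊗ b ⟶ a ⊗ α) (ξ : X.HomSpace S a),
      pre S X g (act V ξ) = act (α ◁ g ≫ V) ξ)
    (slide : ∀ {a b α β : C} (u : α ⟶ β) (V : β ⊗ b ⟶ a ⊗ α) (ξ : X.HomSpace S a),
      act (u ▷ b ≫ V) ξ = act (V ≫ a ◁ u) ξ)
    (act_act : ∀ {a b c α β : C} (V : α ⊗ b ⟶ a ⊗ α) (W : β ⊗ c ⟶ b ⊗ β) (ξ : X.HomSpace S a),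
      act W (act V ξ) = act (TubeAlgebra.mulHom V W) ξ)
    (act_unit : ∀ {a : C} (ξ : X.HomSpace S a), act ((λ_ a).hom ≫ (ρ_ a).inv) ξ = ξ)
    (α b : C) (η : X.HomSpace S b) :
    pre S _ (S.cup α (α ⊗ b)) (whiskL S X α _
      (act (S.cap α (α ⊗ b) ≫ S.coevR α (α ⊗ b)) (act (S.contract α b) η))) =
      whiskL S X α b η := by
  rw [act_act, mulHom_contract, ← slide, t_whisker_cap_evL, ← pre_act, act_unit, ← pre_whiskL,
    pre_pre, cup_evL, pre_id]

end Collapse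

namespace AnnularAction
variable {S : StandardSolutions C} {X : IndObj.{w} C} (A : AnnularAction S X)

/-- The vector of `(αX, γ)` corresponding to `(ξ ⊗ 1) V`. -/
def transport {a α γ : C} (V : γ ⟶ a ⊗ α) (ξ : X.HomSpace S a) : (X.tensorLeft α).HomSpace S γ :=
  pre S _ (S.cup α γ) (whiskL S X α _ (A.act (S.cap α γ ≫ V) ξ))

theorem pre_transport {a α γ δ : C} (g : δ ⟶ γ) (V : γ ⟶ a ⊗ α) (ξ : X.HomSpace S a) :
    pre S _ g (A.transport V ξ) = A.transport (g ≫ V) ξ := by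
  have h : S.cap α δ ≫ g ≫ V = α ◁ (S α).bar ◁ g ≫ S.cap α γ ≫ V := by
    rw [← Category.assoc, cap_naturality, Category.assoc]
  rw [transport, transport, h, ← A.pre_act, ← pre_whiskL, pre_pre, pre_pre, cup_naturality]

theorem transport_pre {a a' α γ : C} (f : a ⟶ a') (V : γ ⟶ a ⊗ α) (ξ : X.HomSpace S a') :
    A.transport V (pre S X f ξ) = A.transport (V ≫ f ▷ α) ξ := by
  rw [transport, transport, A.act_pre, Category.assoc]

/-- The defining property of `transport`: it is a vector of (αX, γ) whose partial traces reproduce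
the action. Factoring W through a cap reduces the claim to the case where bending and unbending
cancel. -/
theorem ptOp_transport {a b α γ : C} (W : α ⊗ b ⟶ γ) (V : γ ⟶ a ⊗ α) (ξ : X.HomSpace S a) :
    ptOp S X α b (pre S _ W (A.transport V ξ)) = A.act (W ≫ V) ξ := by
  obtain ⟨w, rfl⟩ := S.exists_whiskerLeft_cap W
  rw [Category.assoc, ← A.pre_act, ← pre_pre, ptOp_pre]
  congr 1
  exact ext' fun k => S.partialTrace_cap_cup _

/-- The bending preserves scalar products, so the left side is a scalar product of two values of the
action. The adjoint relation combines them into the action of one product, sliding collapses it to a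
right partial trace, and `inner_whiskR` identifies the result. -/
theorem inner_transport {a b α γ : C} (V : γ ⟶ a ⊗ α) (W : γ ⟶ b ⊗ α) (ξ : X.HomSpace S a)
    (η : X.HomSpace S b) : inner ℂ (A.transport V ξ) (A.transport W η) =
      inner ℂ (pre S _ V (whiskR S X α a ξ)) (pre S _ W (whiskR S X α b η)) := by
  rw [transport, transport, inner_pre_cup_whiskL, ← inner_conj_symm, A.inner_act, inner_conj_symm,
    A.act_act, mulHom_sharpHom_cap, A.slide, whisker_s_rightPartialTrace, ← A.pre_act, A.act_unit,
    ← inner_whiskR, inner_pre_left, pre_pre]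

/-- The vectors 1 ⊗ η are values of `transport`; this makes the isometry R_α surjective. -/
theorem transport_contract (α b : C) (η : X.HomSpace S b) :
    A.transport (S.coevR α (α ⊗ b)) (A.act (S.contract α b) η) = whiskL S X α b η :=
  act_cap_act_contract A.act A.pre_act A.slide A.act_act A.act_unit α b η

theorem exists_rotation (α : C) : ∃ R : NatOp S (X.tensorRight α) (X.tensorLeft α),
    (∀ {a γ : C} (V : γ ⟶ a ⊗ α) (ξ : X.HomSpace S a),
      R.op γ (pre S _ V (whiskR S X α a ξ)) = A.transport V ξ) ∧
    R.adj.comp R = NatOp.id S _ ∧ R.comp R.adj = NatOp.id S _ := by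
  -- The columns of R are forced: the inclusion of X_l ⊗ α must go to the transport of the identity.
  -- `inner_transport` supplies the scalar products needed for an isometry.
  obtain ⟨R, hR, h1⟩ := NatOp.exists_isometry (S := S) (X := X.tensorRight α) (Y := X.tensorLeft α)
    (fun l => A.transport (𝟙 _) (unitVec S X l)) (by
      intro γ l m x y
      have h : ∀ (l : X.ι) (x : γ ⟶ X.obj l ⊗ α), pre S (X.tensorLeft α) x
          (A.transport (𝟙 (X.obj l ⊗ α)) (unitVec S X l)) = A.transport x (unitVec S X l) :=
        fun l x => by rw [A.pre_transport, Category.comp_id]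
      have h' : ∀ (l : X.ι) (x : γ ⟶ X.obj l ⊗ α), pre S (X.tensorRight α) x
          (whiskR S X α _ (unitVec S X l)) = single S (X.tensorRight α) l x :=
        fun l x => (congrArg _ (NatOp.whiskR_unitVec α l)).trans (single_eq_pre _ _).symm
      refine (congrArg₂ (inner ℂ) (h l x) (h m y)).trans ((A.inner_transport _ _ _ _).trans ?_)
      exact congrArg₂ (inner ℂ) (h' l x) (h' m y))
  have h2 : ∀ {a γ : C} (V : γ ⟶ a ⊗ α) (ξ : X.HomSpace S a),
      R.op γ (pre S _ V (whiskR S X α a ξ)) = A.transport V ξ := by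
    intro a γ V ξ
    have : R.op γ ∘L (pre S _ V ∘L whiskR S X α a) =
        pre S _ (S.cup α γ) ∘L (whiskL S X α _ ∘L A.act (S.cap α γ ≫ V)) := clm_ext fun l x => by
      change R.op γ (pre S _ V (whiskR S X α a (single S X l x))) = A.transport V (single S X l x)
      rw [single_eq_pre, A.transport_pre, ← pre_whiskR, pre_pre, R.op_pre]
      refine (congrArg (pre S _ _)
        ((congrArg (R.op _) (NatOp.whiskR_unitVec α l)).trans (hR l))).trans ?_
      exact (A.pre_transport _ _ _).trans
        (congrArg (fun g => A.transport g (unitVec S X l)) (Category.comp_id _))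
    exact DFunLike.congr_fun this ξ
  refine ⟨R, h2, h1, NatOp.op_ext fun k => ?_⟩
  have h3 : ∀ {γ : C} (ξ : (X.tensorRight α).HomSpace S γ), R.adj.op γ (R.op γ ξ) = ξ :=
    fun ξ => DFunLike.congr_fun (congrFun (congrArg NatOp.op h1) _) ξ
  -- Once R is isometric, R R† fixes every vector in the range of R. It is then enough that the
  -- inclusions of the summands of αX lie in the range.
  have h4 : ∀ {γ : C} {ζ : (X.tensorLeft α).HomSpace S γ} (ξ : (X.tensorRight α).HomSpace S γ),
      R.op γ ξ = ζ → (R.comp R.adj).op γ ζ = ζ := fun ξ h => by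
    rw [← h, NatOp.comp_op]
    exact congrArg _ (h3 ξ)
  refine h4 (γ := α ⊗ X.obj k) (pre S _ (S.coevR α _) (whiskR S X α _ (A.act (S.contract α _)
    (unitVec S X k)))) ?_
  rw [h2, A.transport_contract]
  exact NatOp.whiskL_unitVec (X := X) α k

/-- The operators `(ξ ⊗ 1) V ↦ σ_α† (ξ ⊗ 1) V`. -/
def rotation (α : C) : NatOp S (X.tensorRight α) (X.tensorLeft α) :=
  Classical.choose (A.exists_rotation α)

theorem rotation_op {a α γ : C} (V : γ ⟶ a ⊗ α) (ξ : X.HomSpace S a) :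
    (A.rotation α).op γ (pre S _ V (whiskR S X α a ξ)) = A.transport V ξ :=
  (Classical.choose_spec (A.exists_rotation α)).1 V ξ

theorem ptOp_rotation {a b α : C} (W : α ⊗ b ⟶ a ⊗ α) (ξ : X.HomSpace S a) :
    ptOp S X α b ((A.rotation α).op _ (pre S _ W (whiskR S X α a ξ))) = A.act W ξ := by
  have := A.ptOp_transport W (𝟙 _) ξ
  rwa [A.pre_transport, Category.comp_id, ← rotation_op] at this

end AnnularAction

end

/-! ### Tensoring natural families with objects; product and unit of rotations. -/

section

open IndObj.HomSpace StandardSolutions TubeAlgebra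

namespace NatOp
variable {S : StandardSolutions C} {X Y Z : IndObj.{w} C}

theorem _root_.TubeRep.IsOrthogonalFamily.whiskerLeft {ι : Type w} {F : Finset ι} {Y : ι → C}
    {A : C} {a : ∀ k, Y k ⟶ A} (ha : IsOrthogonalFamily F a) (α : C) :
    IsOrthogonalFamily F (fun k => α ◁ a k) := by
  refine ⟨fun k hk => ?_, fun k hk l hl hkl => ?_⟩
  · rw [dagger_whiskerLeft, ← MonoidalCategory.whiskerLeft_comp, ha.1 k hk,
      MonoidalCategory.whiskerLeft_id]
  · rw [dagger_whiskerLeft, ← MonoidalCategory.whiskerLeft_comp, ha.2 k hk l hl hkl]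
    exact MonoidalPreadditive.whiskerLeft_zero

theorem mat_comp_diag {J : Type w} {A B : J → C} (f : ∀ k, A k ⟶ B k) (c : ℝ)
    (h : ∀ k, ‖f k‖ ≤ c) (T : NatOp S ⟨J, B⟩ Y) (k : Y.ι) (l : J) :
    (T.comp (diag S f c h)).mat k l = f l ≫ T.mat k l := by
  refine (congrArg (fun ζ => (T.op _ ζ).component k) (diag_single f c h l (𝟙 _))).trans ?_
  refine (T.op_single l (𝟙 _ ≫ f l) k).trans ?_
  rw [Category.id_comp]

theorem exists_tensorLeft (α : C) (T : NatOp S X Y) :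
    ∃ R : NatOp S (X.tensorLeft α) (Y.tensorLeft α), R.mat = fun k l => α ◁ T.mat k l := by
  obtain ⟨c, hc⟩ := T.isBounded
  obtain ⟨F, hF, -⟩ := IndMat.exists_natOp_of_corners (X := X.tensorLeft α)
    (Y := Y.tensorLeft α) S (fun k l => α ◁ T.mat k l) c fun (s : Finset X.ι) (t : Finset Y.ι) => by
    obtain ⟨A, a, ha⟩ := exists_orthogonalFamily s X.obj
    obtain ⟨B, b, hb⟩ := exists_orthogonalFamily t Y.obj
    refine ⟨α ⊗ A, α ⊗ B, fun l => α ◁ a l, fun k => α ◁ b k, ha.whiskerLeft α,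
      hb.whiskerLeft α, ?_⟩
    have h := (norm_whiskerLeft_le α _).trans (hc s t A B a b ha hb)
    have e : α ◁ (∑ l ∈ s, ∑ k ∈ t, (a l)† ≫ T.mat k l ≫ b k) =
        ∑ l ∈ s, ∑ k ∈ t, (α ◁ a l)† ≫ (α ◁ T.mat k l) ≫ (α ◁ b k) := by
      simp only [whiskerLeft_sum, MonoidalCategory.whiskerLeft_comp, ← dagger_whiskerLeft]
    rw [e] at h
    exact h
  exact ⟨F, hF⟩

/-- The natural family `1 ⊗ T`. -/
def tensorLeft (α : C) (T : NatOp S X Y) : NatOp S (X.tensorLeft α) (Y.tensorLeft α) :=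
  Classical.choose (T.exists_tensorLeft α)

theorem mat_tensorLeft (α : C) (T : NatOp S X Y) (k : Y.ι) (l : X.ι) :
    (T.tensorLeft α).mat k l = α ◁ T.mat k l :=
  congrFun (congrFun (Classical.choose_spec (T.exists_tensorLeft α)) k) l

theorem tensorLeft_whiskL (T : NatOp S X Y) (α : C) {γ : C} (ξ : X.HomSpace S γ) :
    (T.tensorLeft α).op _ (whiskL S X α γ ξ) = whiskL S Y α γ (T.op γ ξ) := by
  have : (T.tensorLeft α).op _ ∘L whiskL S X α γ = whiskL S Y α γ ∘L T.op γ :=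
    clm_ext fun l x => ext' fun k => by
      refine (congrArg (fun ζ => ((T.tensorLeft α).op _ ζ).component k)
        (whiskL_single α l x)).trans ((op_single _ _ _ _).trans ?_)
      refine ((congrArg (α ◁ x ≫ ·) (T.mat_tensorLeft α k l)).trans
        (MonoidalCategory.whiskerLeft_comp _ _ _).symm).trans ?_
      exact congrArg (α ◁ ·) (T.op_single l x k).symm
  exact DFunLike.congr_fun this ξ

/-- By Frobenius reciprocity every vector of (αX, α ⊗ γ) is a bent vector 1 ⊗ ζ, on which 1 ⊗ T acts
through ζ. The partial trace of such a vector is precomposition of ζ with a fixed morphism w, and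
this commutes with T by naturality. -/
theorem ptOp_tensorLeft (T : NatOp S X Y) (α : C) {γ : C}
    (ξ : (X.tensorLeft α).HomSpace S (α ⊗ γ)) :
    ptOp S Y α γ ((T.tensorLeft α).op _ ξ) = T.op γ (ptOp S X α γ ξ) := by
  have h := pre_cup_whiskL_ptOp (S := S) (X := X) α ξ
  have h' : ξ = pre S _ (S.cup α _) (whiskL S X α _ (ptOp S X α _ (pre S _ (S.cap α _) ξ))) := h.symm
  generalize ptOp S X α _ (pre S _ (S.cap α _) ξ) = ζ at h'
  subst h'
  rw [(T.tensorLeft α).op_pre, tensorLeft_whiskL]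
  obtain ⟨w, hw⟩ : ∃ w : γ ⟶ (S α).bar ⊗ (α ⊗ γ), ∀ {Z : C} (f : (S α).bar ⊗ (α ⊗ γ) ⟶ Z),
      S.partialTrace α (S.cup α (α ⊗ γ) ≫ α ◁ f) = w ≫ f :=
    ⟨S.partialTrace α (S.cup α (α ⊗ γ)), fun f => S.partialTrace_comp_right _ f⟩
  have h1 : ∀ {Z : IndObj.{w} C} (θ : Z.HomSpace S ((S α).bar ⊗ (α ⊗ γ))),
      ptOp S Z α γ (pre S _ (S.cup α (α ⊗ γ)) (whiskL S Z α _ θ)) = pre S Z w θ :=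
    fun θ => ext' fun k => hw (θ.component k)
  rw [h1, h1, T.op_pre]

variable (S X)

/-- The morphisms `u ⊗ 1 : αX ⟶ βX`. -/
def mapLeft {α β : C} (u : α ⟶ β) : NatOp S (X.tensorLeft α) (X.tensorLeft β) :=
  diag S (fun k => u ▷ X.obj k) ‖u‖ fun k => norm_whiskerRight_le u (X.obj k)

/-- The morphisms `1 ⊗ u : Xα ⟶ Xβ`. -/
def mapRight {α β : C} (u : α ⟶ β) : NatOp S (X.tensorRight α) (X.tensorRight β) :=
  diag S (fun k => X.obj k ◁ u) ‖u‖ fun k => norm_whiskerLeft_le (X.obj k) u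

/-- The associator `X(αβ) ⟶ (Xα)β`. -/
def assocRight (α β : C) :
    NatOp S (X.tensorRight (α ⊗ β)) ((X.tensorRight α).tensorRight β) :=
  diag S (fun k => (α_ (X.obj k) α β).inv) 1 fun _ => norm_le_one_of_isometry _ (by
    rw [dagger_of_unitary' _ (unitary_associator _ _ _), Iso.inv_hom_id])

/-- The associator `(αX)β ⟶ α(Xβ)`. -/
def assocMiddle (α β : C) :
    NatOp S ((X.tensorLeft α).tensorRight β) ((X.tensorRight β).tensorLeft α) :=
  diag S (fun k => (α_ α (X.obj k) β).hom) 1 fun _ => norm_le_one_of_isometry _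
    (unitary_associator _ _ _).1

/-- The associator `α(βX) ⟶ (αβ)X`. -/
def assocLeft (α β : C) :
    NatOp S ((X.tensorLeft β).tensorLeft α) (X.tensorLeft (α ⊗ β)) :=
  diag S (fun k => (α_ α β (X.obj k)).inv) 1 fun _ => norm_le_one_of_isometry _ (by
    rw [dagger_of_unitary' _ (unitary_associator _ _ _), Iso.inv_hom_id])

/-- The natural isomorphism `Xε ⟶ εX`. -/
def unitRotation : NatOp S (X.tensorRight (𝟙_ C)) (X.tensorLeft (𝟙_ C)) :=
  diag S (fun k => (ρ_ (X.obj k)).hom ≫ (λ_ (X.obj k)).inv) 1 fun _ => norm_le_one_of_isometry _ (by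
    rw [dagger_comp, dagger_of_unitary' _ (unitary_leftUnitor _),
      dagger_of_unitary _ (unitary_rightUnitor _)]
    simp)

variable {S X}

theorem mat_comp_assocRight (α β : C) (T : NatOp S ((X.tensorRight α).tensorRight β) Y)
    (k : Y.ι) (l : X.ι) :
    (T.comp (assocRight S X α β)).mat k l = (α_ (X.obj l) α β).inv ≫ T.mat k l :=
  mat_comp_diag _ _ _ T k l

/-- The morphism `(1 ⊗ Q)(P ⊗ 1) : Xαβ ⟶ αβX`, for `P : Xα ⟶ αX` and `Q : Xβ ⟶ βX`. -/
def mulRotation {α β : C} (P : NatOp S (X.tensorRight α) (X.tensorLeft α))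
    (Q : NatOp S (X.tensorRight β) (X.tensorLeft β)) :
    NatOp S (X.tensorRight (α ⊗ β)) (X.tensorLeft (α ⊗ β)) :=
  (assocLeft S X α β).comp (((Q.tensorLeft α).comp ((assocMiddle S X α β).comp
    (P.tensorRight β))).comp (assocRight S X α β))

theorem mat_mulRotation {α β : C} (P : NatOp S (X.tensorRight α) (X.tensorLeft α))
    (Q : NatOp S (X.tensorRight β) (X.tensorLeft β)) (k l : X.ι) :
    (mulRotation P Q).mat k l = ((α_ (X.obj l) α β).inv ≫
      ∑' m : X.ι, (P.mat m l ▷ β ≫ (α_ α (X.obj m) β).hom) ≫ α ◁ Q.mat k m) ≫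
        (α_ α β (X.obj k)).inv := by
  refine congrArg (· ≫ (α_ α β (X.obj k)).inv) ?_
  refine (mat_comp_assocRight α β ((Q.tensorLeft α).comp ((assocMiddle S X α β).comp
    (P.tensorRight β))) k l).trans (congrArg ((α_ (X.obj l) α β).inv ≫ ·) ?_)
  refine (congrFun (congrFun (mat_comp (Q.tensorLeft α) ((assocMiddle S X α β).comp
    (P.tensorRight β))) k) l).trans (tsum_congr fun m => ?_)
  refine congrArg₂ (· ≫ ·) ?_ (Q.mat_tensorLeft α k m)
  refine congrArg (· ≫ (α_ α (X.obj m) β).hom) ?_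
  exact P.mat_tensorRight β m l

/-- The partial trace of the rotation: `(Tr_α ⊗ 1)(P (ξ ⊗ 1) V)`. -/
def tubeAct {a b α : C} (P : NatOp S (X.tensorRight α) (X.tensorLeft α)) (V : α ⊗ b ⟶ a ⊗ α) :
    X.HomSpace S a →L[ℂ] X.HomSpace S b :=
  ptOp S X α b ∘L P.op _ ∘L pre S _ V ∘L whiskR S X α a

/-- The partial trace over α ⊗ β is taken over α first. What follows P involves only β and X, so
this inner trace can be postponed past the whiskering by β and past Q; up to associators both sides
are then the same composite. -/
theorem tubeAct_mulRotation {a b c α β : C} (P : NatOp S (X.tensorRight α) (X.tensorLeft α))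
    (Q : NatOp S (X.tensorRight β) (X.tensorLeft β)) (V : α ⊗ b ⟶ a ⊗ α) (W : β ⊗ c ⟶ b ⊗ β)
    (ξ : X.HomSpace S a) :
    (mulRotation P Q).tubeAct (mulHom V W) ξ = Q.tubeAct W (P.tubeAct V ξ) := by
  symm
  change ptOp S X β c (Q.op _ (pre S _ W (whiskR S X β b (ptOp S X α b
    (P.op _ (pre S _ V (whiskR S X α a ξ))))))) = _
  have h1 : ∀ ζ : (X.tensorLeft α).HomSpace S (α ⊗ b), whiskR S X β b (ptOp S X α b ζ) =
      ptOp S (X.tensorRight β) α (b ⊗ β) ((assocMiddle S X α β).op _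
        (pre S _ (α_ α b β).inv (whiskR S (X.tensorLeft α) β _ ζ))) := fun ζ => ext' fun k => by
    refine (S.partialTrace_whiskerRight (ζ.component k) β).symm.trans
      (congrArg (S.partialTrace α) (Category.assoc _ _ _).symm)
  have h2 : whiskR S (X.tensorRight α) β _ (whiskR S X α a ξ) = (assocRight S X α β).op _
      (pre S _ (α_ a α β).hom (whiskR S X (α ⊗ β) a ξ)) := ext' fun k => by
    change ξ.component k ▷ α ▷ β = ((α_ a α β).hom ≫ ξ.component k ▷ (α ⊗ β)) ≫ (α_ _ α β).inv
    simp
  have h3 : ∀ ζ : ((X.tensorLeft β).tensorLeft α).HomSpace S (α ⊗ (β ⊗ c)),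
      ptOp S X β c (ptOp S (X.tensorLeft β) α (β ⊗ c) ζ) = ptOp S X (α ⊗ β) c
        ((assocLeft S X α β).op _ (pre S _ (α_ α β c).hom ζ)) := fun ζ => ext' fun k => by
    refine Eq.trans ?_ (S.partialTrace_tensor _).symm
    refine congrArg (fun f => S.partialTrace β (S.partialTrace α f)) ?_
    change ζ.component k = (α_ α β c).inv ≫ (((α_ α β c).hom ≫ ζ.component k) ≫
      (α_ α β (X.obj k)).inv) ≫ (α_ α β (X.obj k)).hom
    have : ∀ {A B : C} (e : A ≅ B) {D E : C} (e' : D ≅ E) (z : B ⟶ E),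
        z = e.inv ≫ ((e.hom ≫ z) ≫ e'.inv) ≫ e'.hom := by simp
    exact this (α_ α β c) (α_ α β (X.obj k)) (ζ.component k)
  rw [h1, ← ptOp_pre, ← ptOp_tensorLeft, h3, ← tensorRight_whiskR, ← pre_whiskR, h2]
  change _ = ptOp S X (α ⊗ β) c ((assocLeft S X α β).op _ ((Q.tensorLeft α).op _
    ((assocMiddle S X α β).op _ ((P.tensorRight β).op _ ((assocRight S X α β).op _
      (pre S _ (mulHom V W) (whiskR S X (α ⊗ β) a ξ)))))))
  simp only [op_pre, pre_pre, mulHom, Category.assoc]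

end NatOp

end

/-! ### Half braidings, rotations and annular actions are equivalent data. -/

section

open IndObj.HomSpace StandardSolutions TubeAlgebra

/-- The inverses `R_α = σ_α† : Xα ⟶ αX` of a unitary half braiding, as natural families. -/
structure Rotation (S : StandardSolutions C) (X : IndObj.{w} C) where
  R : ∀ α : C, NatOp S (X.tensorRight α) (X.tensorLeft α)
  adj_comp : ∀ α, (R α).adj.comp (R α) = NatOp.id S _
  comp_adj : ∀ α, (R α).comp (R α).adj = NatOp.id S _
  naturality : ∀ {α β : C} (u : α ⟶ β), (NatOp.mapLeft S X u).comp (R α) =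
    (R β).comp (NatOp.mapRight S X u)
  unit : R (𝟙_ C) = NatOp.unitRotation S X
  mul : ∀ α β : C, R (α ⊗ β) = NatOp.mulRotation (R α) (R β)

/-- The adjoint on a space of morphisms, as an antilinear isometry. -/
def daggerEquiv (X Y : C) : (X ⟶ Y) ≃ₗᵢ⋆[ℂ] (Y ⟶ X) where
  toFun f := f†
  invFun f := f†
  left_inv f := dagger_dagger f
  right_inv f := dagger_dagger f
  map_add' := dagger_add
  map_smul' := dagger_smul
  norm_map' := norm_dagger

theorem dagger_tsum {J : Type*} {X Y : C} (f : J → (X ⟶ Y)) : (∑' j, f j)† = ∑' j, (f j)† :=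
  (daggerEquiv X Y).toContinuousLinearEquiv.map_tsum

theorem IndMat.id_dagger (X : IndObj.{w} C) (k l : X.ι) :
    (IndMat.id X k l)† = IndMat.id X l k := by
  unfold IndMat.id
  by_cases h : l = k
  · subst h; simp [dagger_id]
  · rw [dif_neg h, dif_neg (Ne.symm h), dagger_zero]

theorem dagger_unit_conj {A B D E : C} {e : A ≅ B} {e' : E ≅ D} (h : IsUnitaryHom e.hom)
    (h' : IsUnitaryHom e'.hom) {z : B ⟶ D} {z' : D ⟶ B} (hz : z† = z') :
    (e.hom ≫ z ≫ e'.inv)† = e'.hom ≫ z' ≫ e.inv := by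
  rw [dagger_comp, dagger_comp, dagger_of_unitary' _ h', dagger_of_unitary _ h, hz, Category.assoc]

/-- Rotations are the adjoints of half braidings, so each axiom for one family is the adjoint of an
axiom for the other. Arbitrary names for the adjoint morphisms allow use in both directions. -/
theorem naturality_dagger {α β A B : C} (u : α ⟶ β) {f : β ⊗ A ⟶ B ⊗ β} {g : α ⊗ A ⟶ B ⊗ α}
    {f' : B ⊗ β ⟶ β ⊗ A} {g' : B ⊗ α ⟶ α ⊗ A} (hf : f† = f') (hg : g† = g') :
    f ≫ B ◁ u† = u† ▷ A ≫ g ↔ g' ≫ u ▷ A = B ◁ u ≫ f' := by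
  have h : ∀ {P Q : C} {x y : P ⟶ Q}, x = y ↔ x† = y† :=
    ⟨fun h => h ▸ rfl, fun h => by simpa only [dagger_dagger] using congrArg (fun x => x†) h⟩
  rw [h]
  simp only [dagger_comp, dagger_whiskerLeft, dagger_whiskerRight, dagger_dagger, hf, hg]
  exact eq_comm

theorem multiplicativity_dagger {J : Type*} {Y : J → C} {α β : C} {k l : J}
    {f : ∀ m, β ⊗ Y l ⟶ Y m ⊗ β} {g : ∀ m, α ⊗ Y m ⟶ Y k ⊗ α}
    {f' : ∀ m, Y m ⊗ β ⟶ β ⊗ Y l} {g' : ∀ m, Y k ⊗ α ⟶ α ⊗ Y m}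
    (hf : ∀ m, (f m)† = f' m) (hg : ∀ m, (g m)† = g' m) :
    ((α_ α β (Y l)).hom ≫ (∑' m, α ◁ f m ≫ (α_ α (Y m) β).inv ≫ g m ▷ β) ≫
        (α_ (Y k) α β).hom)† =
      ((α_ (Y k) α β).inv ≫ ∑' m, (g' m ▷ β ≫ (α_ α (Y m) β).hom) ≫ α ◁ f' m) ≫
        (α_ α β (Y l)).inv := by
  rw [dagger_comp, dagger_comp, dagger_of_unitary _ (unitary_associator _ _ _),
    dagger_of_unitary _ (unitary_associator _ _ _), dagger_tsum]
  simp only [dagger_comp, dagger_whiskerLeft, dagger_whiskerRight,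
    dagger_of_unitary' _ (unitary_associator _ _ _), hf, hg]

theorem NatOp.mat_unitRotation (S : StandardSolutions C) (X : IndObj.{w} C) (k l : X.ι) :
    (NatOp.unitRotation S X).mat l k = (ρ_ (X.obj k)).hom ≫ IndMat.id X l k ≫
      (λ_ (X.obj l)).inv := by
  refine (congrArg (fun ζ => ζ.component l) (NatOp.diag_single (S := S)
    (fun k => (ρ_ (X.obj k)).hom ≫ (λ_ (X.obj k)).inv) _ _ k (𝟙 (X.obj k ⊗ 𝟙_ C)))).trans ?_
  rw [Category.id_comp]
  by_cases h : l = k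
  · subst h
    refine (single_component_self (X := X.tensorLeft (𝟙_ C)) l _).trans ?_
    simp [IndMat.id]
    rfl
  · refine (single_component_ne (X := X.tensorLeft (𝟙_ C)) _ h).trans ?_
    simp [IndMat.id, Ne.symm h]
    rfl

namespace UnitaryHalfBraiding
variable {S : StandardSolutions C} {X : IndObj.{w} C}

variable (S) in
/-- The rotation family of a unitary half braiding. -/
def rotationOp (σ : UnitaryHalfBraiding X) (α : C) : NatOp S (X.tensorRight α) (X.tensorLeft α) :=
  (IndMat.natOp S (σ.bounded α)).adj

theorem mat_rotationOp (σ : UnitaryHalfBraiding X) (α : C) (k l : X.ι) :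
    (σ.rotationOp S α).mat k l = (σ.σ α l k)† := by
  have h := NatOp.mat_adj (IndMat.natOp S (σ.bounded α))
  rw [IndMat.mat_natOp] at h
  exact congrFun (congrFun h k) l

variable (S) in
/-- The rotation of a unitary half braiding. -/
def toRotation (σ : UnitaryHalfBraiding X) : Rotation S X where
  R := σ.rotationOp S
  adj_comp α := by
    have h := σ.unitary α
    rw [← IndMat.mat_natOp S (σ.bounded α), NatOp.isUnitary_mat_iff] at h
    rw [rotationOp, NatOp.adj_adj]
    exact h.2
  comp_adj α := by
    have h := σ.unitary α
    rw [← IndMat.mat_natOp S (σ.bounded α), NatOp.isUnitary_mat_iff] at h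
    rw [rotationOp, NatOp.adj_adj]
    exact h.1
  naturality {α β} u := NatOp.mat_injective (funext fun (k : X.ι) => funext fun (l : X.ι) => by
    refine ((naturality_dagger u (σ.mat_rotationOp (S := S) β k l).symm
      (σ.mat_rotationOp (S := S) α k l).symm).1
      (σ.naturality (u†) l k)).trans ?_
    exact (NatOp.mat_comp_diag (fun k => X.obj k ◁ u) _ _ (σ.rotationOp S β) k l).symm)
  unit := NatOp.mat_injective (funext fun (k : X.ι) => funext fun (l : X.ι) => by
    refine (σ.mat_rotationOp _ k l).trans ((congrArg _ (σ.unit l k)).trans ?_)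
    refine Eq.trans ?_ (NatOp.mat_unitRotation S X l k).symm
    exact dagger_unit_conj (unitary_leftUnitor _) (unitary_rightUnitor _) (IndMat.id_dagger X l k))
  mul α β := NatOp.mat_injective (funext fun (k : X.ι) => funext fun (l : X.ι) => by
    refine (σ.mat_rotationOp _ k l).trans ((congrArg _ (σ.multiplicativity α β l k)).trans ?_)
    refine Eq.trans ?_ (NatOp.mat_mulRotation _ _ k l).symm
    exact multiplicativity_dagger (fun m => (σ.mat_rotationOp β k m).symm)
      (fun m => (σ.mat_rotationOp α m l).symm))

theorem toRotation_injective {σ ρ : UnitaryHalfBraiding X}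
    (h : (σ.toRotation S).R = (ρ.toRotation S).R) : σ = ρ := by
  have : σ.σ = ρ.σ := funext fun α => funext fun k => funext fun l => by
    have h1 := (σ.mat_rotationOp (S := S) α l k).symm.trans
      ((congrArg (fun R : ∀ α, NatOp S (X.tensorRight α) (X.tensorLeft α) => (R α).mat l k) h).trans
        (ρ.mat_rotationOp α l k))
    have h2 : ∀ {A B : C} {x y : A ⟶ B}, x† = y† → x = y := fun h => by
      simpa only [dagger_dagger] using congrArg (fun x => x†) h
    exact h2 h1
  cases σ; cases ρ
  simp only at this
  subst this
  rfl

end UnitaryHalfBraiding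

namespace Rotation
variable {S : StandardSolutions C} {X : IndObj.{w} C} (R : Rotation S X)

/-- The unitary half braiding of a rotation. -/
def toHalfBraiding : UnitaryHalfBraiding X where
  σ α := (R.R α).adj.mat
  bounded α := (R.R α).adj.isBounded
  unitary α := by
    rw [NatOp.isUnitary_mat_iff, NatOp.adj_adj]
    exact ⟨R.comp_adj α, R.adj_comp α⟩
  naturality {α β} V k l := by
    have h := congrFun (congrFun (congrArg NatOp.mat (R.naturality (V†))) l) k
    have h' : (R.R β).mat l k ≫ V† ▷ X.obj l = X.obj k ◁ V† ≫ (R.R α).mat l k :=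
      h.trans (NatOp.mat_comp_diag (fun k => X.obj k ◁ V†) _ _ (R.R α) l k)
    rw [NatOp.mat_adj, NatOp.mat_adj]
    have h2 := (naturality_dagger (V†) (dagger_dagger ((R.R α).mat l k))
      (dagger_dagger ((R.R β).mat l k))).2 h'
    rw [dagger_dagger] at h2
    exact h2
  unit k l := by
    rw [NatOp.mat_adj, R.unit]
    refine (congrArg _ (NatOp.mat_unitRotation S X k l)).trans ?_
    exact dagger_unit_conj (unitary_rightUnitor _) (unitary_leftUnitor _) (IndMat.id_dagger X l k)
  multiplicativity α β k l := by
    have h : ∀ {A B : C} {x : A ⟶ B} {y : B ⟶ A}, y† = x → x† = y := fun h => by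
      rw [← h, dagger_dagger]
    simp only [NatOp.mat_adj]
    rw [R.mul]
    refine (congrArg _ (NatOp.mat_mulRotation _ _ l k)).trans (h ?_)
    exact multiplicativity_dagger (fun m => dagger_dagger _) (fun m => dagger_dagger _)

theorem toRotation_toHalfBraiding : (R.toHalfBraiding.toRotation S).R = R.R :=
  funext fun α => NatOp.mat_injective (funext fun (k : X.ι) => funext fun (l : X.ι) => by
    refine (R.toHalfBraiding.mat_rotationOp α k l).trans ?_
    change ((R.R α).adj.mat l k)† = _
    rw [NatOp.mat_adj]
    exact dagger_dagger _)

theorem inner_R {α γ : C} (ξ η : (X.tensorRight α).HomSpace S γ) :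
    inner ℂ ((R.R α).op γ ξ) ((R.R α).op γ η) = inner ℂ ξ η := by
  rw [← NatOp.adj_inner_left, ← NatOp.comp_op, R.adj_comp]
  rfl

end Rotation

namespace NatOp
variable {S : StandardSolutions C} {X : IndObj.{w} C}

theorem mapRight_whiskR {a α β : C} (u : α ⟶ β) (ξ : X.HomSpace S a) :
    (mapRight S X u).op _ (whiskR S X α a ξ) = pre S _ (a ◁ u) (whiskR S X β a ξ) :=
  ext' fun k => (whisker_exchange (ξ.component k) u).symm

theorem ptOp_mapLeft {b α β : C} (u : α ⟶ β) (ζ : (X.tensorLeft α).HomSpace S (β ⊗ b)) :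
    ptOp S X β b ((mapLeft S X u).op _ ζ) = ptOp S X α b (pre S _ (u ▷ b) ζ) :=
  ext' fun k => (S.partialTrace_slide u (ζ.component k)).symm

theorem tubeAct_unitRotation {a b : C} (V : 𝟙_ C ⊗ b ⟶ a ⊗ 𝟙_ C) (ξ : X.HomSpace S a) :
    (unitRotation S X).tubeAct V ξ = pre S X ((λ_ b).inv ≫ V ≫ (ρ_ a).hom) ξ := by
  refine ext' fun k => (S.partialTrace_unit _).trans ?_
  change (λ_ b).inv ≫ ((V ≫ ξ.component k ▷ 𝟙_ C) ≫
    (ρ_ (X.obj k)).hom ≫ (λ_ (X.obj k)).inv) ≫ (λ_ (X.obj k)).hom = _ ≫ ξ.component k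
  simp

end NatOp

namespace Rotation
variable {S : StandardSolutions C} {X : IndObj.{w} C} (R : Rotation S X)

/-- The action of a rotation. -/
def act {a b α : C} (V : α ⊗ b ⟶ a ⊗ α) : X.HomSpace S a →L[ℂ] X.HomSpace S b :=
  (R.R α).tubeAct V

theorem act_apply {a b α : C} (V : α ⊗ b ⟶ a ⊗ α) (ξ : X.HomSpace S a) :
    R.act V ξ = ptOp S X α b ((R.R α).op _ (pre S _ V (whiskR S X α a ξ))) := rfl

theorem pre_act {a b b' α : C} (g : b' ⟶ b) (V : α ⊗ b ⟶ a ⊗ α) (ξ : X.HomSpace S a) :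
    pre S X g (R.act V ξ) = R.act (α ◁ g ≫ V) ξ := by
  rw [act_apply, act_apply, ← ptOp_pre, ← NatOp.op_pre, pre_pre]

theorem slide {a b α β : C} (u : α ⟶ β) (V : β ⊗ b ⟶ a ⊗ α) (ξ : X.HomSpace S a) :
    R.act (u ▷ b ≫ V) ξ = R.act (V ≫ a ◁ u) ξ := by
  have h3 : ∀ {γ : C} (ζ : (X.tensorRight α).HomSpace S γ), (NatOp.mapLeft S X u).op _
      ((R.R α).op _ ζ) = (R.R β).op _ ((NatOp.mapRight S X u).op _ ζ) := fun ζ =>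
    congrArg (fun P => NatOp.op P _ ζ) (R.naturality u)
  rw [act_apply, act_apply, ← pre_pre, ← pre_pre, ← NatOp.mapRight_whiskR, NatOp.op_pre,
    ← NatOp.ptOp_mapLeft, ← NatOp.op_pre, h3, NatOp.op_pre]

theorem act_act {a b c α β : C} (V : α ⊗ b ⟶ a ⊗ α) (W : β ⊗ c ⟶ b ⊗ β) (ξ : X.HomSpace S a) :
    R.act W (R.act V ξ) = R.act (mulHom V W) ξ := by
  unfold act
  rw [R.mul, NatOp.tubeAct_mulRotation]

theorem act_unit {a : C} (ξ : X.HomSpace S a) : R.act ((λ_ a).hom ≫ (ρ_ a).inv) ξ = ξ := by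
  rw [act, R.unit, NatOp.tubeAct_unitRotation]
  simp [pre_id]

/-- For an action that comes from a rotation, this presents 1 ⊗ η explicitly as a value of R_α. It
uses only sliding, products and the unit, not the adjoint relation that is to be derived from it. -/
theorem R_contract (α b : C) (η : X.HomSpace S b) :
    (R.R α).op _ (pre S _ (S.coevR α (α ⊗ b)) (whiskR S X α _ (R.act (S.contract α b) η))) =
      whiskL S X α b η := by
  rw [← act_cap_act_contract R.act R.pre_act R.slide R.act_act R.act_unit α b η,
    R.act_apply (S.cap α (α ⊗ b) ≫ S.coevR α (α ⊗ b)), ← pre_pre,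
    NatOp.op_pre _ (S.cap α (α ⊗ b)), pre_cup_whiskL_ptOp, NatOp.op_pre]

/-- The annular action of a rotation. -/
def toAction : AnnularAction S X where
  act := R.act
  act_add V W ξ := by simp only [act_apply, pre_add_hom, map_add]
  act_smul c V ξ := by simp only [act_apply, pre_smul_hom, map_smul]
  act_pre f V ξ := by rw [act_apply, act_apply, ← pre_whiskR, pre_pre]
  pre_act := R.pre_act
  slide := R.slide
  act_act := R.act_act
  act_unit := R.act_unit
  inner_act {a b α} V ξ η := by
    -- The partial trace is moved to the other side as 1 ⊗ η, which is then replaced by a value of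
    -- R_α. The isometry R_α cancels from the scalar product, and what remains is V^# in the form of
    -- `sharpHom_eq`.
    rw [act_apply, ← inner_whiskL_left, ← R.R_contract, R.inner_R, ← sharpHom_eq, ← R.pre_act,
      inner_pre_left, pre_pre, inner_whiskR, inner_pre_left, dagger_dagger]

end Rotation

namespace AnnularAction
variable {S : StandardSolutions C} {X : IndObj.{w} C} (A : AnnularAction S X)

/-- Evaluation on caps and on the inclusions of summands already determines every column of P, by
Frobenius reciprocity. -/
theorem rotation_ext {α : C} {P Q : NatOp S (X.tensorRight α) (X.tensorLeft α)}
    (h : ∀ {a b : C} (V : α ⊗ b ⟶ a ⊗ α) (ξ : X.HomSpace S a), P.tubeAct V ξ = Q.tubeAct V ξ) :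
    P = Q := by
  refine NatOp.op_ext fun l => ptOp_injective α ?_
  have h1 : ∀ P : NatOp S (X.tensorRight α) (X.tensorLeft α),
      ptOp S X α _ (pre S _ (S.cap α (X.obj l ⊗ α)) (P.op _ (unitVec S (X.tensorRight α) l))) =
        P.tubeAct (S.cap α (X.obj l ⊗ α)) (unitVec S X l) := fun P => by
    refine (congrArg (ptOp S X α _) ?_ : _ = ptOp S X α _ (P.op _ (pre S _ _ (whiskR S X α _ _))))
    rw [P.op_pre]
    exact congrArg (fun ζ => pre S _ _ (P.op _ ζ)) (NatOp.whiskR_unitVec (X := X) α l).symm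
  exact (h1 P).trans ((h _ _).trans (h1 Q).symm)

theorem rotation_tubeAct {a b α : C} (V : α ⊗ b ⟶ a ⊗ α) (ξ : X.HomSpace S a) :
    (A.rotation α).tubeAct V ξ = A.act V ξ := A.ptOp_rotation V ξ

/-- Bending first α and then β writes an arbitrary V over α ⊗ β as a product of two caps with a
morphism u in front. Multiplicativity of the rotation then has to be checked only on products, where
it is the product rule of the action. -/
theorem exists_mulHom_cap {a c α β : C} (V : (α ⊗ β) ⊗ c ⟶ a ⊗ (α ⊗ β)) :
    ∃ u : c ⟶ (S β).bar ⊗ (((S α).bar ⊗ (a ⊗ α)) ⊗ β),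
      (α ⊗ β) ◁ u ≫ mulHom (S.cap α (a ⊗ α)) (S.cap β (((S α).bar ⊗ (a ⊗ α)) ⊗ β)) = V := by
  obtain ⟨w, hw⟩ := S.exists_whiskerLeft_cap ((α_ α β c).inv ≫ V ≫ (α_ a α β).inv)
  obtain ⟨u, hu⟩ := S.exists_whiskerLeft_cap (w ≫ (α_ (S α).bar (a ⊗ α) β).inv)
  refine ⟨u, ?_⟩
  have h1 : (α_ α ((S α).bar ⊗ (a ⊗ α)) β).inv ≫ S.cap α (a ⊗ α) ▷ β =
    α ◁ (α_ _ _ _).hom ≫ S.cap α ((a ⊗ α) ⊗ β) := S.cap_whiskerRight β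
  rw [mulHom]
  calc _ = (α_ α β c).hom ≫ α ◁ (β ◁ u ≫ S.cap β _) ≫ ((α_ α ((S α).bar ⊗ (a ⊗ α)) β).inv ≫
        S.cap α (a ⊗ α) ▷ β) ≫ (α_ a α β).hom := by
        simp only [Category.assoc, MonoidalCategory.whiskerLeft_comp]
        simp
    _ = (α_ α β c).hom ≫ (α ◁ w ≫ S.cap α ((a ⊗ α) ⊗ β)) ≫ (α_ a α β).hom := by
        rw [hu, h1, MonoidalCategory.whiskerLeft_comp]
        simp only [Category.assoc]
        rw [← MonoidalCategory.whiskerLeft_comp_assoc α (α_ _ _ _).inv, Iso.inv_hom_id,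
          MonoidalCategory.whiskerLeft_id, Category.id_comp]
    _ = V := by rw [hw]; simp

/-- The rotation of an annular action. -/
def toRotation : Rotation S X where
  R := A.rotation
  adj_comp α := (Classical.choose_spec (A.exists_rotation α)).2.1
  comp_adj α := (Classical.choose_spec (A.exists_rotation α)).2.2
  naturality {α β} u := by
    refine NatOp.op_ext fun (l : X.ι) => ptOp_injective β ?_
    have h : ∀ {b : C} (W : β ⊗ b ⟶ X.obj l ⊗ α) {ζ : (X.tensorRight α).HomSpace S (X.obj l ⊗ α)},
        whiskR S X α _ (unitVec S X l) = ζ →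
        ptOp S X β b (pre S _ W (((NatOp.mapLeft S X u).comp (A.rotation α)).op _ ζ)) =
          ptOp S X β b (pre S _ W (((A.rotation β).comp (NatOp.mapRight S X u)).op _ ζ)) := by
      rintro b W ζ rfl
      rw [NatOp.comp_op, NatOp.comp_op, NatOp.mapRight_whiskR, ← NatOp.op_pre, NatOp.ptOp_mapLeft,
        pre_pre, ← NatOp.op_pre, ← NatOp.op_pre, pre_pre, A.ptOp_rotation,
        A.ptOp_rotation, A.slide]
    exact h _ (NatOp.whiskR_unitVec α l)
  unit := rotation_ext fun {a b} V ξ => by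
    rw [rotation_tubeAct, NatOp.tubeAct_unitRotation]
    conv_rhs => rw [← A.act_unit ξ, A.pre_act]
    congr 2
    monoidal
  mul α β := rotation_ext fun {a c} V ξ => by
    obtain ⟨u, rfl⟩ := exists_mulHom_cap (S := S) V
    have h : ∀ P : NatOp S (X.tensorRight (α ⊗ β)) (X.tensorLeft (α ⊗ β)), ∀ {b : C}
        (W : (α ⊗ β) ⊗ b ⟶ a ⊗ (α ⊗ β)) (u : c ⟶ b),
        P.tubeAct ((α ⊗ β) ◁ u ≫ W) ξ = pre S X u (P.tubeAct W ξ) := fun P b W u => by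
      change ptOp S X _ c (P.op _ (pre S _ _ (whiskR S X _ a ξ))) = _
      rw [← pre_pre, P.op_pre, ptOp_pre]
      rfl
    rw [h, h, NatOp.tubeAct_mulRotation]
    simp only [rotation_tubeAct]
    rw [A.act_act]

end AnnularAction

end

/-! ### The tube algebra and decompositions into representatives. -/

section

open StandardSolutions TubeAlgebra

section Irreducible
variable (S : StandardSolutions C)

theorem IsIrreducible.comp_dagger {α β : C} (h : IsIrreducible α) (x y : α ⟶ β) :
    S.dim α • (x ≫ y†) = (inner ℂ (toHilb S y) (toHilb S x) : ℂ) • 𝟙 α := by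
  obtain ⟨c, hc, -⟩ := h (x ≫ y†)
  rw [inner_toHilb, hc, S.tr_smul, smul_smul, mul_comm]
  rfl

/-- By irreducibility f ≫ f† and f† ≫ f are scalars. They agree because f ≫ f† ≫ f can be computed
in two ways, so f becomes unitary after division by the square root of this scalar. -/
theorem IsIrreducible.exists_unitary {α β : C} (hα : IsIrreducible α) (hβ : IsIrreducible β)
    {f : α ⟶ β} (hf : f ≠ 0) : ∃ u : α ⟶ β, IsUnitaryHom u := by
  obtain ⟨r, hr, h⟩ := hα.exists_nonneg f
  have hr0 : 0 < r := by
    refine lt_of_le_of_ne hr fun h0 => hf (eq_zero_of_comp_dagger f ?_)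
    rw [h, ← h0, Complex.ofReal_zero, zero_smul]
  obtain ⟨c, hc, -⟩ := hβ (f† ≫ f)
  have hcr : c = r := by
    have h1 : (r : ℂ) • f = c • f := by
      calc (r : ℂ) • f = (f ≫ f†) ≫ f := by rw [h, Linear.smul_comp, Category.id_comp]
        _ = c • f := by rw [Category.assoc, hc, Linear.comp_smul, Category.comp_id]
    by_contra hne
    refine hf ?_
    have h2 : ((r : ℂ) - c) • f = 0 := by rw [sub_smul, h1, sub_self]
    exact (smul_eq_zero.1 h2).resolve_left (sub_ne_zero.2 (Ne.symm hne))
  have hs : ((√r : ℝ) : ℂ)⁻¹ * ((√r : ℝ) : ℂ)⁻¹ * r = 1 := by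
    have : ((√r : ℝ) : ℂ) * (√r : ℝ) = r := by
      rw [← Complex.ofReal_mul, Real.mul_self_sqrt hr]
    have h0 : ((√r : ℝ) : ℂ) ≠ 0 := by exact_mod_cast (Real.sqrt_pos.2 hr0).ne'
    rw [← this]
    field_simp
  refine ⟨((√r : ℝ) : ℂ)⁻¹ • f, ?_, ?_⟩
  · rw [dagger_smul, Linear.smul_comp, Linear.comp_smul, h, smul_smul, smul_smul, map_inv₀,
      Complex.conj_ofReal, hs, one_smul]
  · rw [dagger_smul, Linear.smul_comp, Linear.comp_smul, hc, hcr, smul_smul, smul_smul, map_inv₀,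
      Complex.conj_ofReal, hs, one_smul]

theorem IsIrr.eq_of_hom {I : Set C} (hI : IsIrr I) {α β : I} {f : α.1 ⟶ β.1} (hf : f ≠ 0) :
    α = β := by
  obtain ⟨u, hu⟩ := (hI.1 _ α.2).exists_unitary (hI.1 _ β.2) hf
  obtain ⟨i, -, hi⟩ := hI.2 α.1 (hI.1 _ α.2)
  exact Subtype.ext ((hi α.1 ⟨α.2, ⟨Iso.refl _⟩⟩).trans
    (hi β.1 ⟨β.2, ⟨⟨u, u†, hu.1, hu.2⟩⟩⟩).symm)

theorem IsIrr.exists_unitary {I : Set C} (hI : IsIrr I) {α : C} (h : IsIrreducible α) :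
    ∃ (i : I) (u : α ⟶ i.1), IsUnitaryHom u := by
  obtain ⟨i, ⟨hi, ⟨e⟩⟩, -⟩ := hI.2 α h
  have : e.hom ≠ 0 := fun h0 => h.id_ne_zero (by rw [← e.hom_inv_id, h0, Limits.zero_comp])
  obtain ⟨u, hu⟩ := h.exists_unitary (hI.1 i hi) this
  exact ⟨⟨i, hi⟩, u, hu⟩

end Irreducible

namespace TubeAlgebra
variable {S : StandardSolutions C} {I : Set C}

variable (S) in
/-- The inclusion of a summand, as a linear map. -/
def ofₗ (i j α : I) : (α.1 ⊗ j.1 ⟶ i.1 ⊗ α.1) →ₗ[ℂ] TubeAlgebra S I :=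
  DirectSum.lof ℂ (I × I × I) (fun t => (t.2.2.1 ⊗ t.2.1.1 ⟶ t.1.1 ⊗ t.2.2.1)) (i, j, α)

variable (S) in
/-- The scaled orthonormal basis of the morphisms from an irreducible object. -/
def basisIsometry (α β : C) (m : Fin (Module.finrank ℂ (HilbHom S α β))) : α ⟶ β :=
  ((√‖S.dim α‖ : ℝ) : ℂ) • (stdOrthonormalBasis ℂ (HilbHom S α β) m).hom

theorem sqrt_dim_mul_self (α : C) :
    ((√‖S.dim α‖ : ℝ) : ℂ) * ((√‖S.dim α‖ : ℝ) : ℂ) = S.dim α := by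
  rw [← Complex.ofReal_mul, Real.mul_self_sqrt (norm_nonneg _), ← S.dim_eq_trace]

theorem basisIsometry_dagger (α β : C) (m : Fin (Module.finrank ℂ (HilbHom S α β))) :
    (basisIsometry S α β m)† =
      ((√‖S.dim α‖ : ℝ) : ℂ) • (stdOrthonormalBasis ℂ (HilbHom S α β) m).hom† := by
  rw [basisIsometry, dagger_smul, Complex.conj_ofReal]

/-- For irreducible α the composite x ≫ y† is a scalar, and the trace scalar product of y and x is
d(α) times it. Orthonormal vectors thus become isometries with orthogonal ranges after
multiplication by √d(α), which accounts for the weight d(α) in `ofObj`. -/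
theorem basisIsometry_comp_dagger {α β : C} (h : IsIrreducible α)
    (m n : Fin (Module.finrank ℂ (HilbHom S α β))) :
    basisIsometry S α β m ≫ (basisIsometry S α β n)† = if m = n then 𝟙 α else 0 := by
  rw [basisIsometry_dagger, basisIsometry, Linear.smul_comp, Linear.comp_smul, smul_smul,
    sqrt_dim_mul_self, h.comp_dagger S]
  change (inner ℂ (stdOrthonormalBasis ℂ (HilbHom S α β) n)
    (stdOrthonormalBasis ℂ (HilbHom S α β) m) : ℂ) • 𝟙 α = _
  rw [orthonormal_iff_ite.1 (stdOrthonormalBasis ℂ (HilbHom S α β)).orthonormal n m]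
  by_cases h : m = n
  · rw [if_pos h, if_pos h.symm, one_smul]
  · rw [if_neg h, if_neg (Ne.symm h), zero_smul]

theorem basisIsometry_conj {i j α β : C} (V : β ⊗ j ⟶ i ⊗ β)
    (m : Fin (Module.finrank ℂ (HilbHom S α β))) :
    basisIsometry S α β m ▷ j ≫ V ≫ i ◁ (basisIsometry S α β m)† =
      S.dim α • (((stdOrthonormalBasis ℂ (HilbHom S α β) m).hom ▷ j) ≫ V ≫
        (i ◁ (stdOrthonormalBasis ℂ (HilbHom S α β) m).hom†)) := by
  rw [basisIsometry_dagger, basisIsometry, MonoidalLinear.smul_whiskerRight,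
    MonoidalLinear.whiskerLeft_smul, Linear.smul_comp, Linear.comp_smul, Linear.comp_smul,
    smul_smul, sqrt_dim_mul_self]

theorem sum_basisIsometry {α β : C} (hα : IsIrreducible α) (x : α ⟶ β) :
    x ≫ ∑ m, (basisIsometry S α β m)† ≫ basisIsometry S α β m = x := by
  have h1 : x = ∑ m, (inner ℂ (stdOrthonormalBasis ℂ (HilbHom S α β) m) (toHilb S x) : ℂ) •
      (stdOrthonormalBasis ℂ (HilbHom S α β) m).hom :=
    ((stdOrthonormalBasis ℂ (HilbHom S α β)).sum_repr' (toHilb S x)).symm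
  have h2 : ∀ m, x ≫ (basisIsometry S α β m)† ≫ basisIsometry S α β m =
      (inner ℂ (stdOrthonormalBasis ℂ (HilbHom S α β) m) (toHilb S x) : ℂ) •
        (stdOrthonormalBasis ℂ (HilbHom S α β) m).hom := fun m => by
    rw [basisIsometry_dagger, basisIsometry, Linear.smul_comp, Linear.comp_smul,
      Linear.comp_smul, Linear.comp_smul, smul_smul, sqrt_dim_mul_self, ← Category.assoc,
      ← Linear.smul_comp, hα.comp_dagger S, Linear.smul_comp, Category.id_comp]
    rfl
  rw [Preadditive.comp_sum]
  simp only [h2]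
  exact h1.symm

/-- The decomposition of an object into objects of `I`, and of the corresponding elements of the
tube algebra. -/
theorem exists_resolution (S : StandardSolutions C) (hI : IsIrr I) (β : C) :
    ∃ (K : Type u) (_ : Fintype K) (Y : K → I) (u : ∀ k, (Y k).1 ⟶ β), IsDirectSum u ∧
      ∀ (i j : I) (V : β ⊗ j.1 ⟶ i.1 ⊗ β),
        ofObj S i j β V = ∑ k, of S i j (Y k) (u k ▷ j.1 ≫ V ≫ i.1 ◁ (u k)†) := by
  obtain ⟨n, Z, v, hZ, hv⟩ := semisimple β
  choose z w hw using fun k => hI.exists_unitary (hZ k)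
  -- F collects the members of I that occur in β. All other members have only the zero morphism to
  -- β, so bases of morphisms for the members of F give the whole decomposition.
  let F : Finset I := Finset.univ.image z
  let K : Type u := Σ α : F, Fin (Module.finrank ℂ (HilbHom S α.1.1 β))
  let u : ∀ k : K, k.1.1.1 ⟶ β := fun k => basisIsometry S k.1.1.1 β k.2
  have hzero : ∀ α : I, α ∉ F → ∀ x : α.1 ⟶ β, x = 0 := fun α hα x => by
    calc x = x ≫ ∑ k, (v k)† ≫ v k := by rw [hv.2, Category.comp_id]
      _ = ∑ k, (x ≫ (v k)† ≫ w k) ≫ (w k)† ≫ v k := by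
          rw [Preadditive.comp_sum]
          refine Finset.sum_congr rfl fun k _ => ?_
          simp only [Category.assoc]
          rw [← Category.assoc (w k), (hw k).1, Category.id_comp]
      _ = 0 := by
          refine Finset.sum_eq_zero fun k _ => ?_
          by_cases h : x ≫ (v k)† ≫ w k = 0
          · rw [h, Limits.zero_comp]
          · exact absurd (Finset.mem_image.2 ⟨k, Finset.mem_univ k, (hI.eq_of_hom h).symm⟩) hα
  have horth : ∀ k l : K, k ≠ l → u k ≫ (u l)† = 0 := by
    rintro ⟨α, m⟩ ⟨β', n⟩ h
    by_cases hab : α = β'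
    · subst hab
      exact (basisIsometry_comp_dagger (hI.1 _ α.1.2) m n).trans
        (if_neg fun h' => h (by rw [h']))
    · by_contra h0
      exact hab (Subtype.ext (hI.eq_of_hom h0))
  have hiso : ∀ k : K, u k ≫ (u k)† = 𝟙 _ := fun k =>
    (basisIsometry_comp_dagger (hI.1 _ k.1.1.2) k.2 k.2).trans (if_pos rfl)
  have hsum : ∀ {α : I} (x : α.1 ⟶ β), x ≫ ∑ k, (u k)† ≫ u k = x := fun {α} x => by
    by_cases hα : α ∈ F
    · rw [Fintype.sum_sigma, Preadditive.comp_sum, Finset.sum_eq_single ⟨α, hα⟩]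
      · exact sum_basisIsometry (hI.1 _ α.2) x
      · intro α' _ hne
        rw [Preadditive.comp_sum]
        refine Finset.sum_eq_zero fun m _ => ?_
        by_cases h : x ≫ (u ⟨α', m⟩)† = 0
        · rw [← Category.assoc, h, Limits.zero_comp]
        · exact absurd (Subtype.ext (hI.eq_of_hom h).symm) hne
      · exact fun h => absurd (Finset.mem_univ _) h
    · rw [hzero α hα x, Limits.zero_comp]
  refine ⟨K, inferInstance, fun k => k.1.1, u, ⟨⟨fun k _ => hiso k, fun k _ l _ => horth k l⟩, ?_⟩,
    fun i j V => ?_⟩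
  · have h1 : ∀ k, v k ≫ ∑ k, (u k)† ≫ u k = v k := fun k => by
      have h2 := hsum ((w k)† ≫ v k)
      calc v k ≫ ∑ k, (u k)† ≫ u k = w k ≫ ((w k)† ≫ v k) ≫ ∑ k, (u k)† ≫ u k := by
            simp only [← Category.assoc]
            rw [(hw k).1, Category.id_comp]
        _ = v k := by rw [h2, ← Category.assoc, (hw k).1, Category.id_comp]
    calc ∑ k, (u k)† ≫ u k = (∑ l, (v l)† ≫ v l) ≫ ∑ k, (u k)† ≫ u k := by
          rw [hv.2, Category.id_comp]
      _ = ∑ l, (v l)† ≫ v l := by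
          rw [Preadditive.sum_comp]
          refine Finset.sum_congr rfl fun l _ => ?_
          rw [Category.assoc, h1]
      _ = 𝟙 β := hv.2
  -- Terms outside F vanish, and the weight d(α) is split between u k and its adjoint.
  · rw [ofObj, finsum_eq_sum_of_support_subset (s := F), Fintype.sum_sigma, ← Finset.sum_coe_sort]
    · refine Finset.sum_congr rfl fun α _ => ?_
      refine (map_sum (ofₗ S i j α.1) _ _).trans (Finset.sum_congr rfl fun m _ => ?_)
      exact congrArg (ofₗ S i j α.1) (basisIsometry_conj V m).symm
    · intro α hα
      by_contra h
      refine hα ?_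
      refine (congrArg (ofₗ S i j α) (Finset.sum_eq_zero fun m _ => ?_)).trans (map_zero _)
      rw [hzero α h (stdOrthonormalBasis ℂ (HilbHom S α.1 β) m).hom]
      simp

theorem ofObj_add (hI : IsIrr I) (i j : I) (β : C) (V W : β ⊗ j.1 ⟶ i.1 ⊗ β) :
    ofObj S i j β (V + W) = ofObj S i j β V + ofObj S i j β W := by
  obtain ⟨K, _, Y, u, -, h⟩ := exists_resolution S hI β
  rw [h, h, h, ← Finset.sum_add_distrib]
  refine Finset.sum_congr rfl fun k _ => ?_
  rw [Preadditive.add_comp, Preadditive.comp_add]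
  exact map_add (ofₗ S i j (Y k)) _ _

theorem ofObj_smul (hI : IsIrr I) (i j : I) (β : C) (c : ℂ) (V : β ⊗ j.1 ⟶ i.1 ⊗ β) :
    ofObj S i j β (c • V) = c • ofObj S i j β V := by
  obtain ⟨K, _, Y, u, -, h⟩ := exists_resolution S hI β
  rw [h, h, Finset.smul_sum]
  refine Finset.sum_congr rfl fun k _ => ?_
  rw [Linear.smul_comp, Linear.comp_smul]
  exact map_smul (ofₗ S i j (Y k)) c _

/-- The map `ofObj`, as a linear map. -/
def ofObjₗ (S : StandardSolutions C) (hI : IsIrr I) (i j : I) (β : C) :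
    (β ⊗ j.1 ⟶ i.1 ⊗ β) →ₗ[ℂ] TubeAlgebra S I where
  toFun := ofObj S i j β
  map_add' := ofObj_add hI i j β
  map_smul' := ofObj_smul hI i j β

/-- All summands of an object of I are that object itself, so the inclusions are scalars c k. They
satisfy ∑ |c k|² = 1, and the components add up to V. -/
theorem ofObj_of (hI : IsIrr I) (i j α : I) (V : α.1 ⊗ j.1 ⟶ i.1 ⊗ α.1) :
    ofObj S i j α.1 V = of S i j α V := by
  obtain ⟨K, _, Y, u, hu, h⟩ := exists_resolution S hI α.1
  have hY : ∀ k, Y k = α := fun k => hI.eq_of_hom (f := u k) fun h0 => by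
    have := hu.1.1 k (Finset.mem_univ k)
    rw [h0, Limits.zero_comp] at this
    exact (hI.1 _ (Y k).2).id_ne_zero this.symm
  obtain rfl : Y = fun _ => α := funext hY
  choose c hc using fun k => (hI.1 _ α.2 (u k)).exists
  have h1 : ∑ k, (starRingEnd ℂ) (c k) * c k = 1 := by
    refine (hI.1 _ α.2).smul_injective ?_
    rw [one_smul, Finset.sum_smul]
    refine Eq.trans ?_ hu.2
    refine Finset.sum_congr rfl fun k _ => ?_
    have h2 : (u k)† = (starRingEnd ℂ) (c k) • 𝟙 α.1 := by
      conv_lhs => rw [hc k]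
      rw [dagger_smul, dagger_id]
    rw [h2, Linear.smul_comp, Category.id_comp]
    rw [mul_smul, ← hc k]
  rw [h]
  have h2 : ∀ k, u k ▷ j.1 ≫ V ≫ i.1 ◁ (u k)† = ((starRingEnd ℂ) (c k) * c k) • V := fun k => by
    have h2 : (u k)† = (starRingEnd ℂ) (c k) • 𝟙 α.1 := by
      conv_lhs => rw [hc k]
      rw [dagger_smul, dagger_id]
    rw [h2]
    conv_lhs => rw [hc k]
    simp [smul_smul, mul_comm]
  refine (map_sum (ofₗ S i j α) _ _).symm.trans (congrArg (ofₗ S i j α) ?_)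
  simp only [h2]
  rw [← Finset.sum_smul, h1, one_smul]

/-- Expand U ≫ f in the basis for β and f ≫ U'† in the adjoints of the basis for α. The coefficients
are the same scalar products, so both sides are the same double sum. This sliding relation makes
`ofObj` compatible with arbitrary decompositions. -/
theorem ofObj_slide (i j : I) {α β : C} (f : α ⟶ β) (V : β ⊗ j.1 ⟶ i.1 ⊗ α) :
    ofObj S i j α (f ▷ j.1 ≫ V) = ofObj S i j β (V ≫ i.1 ◁ f) := by
  unfold ofObj
  refine finsum_congr fun γ => congrArg (of S i j γ) ?_
  rw [← Finset.smul_sum, ← Finset.smul_sum]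
  congr 1
  let e := stdOrthonormalBasis ℂ (HilbHom S γ.1 α)
  let e' := stdOrthonormalBasis ℂ (HilbHom S γ.1 β)
  have h1 : ∀ m, (e m).hom ≫ f =
      ∑ n, (inner ℂ (e' n) (toHilb S ((e m).hom ≫ f)) : ℂ) • (e' n).hom := fun m =>
    (e'.sum_repr' (toHilb S ((e m).hom ≫ f))).symm
  have h2 : ∀ n, f ≫ (e' n).hom† =
      ∑ m, (inner ℂ (e' n) (toHilb S ((e m).hom ≫ f)) : ℂ) • (e m).hom† := fun n => by
    have h3 : (e' n).hom ≫ f† =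
        ∑ m, (inner ℂ (e m) (toHilb S ((e' n).hom ≫ f†)) : ℂ) • (e m).hom :=
      (e.sum_repr' (toHilb S ((e' n).hom ≫ f†))).symm
    have h4 := congrArg (fun x => x†) h3
    simp only [dagger_comp, dagger_dagger, dagger_sum, dagger_smul] at h4
    refine h4.trans (Finset.sum_congr rfl fun m _ => ?_)
    congr 1
    rw [inner_conj_symm]
    change S.tr γ.1 ((e m).hom ≫ ((e' n).hom ≫ f†)†) = S.tr γ.1 (((e m).hom ≫ f) ≫ (e' n).hom†)
    rw [dagger_comp, dagger_dagger, Category.assoc]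
  have h5 : ∀ m, (e m).hom ▷ j.1 ≫ (f ▷ j.1 ≫ V) ≫ i.1 ◁ (e m).hom† =
      ∑ n, (inner ℂ (e' n) (toHilb S ((e m).hom ≫ f)) : ℂ) •
        ((e' n).hom ▷ j.1 ≫ V ≫ i.1 ◁ (e m).hom†) := fun m => by
    conv_lhs => rw [Category.assoc, ← comp_whiskerRight_assoc, h1 m, sum_whiskerRight,
      Preadditive.sum_comp]
    simp only [MonoidalLinear.smul_whiskerRight, Linear.smul_comp]
  have h6 : ∀ n, (e' n).hom ▷ j.1 ≫ (V ≫ i.1 ◁ f) ≫ i.1 ◁ (e' n).hom† =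
      ∑ m, (inner ℂ (e' n) (toHilb S ((e m).hom ≫ f)) : ℂ) •
        ((e' n).hom ▷ j.1 ≫ V ≫ i.1 ◁ (e m).hom†) := fun n => by
    rw [Category.assoc, ← MonoidalCategory.whiskerLeft_comp, h2 n, whiskerLeft_sum,
      Preadditive.comp_sum, Preadditive.comp_sum]
    simp only [MonoidalLinear.whiskerLeft_smul, Linear.comp_smul]
  refine (Finset.sum_congr rfl fun m _ => h5 m).trans (Finset.sum_comm.trans ?_)
  exact Finset.sum_congr rfl fun n _ => (h6 n).symm

theorem sum_of (a : TubeAlgebra S I) :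
    a = ∑ p ∈ a.support, of S p.1 p.2.1 p.2.2 (a.component p.1 p.2.1 p.2.2) :=
  (DirectSum.sum_support_of (β := fun t : I × I × I =>
    (t.2.2.1 ⊗ t.2.1.1 ⟶ t.1.1 ⊗ t.2.2.1)) a).symm

theorem support_of {i j α : I} {V : α.1 ⊗ j.1 ⟶ i.1 ⊗ α.1} (hV : V ≠ 0) :
    (of S i j α V).support = {(i, j, α)} :=
  DirectSum.support_of (β := fun t : I × I × I =>
    (t.2.2.1 ⊗ t.2.1.1 ⟶ t.1.1 ⊗ t.2.2.1)) (i, j, α) V hV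

theorem component_of (i j α : I) (V : α.1 ⊗ j.1 ⟶ i.1 ⊗ α.1) :
    (of S i j α V).component i j α = V :=
  DirectSum.of_eq_same (β := fun t : I × I × I =>
    (t.2.2.1 ⊗ t.2.1.1 ⟶ t.1.1 ⊗ t.2.2.1)) (i, j, α) V

theorem mul_def (a b : TubeAlgebra S I) : a * b = ∑ p ∈ a.support, ∑ q ∈ b.support,
    if q.1 = p.2.1 then
      ofObj S p.1 q.2.1 (p.2.2.1 ⊗ q.2.2.1)
        (mulHom (a.component p.1 p.2.1 p.2.2) (b.component p.2.1 q.2.1 q.2.2))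
    else 0 := rfl

theorem of_mul_of (hI : IsIrr I) (i k j α β : I) (V : α.1 ⊗ k.1 ⟶ i.1 ⊗ α.1)
    (W : β.1 ⊗ j.1 ⟶ k.1 ⊗ β.1) :
    of S i k α V * of S k j β W = ofObj S i j (α.1 ⊗ β.1) (mulHom V W) := by
  have hz : ofObj S i j (α.1 ⊗ β.1) 0 = 0 := map_zero (ofObjₗ S hI i j _)
  -- The product is summed over supports, and a zero component has empty support; the zero cases are
  -- therefore separate.
  by_cases hV : V = 0
  · subst hV
    have h0 : of S i k α (0 : α.1 ⊗ k.1 ⟶ i.1 ⊗ α.1) = 0 := map_zero (ofₗ S i k α)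
    rw [h0, mulHom]
    simp [hz]
    rfl
  by_cases hW : W = 0
  · subst hW
    have h0 : of S k j β (0 : β.1 ⊗ j.1 ⟶ k.1 ⊗ β.1) = 0 := map_zero (ofₗ S k j β)
    have hs : (0 : TubeAlgebra S I).support = ∅ := DFinsupp.support_zero
    rw [h0, mulHom, mul_def, hs]
    simp [hz]
  rw [mul_def, support_of hV, support_of hW, Finset.sum_singleton, Finset.sum_singleton, if_pos rfl,
    component_of, component_of]

theorem of_mul_of_ne {i k k' j α β : I} (hk : k ≠ k') (V : α.1 ⊗ k.1 ⟶ i.1 ⊗ α.1)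
    (W : β.1 ⊗ j.1 ⟶ k'.1 ⊗ β.1) : of S i k α V * of S k' j β W = 0 := by
  have hs : ∀ {i j α : I} {V : α.1 ⊗ j.1 ⟶ i.1 ⊗ α.1} {p : I × I × I},
      p ∈ (of S i j α V).support → p = (i, j, α) := fun {i j α V p} hp => by
    by_cases hV : V = 0
    · subst hV
      have h0 : of S i j α (0 : α.1 ⊗ j.1 ⟶ i.1 ⊗ α.1) = 0 := map_zero (ofₗ S i j α)
      have h1 : (0 : TubeAlgebra S I).support = ∅ := DFinsupp.support_zero
      rw [h0, h1] at hp
      exact absurd hp (Finset.notMem_empty _)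
    · rw [support_of hV] at hp
      exact Finset.mem_singleton.1 hp
  rw [mul_def]
  refine Finset.sum_eq_zero fun p hp => Finset.sum_eq_zero fun q hq => if_neg ?_
  rw [hs hp, hs hq]
  exact Ne.symm hk

theorem sharp_of (hI : IsIrr I) (i j α : I) (V : α.1 ⊗ j.1 ⟶ i.1 ⊗ α.1) :
    sharp (of S i j α V) = ofObj S j i (S α.1).bar (sharpHom S V) := by
  by_cases hV : V = 0
  · subst hV
    have h0 : of S i j α (0 : α.1 ⊗ j.1 ⟶ i.1 ⊗ α.1) = 0 := map_zero (ofₗ S i j α)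
    have hz : ofObj S j i (S α.1).bar 0 = 0 := map_zero (ofObjₗ S hI j i _)
    have hs : (0 : TubeAlgebra S I).support = ∅ := DFinsupp.support_zero
    rw [h0, sharp, hs, sharpHom, dagger_zero]
    simp [hz]
  · rw [sharp, support_of hV, Finset.sum_singleton, component_of]

theorem mulHom_conj {i j k α β α' β' : C} (V : α ⊗ k ⟶ i ⊗ α) (W : β ⊗ j ⟶ k ⊗ β)
    (f : α' ⟶ α) (g : β' ⟶ β) :
    mulHom (f ▷ k ≫ V ≫ i ◁ f†) (g ▷ j ≫ W ≫ k ◁ g†) =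
      (f ⊗ₘ g) ▷ j ≫ mulHom V W ≫ i ◁ (f† ⊗ₘ g†) := by
  rw [mulHom, mulHom, MonoidalCategory.tensorHom_def, MonoidalCategory.tensorHom_def]
  calc _ = 𝟙 _ ⊗≫ α' ◁ (g ▷ j ≫ W) ⊗≫ ((α' ⊗ k) ◁ g† ≫ (f ▷ k ≫ V ≫ i ◁ f†) ▷ β') ⊗≫ 𝟙 _ := by
        monoidal
    _ = 𝟙 _ ⊗≫ (α' ◁ (g ▷ j ≫ W) ≫ f ▷ (k ⊗ β)) ⊗≫ (V ≫ i ◁ f†) ▷ β ⊗≫ (i ⊗ α') ◁ g† ⊗≫ 𝟙 _ := by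
        rw [whisker_exchange]
        monoidal
    _ = _ := by
        rw [whisker_exchange]
        monoidal

/-- Drawing f out of V^# through `s` and f† through `t†` turns them into transposes. Both moves need
standard solutions. With f an inclusion of a decomposition of β, this decomposes the conjugate of β
accordingly. -/
theorem sharpHom_conj {i j α β : C} (V : β ⊗ j ⟶ i ⊗ β) (f : α ⟶ β) :
    sharpHom S (f ▷ j ≫ V ≫ i ◁ f†) = (S β).transpose (S α) (f†) ▷ i ≫ sharpHom S V ≫
      j ◁ (S α).transpose (S β) f := by
  have h1 := (S β).transpose_t_dagger (S α) (f†)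
  have h2 := (S α).s_transpose (S β) f
  generalize (S β).transpose (S α) (f†) = f₁ at h1 ⊢
  generalize (S α).transpose (S β) f = f₂ at h2 ⊢
  rw [sharpHom, sharpHom]
  simp only [dagger_comp, dagger_whiskerLeft, dagger_whiskerRight, dagger_dagger]
  calc _ = 𝟙 _ ⊗≫ (S α).bar ◁ i ◁ ((S α).s ≫ f ▷ (S α).bar) ⊗≫ (S α).bar ◁ V† ▷ (S α).bar ⊗≫
        ((S α).bar ◁ f† ≫ (S α).t†) ▷ (j ⊗ (S α).bar) ⊗≫ 𝟙 _ := by monoidal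
    _ = 𝟙 _ ⊗≫ (S α).bar ◁ i ◁ (S β).s ⊗≫ (((S α).bar ⊗ (i ⊗ β)) ◁ f₂ ≫
        ((S α).bar ◁ V† ⊗≫ (f₁ ▷ β ≫ (S β).t†) ▷ j) ▷ (S α).bar) ⊗≫ 𝟙 _ := by
        rw [← h1, ← h2]
        monoidal
    _ = 𝟙 _ ⊗≫ ((S α).bar ◁ (i ◁ (S β).s ⊗≫ V† ▷ (S β).bar) ≫ f₁ ▷ ((β ⊗ j) ⊗ (S β).bar)) ⊗≫
        ((S β).t† ▷ (j ⊗ (S β).bar)) ⊗≫ j ◁ f₂ ⊗≫ 𝟙 _ := by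
        rw [whisker_exchange]
        monoidal
    _ = _ := by
        rw [whisker_exchange]
        monoidal

end TubeAlgebra

end

/-! ### Module relations for elements given by arbitrary objects. -/

section

open IndObj.HomSpace StandardSolutions TubeAlgebra

namespace RightHilbertModule
variable {S : StandardSolutions C} {I : Set C} {K : Type w} [NormedAddCommGroup K]
  [InnerProductSpace ℂ K] [CompleteSpace K] (M : RightHilbertModule S I K)

theorem act_zero_mul {a b : TubeAlgebra S I} (h : a * b = 0) (ξ : K) :
    M.act b (M.act a ξ) = 0 := by
  rw [← M.act_mul, h, map_zero]
  rfl

theorem act_ofObj_resolution (i j : I) {β : C} {J : Type u} [Fintype J] {Y : J → C}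
    {u : ∀ k, Y k ⟶ β} (hI : IsIrr I) (h : ∑ k, (u k)† ≫ u k = 𝟙 β)
    (V : β ⊗ j.1 ⟶ i.1 ⊗ β) :
    ∑ k, ofObj S i j (Y k) (u k ▷ j.1 ≫ V ≫ i.1 ◁ (u k)†) = ofObj S i j β V := by
  have h1 : ∀ k, ofObj S i j (Y k) (u k ▷ j.1 ≫ V ≫ i.1 ◁ (u k)†) =
      ofObjₗ S hI i j β (V ≫ i.1 ◁ ((u k)† ≫ u k)) := fun k => by
    rw [ofObj_slide, Category.assoc, ← MonoidalCategory.whiskerLeft_comp]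
    rfl
  simp only [h1]
  rw [← map_sum, ← Preadditive.comp_sum, ← whiskerLeft_sum, h, MonoidalCategory.whiskerLeft_id,
    Category.comp_id]
  rfl

/-- Decompositions u k of α and v l of β give the decomposition u k ⊗ v l of α ⊗ β. The relation
thus reduces to products of homogeneous elements with α and β in I. -/
theorem act_ofObj_ofObj (hI : IsIrr I) (i k j : I) {α β : C} (V : α ⊗ k.1 ⟶ i.1 ⊗ α)
    (W : β ⊗ j.1 ⟶ k.1 ⊗ β) (ξ : K) :
    M.act (ofObj S k j β W) (M.act (ofObj S i k α V) ξ) =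
      M.act (ofObj S i j (α ⊗ β) (mulHom V W)) ξ := by
  obtain ⟨K₁, _, Y₁, u, hu, h1⟩ := exists_resolution S hI α
  obtain ⟨K₂, _, Y₂, v, hv, h2⟩ := exists_resolution S hI β
  have h3 : ∑ p : K₁ × K₂, (u p.1 ⊗ₘ v p.2)† ≫ (u p.1 ⊗ₘ v p.2) = 𝟙 (α ⊗ β) := by
    rw [Fintype.sum_prod_type]
    have h4 : ∀ k l, (u k ⊗ₘ v l)† ≫ (u k ⊗ₘ v l) =
        ((u k)† ≫ u k) ▷ β ≫ α ◁ ((v l)† ≫ v l) := fun k l => by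
      rw [dagger_tensorHom, tensorHom_comp_tensorHom, MonoidalCategory.tensorHom_def]
    have h5 : ∀ k, ∑ l, (u k ⊗ₘ v l)† ≫ (u k ⊗ₘ v l) = ((u k)† ≫ u k) ▷ β := fun k => by
      refine (Finset.sum_congr rfl fun l _ => h4 k l).trans ?_
      rw [← Preadditive.comp_sum, ← whiskerLeft_sum, hv.2, MonoidalCategory.whiskerLeft_id,
        Category.comp_id]
    refine (Finset.sum_congr rfl fun k _ => h5 k).trans ?_
    rw [← sum_whiskerRight, hu.2, id_whiskerRight]
  rw [← act_ofObj_resolution i j hI h3, h1, h2, Fintype.sum_prod_type]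
  simp only [map_sum, sum_apply]
  refine Finset.sum_congr rfl fun k _ => Finset.sum_congr rfl fun l _ => ?_
  rw [← M.act_mul, of_mul_of hI, mulHom_conj, dagger_tensorHom]

theorem act_ofObj_of_ne (hI : IsIrr I) {i k k' j : I} (hk : k ≠ k') {α β : C}
    (V : α ⊗ k.1 ⟶ i.1 ⊗ α) (W : β ⊗ j.1 ⟶ k'.1 ⊗ β) (ξ : K) :
    M.act (ofObj S k' j β W) (M.act (ofObj S i k α V) ξ) = 0 := by
  obtain ⟨K₁, _, Y₁, u, hu, h1⟩ := exists_resolution S hI α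
  obtain ⟨K₂, _, Y₂, v, hv, h2⟩ := exists_resolution S hI β
  rw [h1, h2]
  simp only [map_sum, sum_apply]
  refine Finset.sum_eq_zero fun l _ => Finset.sum_eq_zero fun m _ => ?_
  exact M.act_zero_mul (of_mul_of_ne hk _ _) ξ

/-- After decomposing α into members of I, the module axiom applies to each summand. The terms V^#
are reassembled by sliding the transposes together: the transposes of the projections of α add up to
the identity of its conjugate. -/
theorem inner_act_ofObj (hI : IsIrr I) (i j : I) {α : C} (V : α ⊗ j.1 ⟶ i.1 ⊗ α) (ξ η : K) :
    inner ℂ (M.act (ofObj S j i (S α).bar (sharpHom S V)) ξ) η =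
      inner ℂ ξ (M.act (ofObj S i j α V) η) := by
  obtain ⟨K₁, _, Y₁, u, hu, h1⟩ := exists_resolution S hI α
  have h2 : ∑ k, ofObj S j i (S (Y₁ k).1).bar (sharpHom S (u k ▷ j.1 ≫ V ≫ i.1 ◁ (u k)†)) =
      ofObj S j i (S α).bar (sharpHom S V) := by
    have h3 : ∀ k, ofObj S j i (S (Y₁ k).1).bar (sharpHom S (u k ▷ j.1 ≫ V ≫ i.1 ◁ (u k)†)) =
        ofObjₗ S hI j i (S α).bar (sharpHom S V ≫
          j.1 ◁ (S α).transpose (S α) ((u k)† ≫ u k)) := fun k => by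
      rw [sharpHom_conj, ofObj_slide, Category.assoc, ← MonoidalCategory.whiskerLeft_comp,
        StandardSolution.transpose, StandardSolution.transpose, StandardSolution.transpose,
        ConjugateSolution.transpose_comp _ (S (Y₁ k).1).toConjugateSolution]
      rfl
    have h4 : ∑ k, (S α).transpose (S α) ((u k)† ≫ u k) = 𝟙 _ := by
      rw [← ConjugateSolution.transpose_id, ← hu.2]
      exact (map_sum (⟨⟨(S α).transpose (S α), by
        simpa using ConjugateSolution.transpose_smul (S α).toConjugateSolution
          (S α).toConjugateSolution 0 0⟩,
        fun f g => ConjugateSolution.transpose_add _ _ f g⟩ : (α ⟶ α) →+ _) _ _).symm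
    simp only [h3]
    rw [← map_sum, ← Preadditive.comp_sum, ← whiskerLeft_sum, h4,
      MonoidalCategory.whiskerLeft_id, Category.comp_id]
    rfl
  rw [← h2, h1]
  simp only [map_sum, sum_apply, sum_inner, inner_sum]
  refine Finset.sum_congr rfl fun k _ => ?_
  rw [← sharp_of hI, M.act_sharp]

theorem ofObj_mulHom_unit_right (i j : I) {α : C} (V : α ⊗ j.1 ⟶ i.1 ⊗ α) :
    ofObj S i j (α ⊗ 𝟙_ C) (mulHom V ((λ_ j.1).hom ≫ (ρ_ j.1).inv)) = ofObj S i j α V := by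
  have : mulHom V ((λ_ j.1).hom ≫ (ρ_ j.1).inv) = (ρ_ α).hom ▷ j.1 ≫ V ≫ i.1 ◁ (ρ_ α).inv := by
    rw [mulHom]
    monoidal
  rw [this, ofObj_slide, Category.assoc, ← MonoidalCategory.whiskerLeft_comp, Iso.inv_hom_id,
    MonoidalCategory.whiskerLeft_id, Category.comp_id]

theorem act_proj_act_ofObj (hI : IsIrr I) (i j : I) {α : C} (V : α ⊗ j.1 ⟶ i.1 ⊗ α) (ξ : K) :
    M.act (proj S j) (M.act (ofObj S i j α V) ξ) = M.act (ofObj S i j α V) ξ := by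
  rw [proj, M.act_ofObj_ofObj hI, ofObj_mulHom_unit_right]

theorem act_ofObj_act_proj_of_ne (hI : IsIrr I) {i i' j : I} (hi : i' ≠ i) {α : C}
    (V : α ⊗ j.1 ⟶ i.1 ⊗ α) (ξ : K) :
    M.act (ofObj S i j α V) (M.act (proj S i') ξ) = 0 :=
  M.act_ofObj_of_ne hI hi _ _ _

theorem act_proj_act_proj (hI : IsIrr I) (i : I) (ξ : K) :
    M.act (proj S i) (M.act (proj S i) ξ) = M.act (proj S i) ξ :=
  M.act_proj_act_ofObj hI i i _ ξ

/-- Let P be the action of p_i and Q that of the element given by its `sharpHom`. Then Q is the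
adjoint of P, and P Q = Q because Q takes values in K · p_i. Hence Q = P P* is selfadjoint and
equals P; the element p_i^# itself need not be computed. -/
theorem inner_act_proj (hI : IsIrr I) (i : I) (ξ η : K) :
    inner ℂ (M.act (proj S i) ξ) η = inner ℂ ξ (M.act (proj S i) η) := by
  have h := M.inner_act_ofObj hI i i ((λ_ i.1).hom ≫ (ρ_ i.1).inv)
  have h1 : ∀ ξ, M.act (proj S i) (M.act (ofObj S i i _ (sharpHom S ((λ_ i.1).hom ≫ (ρ_ i.1).inv))) ξ) =
      M.act (ofObj S i i _ (sharpHom S ((λ_ i.1).hom ≫ (ρ_ i.1).inv))) ξ := fun ξ =>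
    M.act_proj_act_ofObj hI i i _ ξ
  generalize M.act (ofObj S i i _ (sharpHom S ((λ_ i.1).hom ≫ (ρ_ i.1).inv))) = Q at h h1
  change ∀ ξ η, inner ℂ (Q ξ) η = inner ℂ ξ (M.act (proj S i) η) at h
  generalize M.act (proj S i) = P at h h1
  have h' : ∀ ξ η, inner ℂ (P ξ) η = inner ℂ ξ (Q η) := fun ξ η => by
    rw [← inner_conj_symm, ← h, inner_conj_symm]
  exact (h' ξ η).trans ((congrArg (inner ℂ ξ) (h1 η).symm).trans ((h ξ (Q η)).symm.trans
    ((h' (Q ξ) η).symm.trans ((congrArg (inner ℂ · η) (h1 ξ)).trans (h ξ η)))))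

theorem inner_act_proj_of_ne (hI : IsIrr I) {i j : I} (hij : i ≠ j) (ξ η : K) :
    inner ℂ (M.act (proj S i) ξ) (M.act (proj S j) η) = 0 := by
  rw [M.inner_act_proj hI]
  have h := M.act_ofObj_act_proj_of_ne hI hij.symm ((λ_ i.1).hom ≫ (ρ_ i.1).inv) η
  rw [proj, h, inner_zero_right]

/-- Elements of (iα, αj) map K into K · p_j, since p_j acts as a unit there; so K · A lies in the
span of the subspaces K · p_j. -/
theorem dense_proj (hI : IsIrr I) (hM : M.Nondegenerate) :
    (⨆ i : I, (M.act (proj S i)).range).topologicalClosure = ⊤ := by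
  rw [← Submodule.dense_iff_topologicalClosure_eq_top]
  refine hM.mono (SetLike.coe_subset_coe.2 (Submodule.span_le.2 ?_))
  rintro _ ⟨a, ξ, rfl⟩
  rw [sum_of a]
  simp only [map_sum, sum_apply]
  refine Submodule.sum_mem _ fun p _ => ?_
  refine Submodule.mem_iSup_of_mem p.2.1 ⟨M.act (of S p.1 p.2.1 p.2.2
    (a.component p.1 p.2.1 p.2.2)) ξ, ?_⟩
  rw [← ofObj_of hI]
  exact M.act_proj_act_ofObj hI _ _ _ ξ

/-- Linear maps on the tube algebra which agree on the homogeneous elements are equal. -/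
theorem act_induction {L : Type w'} [AddCommGroup L] [Module ℂ L] {f g : TubeAlgebra S I →ₗ[ℂ] L}
    (h : ∀ (i j α : I) (V : α.1 ⊗ j.1 ⟶ i.1 ⊗ α.1), f (of S i j α V) = g (of S i j α V)) :
    f = g := by
  refine LinearMap.ext fun a => ?_
  rw [sum_of a, map_sum, map_sum]
  exact Finset.sum_congr rfl fun p _ => h _ _ _ _

end RightHilbertModule

end

/-! ### From half braidings to modules. -/

section

open IndObj.HomSpace StandardSolutions TubeAlgebra

section
variable {J : Type*} {E : J → Type*} [∀ j, NormedAddCommGroup (E j)]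
  [∀ j, InnerProductSpace ℂ (E j)]

theorem inner_lpIncl_of_ne {i j : J} (h : i ≠ j) (x : E i) (y : E j) :
    inner ℂ (lpIncl E i x) (lpIncl E j y) = 0 := by
  refine (lp.inner_single_left (𝕜 := ℂ) (G := E) i x (lpIncl E j y)).trans ?_
  have : (lpIncl E j y : ∀ i, E i) i = 0 := lp.single_apply_ne (E := E) 2 j y h
  rw [this, inner_zero_right]

theorem hasSum_lpIncl (x : lp E 2) : HasSum (fun j => lpIncl E j (x j)) x :=
  lp.hasSum_single (E := E) (by norm_num) x

end

namespace IndObj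
variable {S : StandardSolutions C} {I : Set C} {X Y Z : IndObj.{w} C}

theorem inner_incl_of_ne {i j : I} (h : i ≠ j) (ξ : X.HomSpace S i.1) (η : X.HomSpace S j.1) :
    inner ℂ (X.incl S I i ξ) (X.incl S I j η) = 0 :=
  inner_lpIncl_of_ne (E := fun i : I => X.HomSpace S i.1) h ξ η

theorem hasSum_incl (ξ : X.Total S I) : HasSum (fun i => X.incl S I i (ξ i)) ξ :=
  hasSum_lpIncl ξ

theorem total_ext {F : Type*} [NormedAddCommGroup F] [NormedSpace ℂ F] {f g : X.Total S I →L[ℂ] F}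
    (h : ∀ (i : I) (ξ : X.HomSpace S i.1), f (X.incl S I i ξ) = g (X.incl S I i ξ)) : f = g := by
  refine ContinuousLinearMap.ext fun ξ => ?_
  have h1 := f.hasSum (hasSum_incl ξ)
  have h2 := g.hasSum (hasSum_incl ξ)
  refine h1.unique ?_
  simpa only [Function.comp_def, h] using h2

variable (S I X) in
/-- The projection of the direct sum onto a summand. -/
def proj (i : I) : X.Total S I →L[ℂ] X.HomSpace S i.1 :=
  (X.incl S I i).toContinuousLinearMap.adjoint

theorem inner_proj (i : I) (ξ : X.HomSpace S i.1) (η : X.Total S I) :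
    inner ℂ ξ (proj S I X i η) = inner ℂ (X.incl S I i ξ) η :=
  ContinuousLinearMap.adjoint_inner_right _ _ _

theorem inner_proj_left (i : I) (ξ : X.HomSpace S i.1) (η : X.Total S I) :
    inner ℂ (proj S I X i η) ξ = inner ℂ η (X.incl S I i ξ) :=
  ContinuousLinearMap.adjoint_inner_left _ _ _

theorem proj_incl (i : I) (ξ : X.HomSpace S i.1) : proj S I X i (X.incl S I i ξ) = ξ :=
  ext_inner_left ℂ fun η => by rw [inner_proj, LinearIsometry.inner_map_map]

theorem proj_incl_of_ne {i j : I} (h : i ≠ j) (ξ : X.HomSpace S i.1) :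
    proj S I X j (X.incl S I i ξ) = 0 :=
  ext_inner_left ℂ fun η => by rw [inner_proj, inner_incl_of_ne h.symm, inner_zero_right]

end IndObj

namespace AnnularAction
variable {S : StandardSolutions C} {I : Set C} {X : IndObj.{w} C} (A : AnnularAction S X)

/-- The action of a homogeneous element on the direct sum. -/
def homogeneous (i j : I) (α : C) : (α ⊗ j.1 ⟶ i.1 ⊗ α) →ₗ[ℂ] (X.Total S I →L[ℂ] X.Total S I) where
  toFun V := (X.incl S I j).toContinuousLinearMap ∘L A.act V ∘L IndObj.proj S I X i
  map_add' V W := ContinuousLinearMap.ext fun ξ => by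
    change X.incl S I j (A.act (V + W) _) = X.incl S I j (A.act V _) + X.incl S I j (A.act W _)
    rw [A.act_add, map_add]
  map_smul' c V := ContinuousLinearMap.ext fun ξ => by
    change X.incl S I j (A.act (c • V) _) = c • X.incl S I j (A.act V _)
    rw [A.act_smul, map_smul]

theorem homogeneous_apply (i j : I) {α : C} (V : α ⊗ j.1 ⟶ i.1 ⊗ α) (ξ : X.Total S I) :
    A.homogeneous i j α V ξ = X.incl S I j (A.act V (IndObj.proj S I X i ξ)) := rfl

/-- The action of the tube algebra on the direct sum. -/
def totalAct : TubeAlgebra S I →ₗ[ℂ] (X.Total S I →L[ℂ] X.Total S I) :=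
  DirectSum.toModule ℂ (I × I × I) _ fun t => A.homogeneous t.1 t.2.1 t.2.2.1

theorem totalAct_of (i j α : I) (V : α.1 ⊗ j.1 ⟶ i.1 ⊗ α.1) :
    A.totalAct (of S i j α V) = A.homogeneous i j α.1 V :=
  DirectSum.toModule_lof (R := ℂ) (ι := I × I × I)
    (M := fun t => (t.2.2.1 ⊗ t.2.1.1 ⟶ t.1.1 ⊗ t.2.2.1))
    (φ := fun t => A.homogeneous t.1 t.2.1 t.2.2.1) (i, j, α) V

theorem sum_act_conj {a b β : C} {J : Type*} [Fintype J] {Y : J → C} {u : ∀ k, Y k ⟶ β}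
    (h : ∑ k, (u k)† ≫ u k = 𝟙 β) (V : β ⊗ b ⟶ a ⊗ β) (ξ : X.HomSpace S a) :
    ∑ k, A.act (u k ▷ b ≫ V ≫ a ◁ (u k)†) ξ = A.act V ξ := by
  let f : (β ⊗ b ⟶ a ⊗ β) →ₗ[ℂ] X.HomSpace S b :=
    { toFun := fun V => A.act V ξ
      map_add' := fun V W => A.act_add V W ξ
      map_smul' := fun c V => A.act_smul c V ξ }
  have h1 : ∀ k, A.act (u k ▷ b ≫ V ≫ a ◁ (u k)†) ξ = f (V ≫ a ◁ ((u k)† ≫ u k)) := fun k => by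
    rw [A.slide, Category.assoc, ← MonoidalCategory.whiskerLeft_comp]
    rfl
  simp only [h1]
  rw [← map_sum, ← Preadditive.comp_sum, ← whiskerLeft_sum, h, MonoidalCategory.whiskerLeft_id,
    Category.comp_id]
  rfl

theorem totalAct_ofObj (hI : IsIrr I) (i j : I) (β : C) (V : β ⊗ j.1 ⟶ i.1 ⊗ β) :
    A.totalAct (ofObj S i j β V) = A.homogeneous i j β V := by
  obtain ⟨K, _, Y, u, hu, h⟩ := exists_resolution S hI β
  rw [h, map_sum]
  refine ContinuousLinearMap.ext fun ξ => ?_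
  rw [sum_apply]
  simp only [totalAct_of, homogeneous_apply]
  rw [← map_sum, A.sum_act_conj hu.2]

/-- The module of an annular action. -/
def toModule (hI : IsIrr I) : RightHilbertModule S I (X.Total S I) where
  act := A.totalAct
  act_mul a b ξ := by
    rw [mul_def]
    conv_rhs => rw [sum_of a, sum_of b]
    simp only [map_sum, sum_apply]
    refine Finset.sum_congr rfl fun p _ => Finset.sum_congr rfl fun q _ => ?_
    rw [totalAct_of, totalAct_of, homogeneous_apply, homogeneous_apply]
    by_cases h : q.1 = p.2.1
    · obtain ⟨p1, p2, p3⟩ := p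
      obtain ⟨q1, q2, q3⟩ := q
      simp only at h
      subst h
      rw [if_pos rfl, A.totalAct_ofObj hI, IndObj.proj_incl, A.act_act, homogeneous_apply]
    · rw [if_neg h, IndObj.proj_incl_of_ne (Ne.symm h), map_zero, map_zero, map_zero]
      rfl
  act_sharp a ξ η := by
    rw [sharp]
    conv_rhs => rw [sum_of a]
    simp only [map_sum, sum_apply, sum_inner, inner_sum]
    refine Finset.sum_congr rfl fun p _ => ?_
    rw [A.totalAct_ofObj hI, totalAct_of, homogeneous_apply, homogeneous_apply,
      ← IndObj.inner_proj_left, A.inner_act, IndObj.inner_proj]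

theorem toModule_act_ofObj (hI : IsIrr I) (i j : I) {β : C} (V : β ⊗ j.1 ⟶ i.1 ⊗ β)
    (ξ : X.HomSpace S i.1) :
    (A.toModule hI).act (ofObj S i j β V) (X.incl S I i ξ) = X.incl S I j (A.act V ξ) := by
  change A.totalAct _ _ = _
  rw [A.totalAct_ofObj hI, homogeneous_apply, IndObj.proj_incl]

theorem toModule_act_proj (hI : IsIrr I) (i : I) (ξ : X.Total S I) :
    (A.toModule hI).act (proj S i) ξ = X.incl S I i (IndObj.proj S I X i ξ) := by
  change A.totalAct _ _ = _
  rw [TubeAlgebra.proj, A.totalAct_ofObj hI, homogeneous_apply, A.act_unit]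

theorem toModule_isRealizedBy (hI : IsIrr I) : (A.toModule hI).IsRealizedBy (X.incl S I) := by
  intro i
  ext x
  constructor
  · rintro ⟨ξ, rfl⟩
    exact ⟨X.incl S I i ξ, by rw [toModule_act_proj, IndObj.proj_incl]⟩
  · rintro ⟨ξ, rfl⟩
    exact ⟨IndObj.proj S I X i ξ, (A.toModule_act_proj hI i ξ).symm⟩

theorem toModule_nondegenerate (hI : IsIrr I) : (A.toModule hI).Nondegenerate := by
  intro ξ
  refine mem_closure_of_tendsto (IndObj.hasSum_incl ξ) (Filter.Eventually.of_forall fun s => ?_)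
  refine Submodule.sum_mem _ fun i _ => Submodule.subset_span ?_
  exact ⟨proj S i, X.incl S I i (ξ i), by rw [toModule_act_proj, IndObj.proj_incl]⟩

end AnnularAction

namespace UnitaryHalfBraiding
variable {S : StandardSolutions C} {I : Set C} {X : IndObj.{w} C} (σ : UnitaryHalfBraiding X)

variable (S) in
/-- The annular action of a unitary half braiding. -/
def toAction : AnnularAction S X := (σ.toRotation S).toAction

theorem rotate_eq {i j α : C} (ξ : X.HomSpace S i) (V : α ⊗ j ⟶ i ⊗ α) (k : X.ι) :
    σ.rotate ξ V k = ((σ.rotationOp S α).op _ (pre S _ V (whiskR S X α i ξ))).component k := by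
  refine Eq.trans ?_ ((σ.rotationOp S α).hasSum_op (pre S _ V (whiskR S X α i ξ)) k).tsum_eq
  refine tsum_congr fun l => ?_
  refine (Category.assoc _ _ _).symm.trans ?_
  exact congrArg ((V ≫ ξ.component l ▷ α) ≫ ·) (σ.mat_rotationOp α k l).symm

theorem toAction_act_component {i j α : C} (V : α ⊗ j ⟶ i ⊗ α) (ξ : X.HomSpace S i) (k : X.ι) :
    ((σ.toAction S).act V ξ).component k = S.partialTrace α (σ.rotate ξ V k) := by
  rw [rotate_eq]
  rfl

theorem induces_iff (M : RightHilbertModule S I (X.Total S I)) :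
    σ.Induces M ↔ ∀ (i j α : I) (ξ : X.HomSpace S i.1) (V : α.1 ⊗ j.1 ⟶ i.1 ⊗ α.1),
      M.act (of S i j α V) (X.incl S I i ξ) = X.incl S I j ((σ.toAction S).act V ξ) := by
  refine forall_congr' fun i => forall_congr' fun j => forall_congr' fun α => forall_congr' fun ξ =>
    forall_congr' fun V => ⟨?_, fun h => ⟨_, fun k => σ.toAction_act_component V ξ k, h⟩⟩
  rintro ⟨ζ, h1, h2⟩
  rw [h2]
  congr 1
  exact ext' fun k => (h1 k).trans (σ.toAction_act_component V ξ k).symm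

theorem Induces.act_ofObj {M : RightHilbertModule S I (X.Total S I)} {σ : UnitaryHalfBraiding X} (h : σ.Induces M)
    (hI : IsIrr I) (i j : I) {β : C} (V : β ⊗ j.1 ⟶ i.1 ⊗ β) (ξ : X.HomSpace S i.1) :
    M.act (ofObj S i j β V) (X.incl S I i ξ) = X.incl S I j ((σ.toAction S).act V ξ) := by
  obtain ⟨K, _, Y, u, hu, hr⟩ := exists_resolution S hI β
  rw [hr, map_sum, sum_apply]
  simp only [(σ.induces_iff M).1 h]
  rw [← map_sum, AnnularAction.sum_act_conj _ hu.2]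

theorem Induces.act_proj {M : RightHilbertModule S I (X.Total S I)} {σ : UnitaryHalfBraiding X} (h : σ.Induces M)
    (hI : IsIrr I) (i : I) (ξ : X.HomSpace S i.1) :
    M.act (proj S i) (X.incl S I i ξ) = X.incl S I i ξ := by
  rw [TubeAlgebra.proj, h.act_ofObj hI, AnnularAction.act_unit]

/-- `Induces` prescribes V ∈ (iα, αj) only on the summand (X, i). On the others the module axioms
force zero, since (X, i') is fixed by p_{i'} and p_{i'} · V = 0. This is what makes the module
structure unique. -/
theorem Induces.act_of_of_ne {M : RightHilbertModule S I (X.Total S I)} {σ : UnitaryHalfBraiding X} (h : σ.Induces M)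
    (hI : IsIrr I) {i i' j α : I} (hi : i' ≠ i) (V : α.1 ⊗ j.1 ⟶ i.1 ⊗ α.1)
    (ξ : X.HomSpace S i'.1) : M.act (of S i j α V) (X.incl S I i' ξ) = 0 := by
  rw [← h.act_proj hI, ← ofObj_of hI, M.act_ofObj_act_proj_of_ne hI hi]

theorem induces_toModule (hI : IsIrr I) : σ.Induces ((σ.toAction S).toModule hI) :=
  (σ.induces_iff _).2 fun i j α ξ V => by
    rw [← ofObj_of hI, AnnularAction.toModule_act_ofObj]

theorem Induces.unique {σ : UnitaryHalfBraiding X} {M N : RightHilbertModule S I (X.Total S I)} (hI : IsIrr I)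
    (hM : σ.Induces M) (hN : σ.Induces N) : M = N := by
  have : M.act = N.act := RightHilbertModule.act_induction fun i j α V =>
    IndObj.total_ext fun i' ξ => by
      by_cases hi : i' = i
      · subst hi
        rw [(σ.induces_iff M).1 hM, (σ.induces_iff N).1 hN]
      · rw [hM.act_of_of_ne hI hi, hN.act_of_of_ne hI hi]
  cases M; cases N
  simp only at this
  subst this
  rfl

/-- The trace of `∑ ξ_k η_k†` is the scalar product. -/
theorem tr_tsum {γ : C} (ξ η : X.HomSpace S γ) :
    S.tr γ (∑' k, ξ.component k ≫ (η.component k)†) = inner ℂ η ξ := by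
  let e := stdOrthonormalBasis ℂ (HilbHom S γ γ)
  -- The morphism space is finite dimensional, so summability is checked on coefficients in an
  -- orthonormal basis; each is a term of a scalar product of two square summable families.
  have h1 : Summable fun k => ξ.component k ≫ (η.component k)† := by
    have h2 : ∀ m, Summable fun k =>
        (inner ℂ (e m) (toHilb S (ξ.component k ≫ (η.component k)†)) : ℂ) • (e m).hom := fun m => by
      refine Summable.smul_const ?_ _
      refine (hasSum_inner η (pre S X ((e m).hom†) ξ)).summable.congr fun k => ?_
      change S.tr γ (((e m).hom† ≫ ξ.component k) ≫ (η.component k)†) =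
        S.tr γ ((ξ.component k ≫ (η.component k)†) ≫ (e m).hom†)
      rw [Category.assoc, S.tr_comm]
    refine (summable_sum fun m (_ : m ∈ Finset.univ) => h2 m).congr fun k => ?_
    exact e.sum_repr' (toHilb S (ξ.component k ≫ (η.component k)†))
  have h3 := h1.hasSum.map (S.trₗ γ) (LinearMap.continuous_of_finiteDimensional (S.trₗ γ))
  exact h3.unique (hasSum_inner η ξ)

/-- The trace over α ⊗ j is the scalar product with 1 ⊗ η, and the adjoint of η ↦ 1 ⊗ η is the
partial trace. Hence the formulas of parts 1 and 2 express the same condition. -/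
theorem coefficient_eq {i j α : C} (ξ : X.HomSpace S i) (η : X.HomSpace S j)
    (V : α ⊗ j ⟶ i ⊗ α) : σ.coefficient ξ η V = inner ℂ η ((σ.toAction S).act V ξ) := by
  refine Eq.trans ?_ (inner_whiskL_left α η _)
  refine Eq.trans ?_ (tr_tsum (X := X.tensorLeft α) _ _)
  refine congrArg (S.tr (α ⊗ j)) (tsum_congr fun k => congrArg₂ (· ≫ ·) (σ.rotate_eq ξ V k) ?_)
  exact (dagger_whiskerLeft α (η.component k)).symm

theorem Induces.determines {M : RightHilbertModule S I (X.Total S I)} {σ : UnitaryHalfBraiding X}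
    (h : σ.Induces M) :
    M.Determines (X.incl S I) σ := fun i j α ξ η V => by
  rw [coefficient_eq, (σ.induces_iff M).1 h, LinearIsometry.inner_map_map]

end UnitaryHalfBraiding

end

/-! ### Extension of an action from representatives to all objects. -/

section

open IndObj.HomSpace StandardSolutions TubeAlgebra

/-- A decomposition of an object into objects of `I`. -/
structure Resolution (I : Set C) (a : C) where
  K : Type u
  fintype : Fintype K
  Y : K → I
  u : ∀ k, (Y k).1 ⟶ a
  isDirectSum : IsDirectSum u

attribute [instance] Resolution.fintype

theorem IsIrr.nonempty_resolution {I : Set C} (hI : IsIrr I) (S : StandardSolutions C) (a : C) :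
    Nonempty (Resolution I a) := by
  obtain ⟨K, h, Y, u, hu, -⟩ := exists_resolution S hI a
  exact ⟨⟨K, h, Y, u, hu⟩⟩

namespace Resolution
variable {S : StandardSolutions C} {I : Set C} {X : IndObj.{w} C} {a : C} (r : Resolution I a)

theorem sum_pre (ξ : X.HomSpace S a) : ∑ k, pre S X ((r.u k)†) (pre S X (r.u k) ξ) = ξ := by
  let f : (a ⟶ a) →ₗ[ℂ] X.HomSpace S a :=
    { toFun := fun g => pre S X g ξ
      map_add' := fun g h => pre_add_hom g h ξ
      map_smul' := fun c g => pre_smul_hom c g ξ }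
  have h : ∀ k, pre S X ((r.u k)†) (pre S X (r.u k) ξ) = f ((r.u k)† ≫ r.u k) := fun k =>
    pre_pre _ _ _
  simp only [h]
  rw [← map_sum, r.isDirectSum.2]
  exact pre_id ξ

theorem pre_sum_pre (ξ : ∀ k, X.HomSpace S (r.Y k).1) (l : r.K) :
    pre S X (r.u l) (∑ k, pre S X ((r.u k)†) (ξ k)) = ξ l := by
  rw [map_sum, Finset.sum_eq_single l]
  · rw [pre_pre, r.isDirectSum.1.1 l (Finset.mem_univ l), pre_id]
  · intro k _ hk
    rw [pre_pre, r.isDirectSum.1.2 l (Finset.mem_univ l) k (Finset.mem_univ k) hk.symm]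
    have := pre_smul_hom (S := S) (0 : ℂ) (0 : (r.Y l).1 ⟶ (r.Y k).1) (ξ k)
    simpa using this
  · exact fun h => absurd (Finset.mem_univ l) h

theorem norm_sq (ξ : ∀ k, X.HomSpace S (r.Y k).1) :
    ‖∑ k, pre S X ((r.u k)†) (ξ k)‖ ^ 2 = ∑ k, ‖ξ k‖ ^ 2 := by
  have h : (inner ℂ (∑ k, pre S X ((r.u k)†) (ξ k)) (∑ k, pre S X ((r.u k)†) (ξ k)) : ℂ) =
      ∑ k, inner ℂ (ξ k) (ξ k) := by
    rw [sum_inner]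
    refine Finset.sum_congr rfl fun k _ => ?_
    rw [inner_pre_left, dagger_dagger, pre_sum_pre]
  have h2 := congrArg RCLike.re h
  rw [inner_self_eq_norm_sq, map_sum] at h2
  simpa only [inner_self_eq_norm_sq] using h2

end Resolution

namespace TubeAlgebra

theorem mulHom_whiskerLeft_comp {a b b' c α β : C} (V : α ⊗ b ⟶ a ⊗ α) (u : b' ⟶ b)
    (W : β ⊗ c ⟶ b' ⊗ β) : mulHom (α ◁ u ≫ V) W = mulHom V (W ≫ u ▷ β) := by
  rw [mulHom, mulHom]; monoidal

theorem mulHom_comp_whiskerRight {a a' b c α β : C} (V : α ⊗ b ⟶ a ⊗ α) (f : a ⟶ a')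
    (W : β ⊗ c ⟶ b ⊗ β) : mulHom (V ≫ f ▷ α) W = mulHom V W ≫ f ▷ (α ⊗ β) := by
  rw [mulHom, mulHom]; monoidal

theorem mulHom_whiskerLeft_comp_right {a b c c' α β : C} (V : α ⊗ b ⟶ a ⊗ α) (g : c' ⟶ c)
    (W : β ⊗ c ⟶ b ⊗ β) : mulHom V (β ◁ g ≫ W) = (α ⊗ β) ◁ g ≫ mulHom V W := by
  rw [mulHom, mulHom]; monoidal

theorem sharpHom_whisker (S : StandardSolutions C) {a a' b b' α : C} (V : α ⊗ b ⟶ a ⊗ α)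
    (f : a ⟶ a') (g : b' ⟶ b) :
    sharpHom S (α ◁ g ≫ V ≫ f ▷ α) = (S α).bar ◁ f† ≫ sharpHom S V ≫ g† ▷ (S α).bar := by
  rw [sharpHom, sharpHom]
  simp only [dagger_comp, dagger_whiskerLeft, dagger_whiskerRight]
  calc _ = 𝟙 _ ⊗≫ (S α).bar ◁ (a' ◁ (S α).s ≫ f† ▷ (α ⊗ (S α).bar)) ⊗≫
        (S α).bar ◁ V† ▷ (S α).bar ⊗≫ (((S α).bar ⊗ α) ◁ g† ≫ (S α).t† ▷ b') ▷ (S α).bar ⊗≫ 𝟙 _ := by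
        monoidal
    _ = _ := by
        rw [whisker_exchange, whisker_exchange]
        monoidal

theorem mulHom_sum {a b c α β : C} {J : Type*} (s : Finset J) (V : α ⊗ b ⟶ a ⊗ α)
    (W : J → (β ⊗ c ⟶ b ⊗ β)) : ∑ k ∈ s, mulHom V (W k) = mulHom V (∑ k ∈ s, W k) := by
  simp only [mulHom, whiskerLeft_sum, Preadditive.sum_comp, Preadditive.comp_sum]

end TubeAlgebra

/-- An action by operators between the spaces `(X, i)`, `i ∈ I`. -/
structure IrrAction (S : StandardSolutions C) (I : Set C) (X : IndObj.{w} C) where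
  act : ∀ {i j : I} {α : C}, (α ⊗ j.1 ⟶ i.1 ⊗ α) → (X.HomSpace S i.1 →L[ℂ] X.HomSpace S j.1)
  act_add : ∀ {i j : I} {α : C} (V W : α ⊗ j.1 ⟶ i.1 ⊗ α) (ξ : X.HomSpace S i.1),
    act (V + W) ξ = act V ξ + act W ξ
  act_smul : ∀ {i j : I} {α : C} (c : ℂ) (V : α ⊗ j.1 ⟶ i.1 ⊗ α) (ξ : X.HomSpace S i.1),
    act (c • V) ξ = c • act V ξ
  slide : ∀ {i j : I} {α β : C} (u : α ⟶ β) (V : β ⊗ j.1 ⟶ i.1 ⊗ α) (ξ : X.HomSpace S i.1),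
    act (u ▷ j.1 ≫ V) ξ = act (V ≫ i.1 ◁ u) ξ
  act_act : ∀ {i k j : I} {α β : C} (V : α ⊗ k.1 ⟶ i.1 ⊗ α) (W : β ⊗ j.1 ⟶ k.1 ⊗ β)
    (ξ : X.HomSpace S i.1), act W (act V ξ) = act (mulHom V W) ξ
  act_unit : ∀ {i : I} (ξ : X.HomSpace S i.1), act ((λ_ i.1).hom ≫ (ρ_ i.1).inv) ξ = ξ
  inner_act : ∀ {i j : I} {α : C} (V : α ⊗ j.1 ⟶ i.1 ⊗ α) (ξ : X.HomSpace S i.1)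
    (η : X.HomSpace S j.1), inner ℂ η (act V ξ) = inner ℂ (act (sharpHom S V) η) ξ

namespace IrrAction
variable {S : StandardSolutions C} {I : Set C} {X : IndObj.{w} C} (A : IrrAction S I X)

/-- `V ↦ act V ξ`, as a linear map. -/
def actₗ {i j : I} {α : C} (ξ : X.HomSpace S i.1) :
    (α ⊗ j.1 ⟶ i.1 ⊗ α) →ₗ[ℂ] X.HomSpace S j.1 where
  toFun V := A.act V ξ
  map_add' V W := A.act_add V W ξ
  map_smul' c V := A.act_smul c V ξ

/-- A nonzero morphism between members of I is a scalar on a single object, so compatibility with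
outer morphisms reduces to linearity and need not be an axiom of `IrrAction`. -/
theorem act_pre (hI : IsIrr I) {i i' j : I} {α : C} (f : i.1 ⟶ i'.1) (V : α ⊗ j.1 ⟶ i.1 ⊗ α)
    (ξ : X.HomSpace S i'.1) : A.act V (pre S X f ξ) = A.act (V ≫ f ▷ α) ξ := by
  by_cases hf : f = 0
  · subst hf
    have h1 : pre S X (0 : i.1 ⟶ i'.1) ξ = 0 := by
      simpa using pre_smul_hom (S := S) (0 : ℂ) (0 : i.1 ⟶ i'.1) ξ
    have h2 : A.act (V ≫ (0 : i.1 ⟶ i'.1) ▷ α) ξ = 0 := by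
      rw [MonoidalPreadditive.zero_whiskerRight, Limits.comp_zero]
      exact map_zero (A.actₗ ξ)
    rw [h1, h2, map_zero]
  · obtain rfl := hI.eq_of_hom hf
    obtain ⟨c, rfl, -⟩ := hI.1 _ i.2 f
    rw [pre_smul_hom, pre_id, MonoidalLinear.smul_whiskerRight, id_whiskerRight, Linear.comp_smul,
      Category.comp_id, A.act_smul, map_smul]

theorem pre_act (hI : IsIrr I) {i j j' : I} {α : C} (g : j'.1 ⟶ j.1) (V : α ⊗ j.1 ⟶ i.1 ⊗ α)
    (ξ : X.HomSpace S i.1) : pre S X g (A.act V ξ) = A.act (α ◁ g ≫ V) ξ := by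
  by_cases hg : g = 0
  · subst hg
    have h1 : pre S X (0 : j'.1 ⟶ j.1) (A.act V ξ) = 0 := by
      simpa using pre_smul_hom (S := S) (0 : ℂ) (0 : j'.1 ⟶ j.1) (A.act V ξ)
    have h2 : A.act (α ◁ (0 : j'.1 ⟶ j.1) ≫ V) ξ = 0 := by
      rw [MonoidalPreadditive.whiskerLeft_zero, Limits.zero_comp]
      exact map_zero (A.actₗ ξ)
    rw [h1, h2]
  · obtain rfl := hI.eq_of_hom hg
    obtain ⟨c, rfl, -⟩ := hI.1 _ j'.2 g
    rw [pre_smul_hom, pre_id, MonoidalLinear.whiskerLeft_smul, MonoidalCategory.whiskerLeft_id,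
      Linear.smul_comp, Category.id_comp, A.act_smul]

/-- The extension of the action to sources decomposed into objects of `I`. -/
def half {a : C} (r : Resolution I a) {j : I} {α : C} (V : α ⊗ j.1 ⟶ a ⊗ α) :
    X.HomSpace S a →L[ℂ] X.HomSpace S j.1 :=
  ∑ k, A.act (V ≫ (r.u k)† ▷ α) ∘L pre S X (r.u k)

theorem half_apply {a : C} (r : Resolution I a) {j : I} {α : C} (V : α ⊗ j.1 ⟶ a ⊗ α)
    (ξ : X.HomSpace S a) :
    A.half r V ξ = ∑ k, A.act (V ≫ (r.u k)† ▷ α) (pre S X (r.u k) ξ) := by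
  rw [half, sum_apply]
  rfl

theorem half_add {a : C} (r : Resolution I a) {j : I} {α : C} (V W : α ⊗ j.1 ⟶ a ⊗ α)
    (ξ : X.HomSpace S a) : A.half r (V + W) ξ = A.half r V ξ + A.half r W ξ := by
  simp only [half_apply, Preadditive.add_comp, A.act_add, Finset.sum_add_distrib]

theorem half_smul {a : C} (r : Resolution I a) {j : I} {α : C} (c : ℂ) (V : α ⊗ j.1 ⟶ a ⊗ α)
    (ξ : X.HomSpace S a) : A.half r (c • V) ξ = c • A.half r V ξ := by
  simp only [half_apply, Linear.smul_comp, A.act_smul, Finset.smul_sum]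

/-- `V ↦ half r V ξ`, as a linear map. -/
def halfₗ {a : C} (r : Resolution I a) {j : I} {α : C} (ξ : X.HomSpace S a) :
    (α ⊗ j.1 ⟶ a ⊗ α) →ₗ[ℂ] X.HomSpace S j.1 where
  toFun V := A.half r V ξ
  map_add' V W := A.half_add r V W ξ
  map_smul' c V := A.half_smul r c V ξ

/-- Decomposing ξ along r' leaves only morphisms between members of I to be moved, after which the
sum over r is an identity. Besides naturality this contains independence of the chosen
decomposition, as the case where f is the identity. -/
theorem half_pre (hI : IsIrr I) {a a' : C} (r : Resolution I a) (r' : Resolution I a') {j : I}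
    {α : C} (f : a ⟶ a') (V : α ⊗ j.1 ⟶ a ⊗ α) (ξ : X.HomSpace S a') :
    A.half r V (pre S X f ξ) = A.half r' (V ≫ f ▷ α) ξ := by
  rw [half_apply, half_apply]
  have h1 : ∀ k, A.act (V ≫ (r.u k)† ▷ α) (pre S X (r.u k) (pre S X f ξ)) =
      ∑ k', A.actₗ (pre S X (r'.u k') ξ) (V ≫ ((r.u k)† ≫ r.u k) ▷ α ≫ (f ≫ (r'.u k')†) ▷ α) :=
    fun k => by
    conv_lhs => rw [← r'.sum_pre ξ]
    simp only [map_sum]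
    refine Finset.sum_congr rfl fun k' _ => ?_
    rw [pre_pre, pre_pre, A.act_pre hI]
    refine congrArg (A.actₗ (pre S X (r'.u k') ξ)) ?_
    simp
  simp only [h1]
  rw [Finset.sum_comm]
  refine Finset.sum_congr rfl fun k' _ => ?_
  rw [← map_sum, ← Preadditive.comp_sum, ← Preadditive.sum_comp, ← sum_whiskerRight,
    r.isDirectSum.2, id_whiskerRight, Category.id_comp, comp_whiskerRight, ← Category.assoc]
  rfl

theorem pre_half (hI : IsIrr I) {a : C} (r : Resolution I a) {j j' : I}
    {α : C} (g : j'.1 ⟶ j.1) (V : α ⊗ j.1 ⟶ a ⊗ α) (ξ : X.HomSpace S a) :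
    pre S X g (A.half r V ξ) = A.half r (α ◁ g ≫ V) ξ := by
  rw [half_apply, half_apply, map_sum]
  refine Finset.sum_congr rfl fun k _ => ?_
  rw [A.pre_act hI, Category.assoc]

theorem half_slide {a : C} (r : Resolution I a) {j : I} {α β : C} (u : α ⟶ β)
    (V : β ⊗ j.1 ⟶ a ⊗ α) (ξ : X.HomSpace S a) :
    A.half r (u ▷ j.1 ≫ V) ξ = A.half r (V ≫ a ◁ u) ξ := by
  rw [half_apply, half_apply]
  refine Finset.sum_congr rfl fun k _ => ?_
  rw [Category.assoc, A.slide, Category.assoc, Category.assoc, whisker_exchange]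

theorem act_half {a : C} (r : Resolution I a) {k j : I} {α β : C} (V : α ⊗ k.1 ⟶ a ⊗ α)
    (W : β ⊗ j.1 ⟶ k.1 ⊗ β) (ξ : X.HomSpace S a) :
    A.act W (A.half r V ξ) = A.half r (mulHom V W) ξ := by
  rw [half_apply, half_apply, map_sum]
  refine Finset.sum_congr rfl fun k _ => ?_
  rw [A.act_act, mulHom_comp_whiskerRight]

theorem half_eq (hI : IsIrr I) {i j : I} (r : Resolution I i.1) {α : C} (V : α ⊗ j.1 ⟶ i.1 ⊗ α)
    (ξ : X.HomSpace S i.1) : A.half r V ξ = A.act V ξ := by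
  rw [half_apply]
  have h1 : ∀ k, A.act (V ≫ (r.u k)† ▷ α) (pre S X (r.u k) ξ) =
      A.actₗ ξ (V ≫ ((r.u k)† ≫ r.u k) ▷ α) := fun k => by
    rw [A.act_pre hI, Category.assoc, comp_whiskerRight]
    rfl
  simp only [h1]
  rw [← map_sum, ← Preadditive.comp_sum, ← sum_whiskerRight, r.isDirectSum.2, id_whiskerRight,
    Category.comp_id]
  rfl

/-- The extension of the action to decomposed sources and targets. -/
def full {a b : C} (r : Resolution I a) (q : Resolution I b) {α : C} (V : α ⊗ b ⟶ a ⊗ α) :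
    X.HomSpace S a →L[ℂ] X.HomSpace S b :=
  ∑ l, pre S X ((q.u l)†) ∘L A.half r (α ◁ q.u l ≫ V)

theorem full_apply {a b : C} (r : Resolution I a) (q : Resolution I b) {α : C}
    (V : α ⊗ b ⟶ a ⊗ α) (ξ : X.HomSpace S a) :
    A.full r q V ξ = ∑ l, pre S X ((q.u l)†) (A.half r (α ◁ q.u l ≫ V) ξ) := by
  rw [full, sum_apply]
  rfl

theorem pre_full (hI : IsIrr I) {a b b' : C} (r : Resolution I a) (q : Resolution I b)
    (q' : Resolution I b') {α : C} (g : b' ⟶ b) (V : α ⊗ b ⟶ a ⊗ α) (ξ : X.HomSpace S a) :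
    pre S X g (A.full r q V ξ) = A.full r q' (α ◁ g ≫ V) ξ := by
  rw [← q'.sum_pre (pre S X g (A.full r q V ξ)), full_apply, full_apply]
  refine Finset.sum_congr rfl fun l' _ => congrArg _ ?_
  have h1 : ∀ l, pre S X (q'.u l') (pre S X g (pre S X ((q.u l)†) (A.half r (α ◁ q.u l ≫ V) ξ))) =
      A.halfₗ r ξ ((α ◁ q'.u l' ≫ α ◁ g) ≫ α ◁ ((q.u l)† ≫ q.u l) ≫ V) := fun l => by
    rw [pre_pre, pre_pre, A.pre_half hI]
    refine congrArg (A.halfₗ r ξ) ?_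
    simp
  simp only [map_sum, h1]
  rw [← map_sum, ← Preadditive.comp_sum, ← Preadditive.sum_comp, ← whiskerLeft_sum,
    q.isDirectSum.2, MonoidalCategory.whiskerLeft_id, Category.id_comp, Category.assoc]
  rfl

theorem full_full {a b c : C} (r : Resolution I a) (q : Resolution I b)
    (p : Resolution I c) {α β : C} (V : α ⊗ b ⟶ a ⊗ α) (W : β ⊗ c ⟶ b ⊗ β)
    (ξ : X.HomSpace S a) :
    A.full q p W (A.full r q V ξ) = A.full r p (mulHom V W) ξ := by
  rw [full_apply, full_apply _ r p]
  refine Finset.sum_congr rfl fun m _ => congrArg _ ?_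
  rw [half_apply]
  have h1 : ∀ l, A.act ((β ◁ p.u m ≫ W) ≫ (q.u l)† ▷ β) (pre S X (q.u l) (A.full r q V ξ)) =
      A.halfₗ r ξ (mulHom V ((β ◁ p.u m ≫ W) ≫ ((q.u l)† ≫ q.u l) ▷ β)) := fun l => by
    rw [full_apply, q.pre_sum_pre, act_half, mulHom_whiskerLeft_comp, Category.assoc,
      ← comp_whiskerRight]
    rfl
  simp only [h1]
  rw [← map_sum, mulHom_sum, ← Preadditive.comp_sum, ← sum_whiskerRight, q.isDirectSum.2,
    id_whiskerRight, Category.comp_id, mulHom_whiskerLeft_comp_right]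
  rfl

theorem full_unit (hI : IsIrr I) {a : C} (r : Resolution I a) (q : ∀ k, Resolution I (r.Y k).1)
    (ξ : X.HomSpace S a) : A.full r r ((λ_ a).hom ≫ (ρ_ a).inv) ξ = ξ := by
  rw [full_apply]
  conv_rhs => rw [← r.sum_pre ξ]
  refine Finset.sum_congr rfl fun l _ => congrArg _ ?_
  have h : 𝟙_ C ◁ r.u l ≫ (λ_ a).hom ≫ (ρ_ a).inv =
      ((λ_ (r.Y l).1).hom ≫ (ρ_ (r.Y l).1).inv) ≫ r.u l ▷ 𝟙_ C := by
    rw [← Category.assoc, leftUnitor_naturality]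
    simp
  rw [h, ← A.half_pre hI (q l) r, A.half_eq hI, A.act_unit]

theorem inner_full {a b : C} (r : Resolution I a) (q : Resolution I b) {α : C}
    (V : α ⊗ b ⟶ a ⊗ α) (ξ : X.HomSpace S a) (η : X.HomSpace S b) :
    inner ℂ η (A.full r q V ξ) = inner ℂ (A.full q r (sharpHom S V) η) ξ := by
  simp only [full_apply, half_apply, map_sum, inner_sum, sum_inner]
  rw [Finset.sum_comm]
  refine Finset.sum_congr rfl fun k _ => Finset.sum_congr rfl fun l _ => ?_
  have h : ∀ {a b : C} (f : a ⟶ b) (x : X.HomSpace S a) (y : X.HomSpace S b),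
      inner ℂ y (pre S X f† x) = inner ℂ (pre S X f y) x := fun f x y => by
    rw [inner_pre_right, dagger_dagger]
  rw [h, A.inner_act, ← inner_pre_right, Category.assoc, Category.assoc, sharpHom_whisker,
    dagger_dagger]

/-- The extension of an action of the objects of `I` to all objects. -/
theorem exists_extension (hI : IsIrr I) : ∃ B : AnnularAction S X,
    ∀ {i j : I} {α : C} (V : α ⊗ j.1 ⟶ i.1 ⊗ α), B.act V = A.act V := by
  have r : ∀ a, Resolution I a := fun a => Classical.choice (hI.nonempty_resolution S a)
  refine ⟨⟨fun {a b α} V => A.full (r a) (r b) V, fun V W ξ => ?_, fun c V ξ => ?_,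
    fun f V ξ => ?_, fun g V ξ => A.pre_full hI _ _ _ g V ξ, fun u V ξ => ?_,
    fun V W ξ => A.full_full _ _ _ V W ξ, fun ξ => A.full_unit hI _ (fun _ => r _) ξ,
    fun V ξ η => A.inner_full _ _ V ξ η⟩, fun {i j α} V => ContinuousLinearMap.ext fun ξ => ?_⟩
  · simp only [full_apply, Preadditive.comp_add, half_add, map_add, Finset.sum_add_distrib]
  · simp only [full_apply, Linear.comp_smul, half_smul, map_smul, Finset.smul_sum]
  · simp only [full_apply]
    refine Finset.sum_congr rfl fun l _ => ?_
    rw [A.half_pre hI _ (r _), Category.assoc]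
  · simp only [full_apply]
    refine Finset.sum_congr rfl fun l _ => ?_
    rw [whisker_exchange_assoc, A.half_slide, Category.assoc]
  · change A.full _ _ V ξ = A.act V ξ
    rw [full_apply]
    conv_rhs => rw [← (r j.1).sum_pre (A.act V ξ)]
    refine Finset.sum_congr rfl fun l _ => congrArg _ ?_
    rw [A.half_eq hI, A.pre_act hI]

end IrrAction

/-- Actions which agree on the objects of `I` are equal. -/
theorem AnnularAction.ext_irr {S : StandardSolutions C} {I : Set C} {X : IndObj.{w} C}
    (hI : IsIrr I) {A B : AnnularAction S X}
    (h : ∀ {i j α : I} (V : α.1 ⊗ j.1 ⟶ i.1 ⊗ α.1) (ξ : X.HomSpace S i.1),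
      A.act V ξ = B.act V ξ) {a b α : C} (V : α ⊗ b ⟶ a ⊗ α) (ξ : X.HomSpace S a) :
    A.act V ξ = B.act V ξ := by
  obtain ⟨r⟩ := hI.nonempty_resolution S a
  obtain ⟨q⟩ := hI.nonempty_resolution S b
  obtain ⟨p⟩ := hI.nonempty_resolution S α
  rw [← A.sum_act_conj p.isDirectSum.2, ← B.sum_act_conj p.isDirectSum.2]
  refine Finset.sum_congr rfl fun m _ => ?_
  generalize p.u m ▷ b ≫ V ≫ a ◁ (p.u m)† = W
  rw [← q.sum_pre (A.act W ξ), ← q.sum_pre (B.act W ξ)]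
  refine Finset.sum_congr rfl fun l _ => congrArg _ ?_
  rw [A.pre_act, B.pre_act, ← r.sum_pre ξ, map_sum, map_sum]
  refine Finset.sum_congr rfl fun k _ => ?_
  rw [A.act_pre, B.act_pre, h]

end

/-! ### From modules to half braidings. -/

section

open IndObj.HomSpace StandardSolutions TubeAlgebra

namespace RightHilbertModule
variable {S : StandardSolutions C} {I : Set C} {K : Type w}
    [NormedAddCommGroup K] [InnerProductSpace ℂ K] [CompleteSpace K]
    (M : RightHilbertModule S I K) {X : IndObj.{w'} C} (φ : ∀ i : I, X.HomSpace S i.1 →ₗᵢ[ℂ] K)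

/-- The compression of the operators of a module to the Hilbert spaces `(X, i)`. -/
def compress {i j : I} {α : C} (V : α ⊗ j.1 ⟶ i.1 ⊗ α) : X.HomSpace S i.1 →L[ℂ] X.HomSpace S j.1 :=
  (φ j).toContinuousLinearMap.adjoint ∘L M.act (ofObj S i j α V) ∘L (φ i).toContinuousLinearMap

variable {M φ}

theorem IsRealizedBy.act_proj (hI : IsIrr I) (hφ : M.IsRealizedBy φ) (i : I)
    (ξ : X.HomSpace S i.1) : M.act (proj S i) (φ i ξ) = φ i ξ := by
  obtain ⟨η, hη⟩ : φ i ξ ∈ Set.range (M.act (proj S i)) := hφ i ▸ Set.mem_range_self ξ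
  rw [← hη, M.act_proj_act_proj hI]

/-- The range of the action lies in K · p_j, which is the range of the isometry φ j, so nothing is
lost in the compression. -/
theorem IsRealizedBy.map_compress (hI : IsIrr I) (hφ : M.IsRealizedBy φ) {i j : I} {α : C}
    (V : α ⊗ j.1 ⟶ i.1 ⊗ α) (ξ : X.HomSpace S i.1) :
    φ j (M.compress φ V ξ) = M.act (ofObj S i j α V) (φ i ξ) := by
  obtain ⟨ζ, hζ⟩ : M.act (ofObj S i j α V) (φ i ξ) ∈ Set.range (φ j) := by
    rw [hφ j, ← M.act_proj_act_ofObj hI]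
    exact Set.mem_range_self _
  have h : M.compress φ V ξ = (φ j).toContinuousLinearMap.adjoint (φ j ζ) :=
    congrArg (φ j).toContinuousLinearMap.adjoint hζ.symm
  have h1 : (φ j).toContinuousLinearMap.adjoint (φ j ζ) = ζ := ext_inner_left ℂ fun v => by
    rw [ContinuousLinearMap.adjoint_inner_right]
    exact (φ j).inner_map_map v ζ
  rw [h, h1, hζ]

/-- The action of the objects of `I` defined by a module. -/
def IsRealizedBy.toIrrAction (hI : IsIrr I) (hφ : M.IsRealizedBy φ) : IrrAction S I X where
  act V := M.compress φ V
  act_add {i j α} V W ξ := (φ j).injective (by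
    simp only [map_add, hφ.map_compress hI, ofObj_add hI, add_apply])
  act_smul {i j α} c V ξ := (φ j).injective (by
    simp only [map_smul, hφ.map_compress hI, ofObj_smul hI, smul_apply])
  slide {i j α β} f V ξ := (φ j).injective (by
    simp only [hφ.map_compress hI, ofObj_slide])
  act_act {i k j α β} V W ξ := (φ j).injective (by
    simp only [hφ.map_compress hI, M.act_ofObj_ofObj hI])
  act_unit {i} ξ := (φ i).injective (by
    rw [hφ.map_compress hI]
    exact hφ.act_proj hI i ξ)
  inner_act {i j α} V ξ η := by
    rw [← (φ j).inner_map_map, ← (φ i).inner_map_map, hφ.map_compress hI, hφ.map_compress hI,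
      M.inner_act_ofObj hI]

theorem IsRealizedBy.existsUnique_determines (hI : IsIrr I) (hφ : M.IsRealizedBy φ) :
    ∃! σ : UnitaryHalfBraiding X, M.Determines φ σ := by
  -- `Determines` says that the action of σ between members of I is the compressed action. Existence
  -- follows by extending that action and passing to its rotation; uniqueness holds because an
  -- action is determined by its values on I and a rotation by its action.
  have key : ∀ σ : UnitaryHalfBraiding X, M.Determines φ σ ↔
      ∀ {i j α : I} (V : α.1 ⊗ j.1 ⟶ i.1 ⊗ α.1) (ξ : X.HomSpace S i.1),
        (σ.toAction S).act V ξ = M.compress φ V ξ := fun σ => by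
    constructor
    · intro h i j α V ξ
      refine ext_inner_left ℂ fun η => ?_
      rw [← UnitaryHalfBraiding.coefficient_eq, h, ← (φ j).inner_map_map, hφ.map_compress hI,
        ofObj_of hI]
    · intro h i j α ξ η V
      rw [UnitaryHalfBraiding.coefficient_eq, h, ← (φ j).inner_map_map, hφ.map_compress hI,
        ofObj_of hI]
  obtain ⟨B, hB⟩ := (hφ.toIrrAction hI).exists_extension hI
  have hact : ∀ {a b α : C} (V : α ⊗ b ⟶ a ⊗ α) (ξ : X.HomSpace S a),
      (B.toRotation.toHalfBraiding.toAction S).act V ξ = B.act V ξ := fun {a b α} V ξ => by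
    refine Eq.trans ?_ (B.rotation_tubeAct V ξ)
    exact congrArg (fun R : ∀ α, NatOp S (X.tensorRight α) (X.tensorLeft α) => (R α).tubeAct V ξ)
      B.toRotation.toRotation_toHalfBraiding
  refine ⟨B.toRotation.toHalfBraiding, (key _).2 fun V ξ => ?_, fun ρ hρ => ?_⟩
  · rw [hact, hB]
    rfl
  · refine UnitaryHalfBraiding.toRotation_injective (S := S) (funext fun α =>
      AnnularAction.rotation_ext fun {a b} V ξ => ?_)
    refine AnnularAction.ext_irr (A := ρ.toAction S) (B := B.toRotation.toHalfBraiding.toAction S) hI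
      (fun V ξ => ?_) V ξ
    rw [(key ρ).1 hρ, hact, hB]
    rfl

end RightHilbertModule

theorem exists_orthonormal_closure_span {K : Type w} [NormedAddCommGroup K] [InnerProductSpace ℂ K]
    (W : Submodule ℂ K) [CompleteSpace W] : ∃ B : Set K, Orthonormal ℂ ((↑) : B → K) ∧
      (Submodule.span ℂ B).topologicalClosure = W.topologicalClosure := by
  obtain ⟨w, b, hb⟩ := exists_hilbertBasis ℂ W
  refine ⟨(↑) '' w, ?_, le_antisymm (Submodule.topologicalClosure_mono
    (Submodule.span_le.2 ?_)) (Submodule.topologicalClosure_minimal _ (fun x hx => ?_)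
      (Submodule.isClosed_topologicalClosure _))⟩
  · have h := (b.orthonormal.comp_linearIsometry W.subtypeₗᵢ)
    have h1 := h.toSubtypeRange
    rw [hb] at h1
    have h2 : Set.range (W.subtypeₗᵢ ∘ ((↑) : w → W)) = (↑) '' w := by
      rw [Set.range_comp, Subtype.range_coe]
      rfl
    rwa [h2] at h1
  · rintro _ ⟨x, -, rfl⟩
    exact x.2
  · have h1 := b.dense_span
    rw [hb, Subtype.range_coe] at h1
    have h2 : (⟨x, hx⟩ : W) ∈ closure (Submodule.span ℂ w : Set W) := by
      rw [← Submodule.topologicalClosure_coe, h1]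
      trivial
    have h3 := image_closure_subset_closure_image W.subtypeL.continuous ⟨_, h2, rfl⟩
    refine closure_mono ?_ h3
    have h4 : Submodule.span ℂ (((↑) : W → K) '' w) = (Submodule.span ℂ w).map W.subtype :=
      Submodule.span_image W.subtype
    rw [h4]
    rfl

theorem exists_linearIsometry_span {E : Type*} {K : Type*} [NormedAddCommGroup E]
    [InnerProductSpace ℂ E] [NormedAddCommGroup K] [InnerProductSpace ℂ K]
    (h : Module.finrank ℂ E = 1) {e : K} (he : ‖e‖ = 1) :
    ∃ V : E →ₗᵢ[ℂ] K, (∀ x, V x ∈ Submodule.span ℂ {e}) ∧ e ∈ Set.range V := by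
  obtain ⟨v, hv, hs⟩ := finrank_eq_one_iff'.1 h
  have hv' : ‖v‖ ≠ 0 := norm_ne_zero_iff.2 hv
  -- Normalized so that v, which spans E, goes to ‖v‖ e.
  let L : E →ₗ[ℂ] K := (((‖v‖ : ℂ)⁻¹ • (innerSL ℂ v)).toLinearMap).smulRight e
  have hL : ∀ x, L x = ((‖v‖ : ℂ)⁻¹ * inner ℂ v x) • e := fun x => rfl
  have hL' : ∀ c : ℂ, L (c • v) = (c * ‖v‖) • e := fun c => by
    rw [hL, inner_smul_right, inner_self_eq_norm_sq_to_K]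
    congr 1
    have : (‖v‖ : ℂ) ≠ 0 := by exact_mod_cast hv'
    simp only [Complex.coe_algebraMap]
    field_simp
  refine ⟨⟨L, fun x => ?_⟩, fun x => ?_, ⟨(‖v‖ : ℂ)⁻¹ • v, ?_⟩⟩
  · obtain ⟨c, rfl⟩ := hs x
    rw [hL', norm_smul, he, norm_smul]
    simp
  · exact Submodule.smul_mem _ _ (Submodule.mem_span_singleton_self e)
  · change L _ = e
    rw [hL', inv_mul_cancel₀ (by exact_mod_cast hv'), one_smul]

end

/-! ### Realization of a module by an ind-object. -/

section

open IndObj.HomSpace StandardSolutions TubeAlgebra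

theorem IsIrreducible.finrank_hilbHom {i : C} (h : IsIrreducible i) (S : StandardSolutions C) :
    Module.finrank ℂ (HilbHom S i i) = 1 :=
  finrank_eq_one_iff'.2 ⟨toHilb S (𝟙 i), h.id_ne_zero, fun f => by
    obtain ⟨c, hc, -⟩ := h f.hom
    exact ⟨c, hc.symm⟩⟩

namespace RightHilbertModule
variable {S : StandardSolutions C} {I : Set C} {K : Type w}
    [NormedAddCommGroup K] [InnerProductSpace ℂ K] [CompleteSpace K]
    (M : RightHilbertModule S I K)

theorem isClosed_range_proj (hI : IsIrr I) (i : I) :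
    IsClosed ((M.act (proj S i)).range : Set K) := by
  have : ((M.act (proj S i)).range : Set K) = {x | M.act (proj S i) x = x} := by
    ext x
    refine ⟨?_, fun h => ⟨x, h⟩⟩
    rintro ⟨y, rfl⟩
    exact M.act_proj_act_proj hI i y
  rw [this]
  exact isClosed_eq (M.act (proj S i)).continuous continuous_id

/-- The ind-object contains one copy of i for each vector of an orthonormal basis of K · p_i. A copy
of i contributes one dimension to (X, i) and nothing to (X, j) for j ≠ i, so (X, i) is matched with
K · p_i line by line. -/
theorem exists_isRealizedBy (hI : IsIrr I) :
    ∃ (X : IndObj.{w} C) (φ : ∀ i : I, X.HomSpace S i.1 →ₗᵢ[ℂ] K), M.IsRealizedBy φ := by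
  have hc := M.isClosed_range_proj hI
  have hB : ∀ i : I, ∃ B : Set K, Orthonormal ℂ ((↑) : B → K) ∧
      (Submodule.span ℂ B).topologicalClosure = (M.act (proj S i)).range := fun i => by
    have := (hc i).completeSpace_coe
    obtain ⟨B, h, h'⟩ := exists_orthonormal_closure_span (M.act (proj S i)).range
    exact ⟨B, h, h'.trans (hc i).submodule_topologicalClosure_eq⟩
  choose B hB hspan using hB
  have hmem : ∀ {i : I} {e : K}, e ∈ B i → e ∈ (M.act (proj S i)).range := fun {i e} he =>
    hspan i ▸ Submodule.le_topologicalClosure _ (Submodule.subset_span he)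
  have hnorm : ∀ {i : I} {e : K}, e ∈ B i → ‖e‖ = 1 := fun {i e} he => (hB i).1 ⟨e, he⟩
  have horth : ∀ {i j : I} {e f : K}, e ∈ B i → f ∈ B j → e ≠ f → inner ℂ e f = 0 := by
    intro i j e f he hf hef
    by_cases hij : i = j
    · subst hij
      exact (hB i).2 (i := ⟨e, he⟩) (j := ⟨f, hf⟩) (fun h => hef (congrArg Subtype.val h))
    · obtain ⟨x, rfl⟩ := hmem he
      obtain ⟨y, rfl⟩ := hmem hf
      exact M.inner_act_proj_of_ne hI hij x y
  -- Indexing by vectors of K keeps the ind-object in the universe of K. The class of a vector is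
  -- then chosen, and it is unique because the subspaces K · p_i are mutually orthogonal and basis
  -- vectors are nonzero.
  let ι : Type w := {e : K // ∃ i, e ∈ B i}
  let c : ι → I := fun e => e.2.choose
  have hce : ∀ e : ι, e.1 ∈ B (c e) := fun e => e.2.choose_spec
  have hc' : ∀ (e : ι) {i : I}, e.1 ∈ B i → c e = i := fun e i he => by
    by_contra h
    obtain ⟨x, hx⟩ := hmem (hce e)
    obtain ⟨y, hy⟩ := hmem he
    have h1 := M.inner_act_proj_of_ne hI h x y
    change M.act (proj S (c e)) x = e.1 at hx
    change M.act (proj S i) y = e.1 at hy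
    rw [hx, hy, inner_self_eq_norm_sq_to_K, hnorm he] at h1
    simp at h1
  let X : IndObj.{w} C := ⟨ι, fun e => (c e).1⟩
  -- If e is a basis vector of K · p_i, the one-dimensional space of morphisms from i to its summand
  -- is sent isometrically onto the line of e. Otherwise that space is zero by Schur's lemma.
  have hV : ∀ (i : I) (e : ι), ∃ V : HilbHom S i.1 (c e).1 →ₗᵢ[ℂ] K,
      (∀ x, V x ∈ Submodule.span ℂ {e.1}) ∧ (e.1 ∈ B i → e.1 ∈ Set.range V) ∧
        (e.1 ∉ B i → ∀ x, V x = 0) := by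
    intro i e
    by_cases he : e.1 ∈ B i
    · obtain rfl := hc' e he
      obtain ⟨V, h1, h2⟩ := exists_linearIsometry_span
        ((hI.1 _ (c e).2).finrank_hilbHom S) (hnorm he)
      exact ⟨V, h1, fun _ => h2, fun h => absurd he h⟩
    · refine ⟨⟨0, fun x => ?_⟩, fun x => Submodule.zero_mem _, fun h => absurd h he, fun _ _ => rfl⟩
      have : x = 0 := by
        by_contra h
        have h1 : i = c e := hI.eq_of_hom (f := x.hom) h
        exact he (h1 ▸ hce e)
      rw [this]
      simp
  choose V hV1 hV2 hV3 using hV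
  have hfam : ∀ i, OrthogonalFamily ℂ (fun e : ι => HilbHom S i.1 (c e).1) (V i) := by
    intro i e f hef x y
    obtain ⟨a, ha⟩ := Submodule.mem_span_singleton.1 (hV1 i e x)
    obtain ⟨b, hb⟩ := Submodule.mem_span_singleton.1 (hV1 i f y)
    rw [← ha, ← hb, inner_smul_left, inner_smul_right,
      horth (hce e) (hce f) (fun h => hef (Subtype.ext h)), mul_zero, mul_zero]
  refine ⟨X, fun i => (hfam i).linearIsometry, fun i => ?_⟩
  have h1 : (hfam i).linearIsometry.range = (M.act (proj S i)).range := by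
    rw [(hfam i).range_linearIsometry]
    refine le_antisymm (Submodule.topologicalClosure_minimal _ (iSup_le fun e => ?_) (hc i)) ?_
    · rintro _ ⟨x, rfl⟩
      by_cases he : e.1 ∈ B i
      · exact Submodule.span_le.2 (Set.singleton_subset_iff.2 (hmem he)) (hV1 i e x)
      · exact (hV3 i e he x).symm ▸ Submodule.zero_mem _
    · rw [← hspan i]
      refine Submodule.topologicalClosure_mono (Submodule.span_le.2 fun e he => ?_)
      exact Submodule.mem_iSup_of_mem ⟨e, i, he⟩ (hV2 i ⟨e, i, he⟩ he)
  exact congrArg (fun W : Submodule ℂ K => (W : Set K)) h1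

end RightHilbertModule

end

/-! ### Mutual inverses, and morphisms of half braidings in terms of actions. -/

section

open IndObj.HomSpace StandardSolutions TubeAlgebra

theorem linearIsometryEquiv_symm_lpIncl {J : Type*} {E : J → Type*} {K : Type*}
    [∀ j, NormedAddCommGroup (E j)] [∀ j, InnerProductSpace ℂ (E j)] [∀ j, CompleteSpace (E j)]
    [NormedAddCommGroup K] [InnerProductSpace ℂ K] [CompleteSpace K] {V : ∀ j, E j →ₗᵢ[ℂ] K}
    (h : IsHilbertSum ℂ E V) (j : J) (x : E j) :
    h.linearIsometryEquiv.symm (lpIncl E j x) = V j x :=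
  h.linearIsometryEquiv_symm_apply_single x

namespace RightHilbertModule
variable {S : StandardSolutions C} {I : Set C} {K : Type w}
    [NormedAddCommGroup K] [InnerProductSpace ℂ K] [CompleteSpace K]
    {M : RightHilbertModule S I K} {X : IndObj.{w'} C} {φ : ∀ i : I, X.HomSpace S i.1 →ₗᵢ[ℂ] K}

theorem IsRealizedBy.isHilbertSum (hI : IsIrr I) (hM : M.Nondegenerate) (hφ : M.IsRealizedBy φ) :
    IsHilbertSum ℂ (fun i : I => X.HomSpace S i.1) φ := by
  refine IsHilbertSum.mk (fun i j hij ξ η => ?_) ?_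
  · rw [← hφ.act_proj hI i ξ, ← hφ.act_proj hI j η]
    exact M.inner_act_proj_of_ne hI hij _ _
  · rw [← M.dense_proj hI hM]
    refine Submodule.topologicalClosure_mono (iSup_mono fun i => ?_)
    exact SetLike.coe_subset_coe.1 (hφ i).symm.subset

theorem Determines.map_act (hI : IsIrr I) (hφ : M.IsRealizedBy φ) {σ : UnitaryHalfBraiding X}
    (hσ : M.Determines φ σ) {i j α : I} (V : α.1 ⊗ j.1 ⟶ i.1 ⊗ α.1) (ξ : X.HomSpace S i.1) :
    φ j ((σ.toAction S).act V ξ) = M.act (of S i j α V) (φ i ξ) := by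
  rw [← ofObj_of hI, ← hφ.map_compress hI]
  refine congrArg _ (ext_inner_left ℂ fun η => ?_)
  rw [← UnitaryHalfBraiding.coefficient_eq, hσ, ← (φ j).inner_map_map, hφ.map_compress hI,
    ofObj_of hI]

theorem IsRealizedBy.act_of_of_ne (hI : IsIrr I) (hφ : M.IsRealizedBy φ) {i i' j α : I}
    (hi : i' ≠ i) (V : α.1 ⊗ j.1 ⟶ i.1 ⊗ α.1) (ξ : X.HomSpace S i'.1) :
    M.act (of S i j α V) (φ i' ξ) = 0 := by
  rw [← hφ.act_proj hI, ← ofObj_of hI, M.act_ofObj_act_proj_of_ne hI hi]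

theorem Determines.exists_linearIsometryEquiv (hI : IsIrr I) (hM : M.Nondegenerate)
    (hφ : M.IsRealizedBy φ) {σ : UnitaryHalfBraiding X} (hσ : M.Determines φ σ)
    {M' : RightHilbertModule S I (X.Total S I)} (hM' : σ.Induces M') :
    ∃ U : X.Total S I ≃ₗᵢ[ℂ] K,
      (∀ (i : I) (ξ : X.HomSpace S i.1), U (X.incl S I i ξ) = φ i ξ) ∧
      ∀ (a : TubeAlgebra S I) (ξ : X.Total S I), U (M'.act a ξ) = M.act a (U ξ) := by
  have hU := hφ.isHilbertSum hI hM
  have h1 : ∀ (i : I) (ξ : X.HomSpace S i.1),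
      hU.linearIsometryEquiv.symm (X.incl S I i ξ) = φ i ξ := fun i ξ =>
    linearIsometryEquiv_symm_lpIncl hU i ξ
  refine ⟨hU.linearIsometryEquiv.symm, h1, fun a ξ => ?_⟩
  generalize hU.linearIsometryEquiv.symm = U at h1
  let U' : X.Total S I →L[ℂ] K := U.toContinuousLinearEquiv.toContinuousLinearMap
  let f : TubeAlgebra S I →ₗ[ℂ] (X.Total S I →L[ℂ] K) :=
    { toFun := fun a => U' ∘L M'.act a
      map_add' := fun a b => by rw [map_add, ContinuousLinearMap.comp_add]
      map_smul' := fun c a => by rw [map_smul, ContinuousLinearMap.comp_smul]; rfl }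
  let g : TubeAlgebra S I →ₗ[ℂ] (X.Total S I →L[ℂ] K) :=
    { toFun := fun a => M.act a ∘L U'
      map_add' := fun a b => by rw [map_add, ContinuousLinearMap.add_comp]
      map_smul' := fun c a => by rw [map_smul, ContinuousLinearMap.smul_comp]; rfl }
  have hfg : f = g := act_induction fun i j α V => IndObj.total_ext fun i' ξ => by
    change U (M'.act (of S i j α V) (X.incl S I i' ξ)) = M.act (of S i j α V) (U (X.incl S I i' ξ))
    rw [h1]
    by_cases hi : i' = i
    · subst hi
      rw [(σ.induces_iff M').1 hM', h1, hσ.map_act hI hφ]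
    · rw [hM'.act_of_of_ne hI hi, hφ.act_of_of_ne hI hi, map_zero]
  exact DFunLike.congr_fun (LinearMap.congr_fun hfg a) ξ

end RightHilbertModule

theorem NatOp.tensor_ext {S : StandardSolutions C} {X Y : IndObj.{w} C} {α : C}
    {P Q : NatOp S (X.tensorRight α) (Y.tensorLeft α)}
    (h : ∀ {a b : C} (V : α ⊗ b ⟶ a ⊗ α) (ξ : X.HomSpace S a),
      ptOp S Y α b (P.op _ (pre S _ V (whiskR S X α a ξ))) =
        ptOp S Y α b (Q.op _ (pre S _ V (whiskR S X α a ξ)))) : P = Q := by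
  refine NatOp.op_ext fun l => ptOp_injective α ?_
  have h1 : ∀ P : NatOp S (X.tensorRight α) (Y.tensorLeft α),
      ptOp S Y α _ (pre S _ (S.cap α (X.obj l ⊗ α)) (P.op _ (unitVec S (X.tensorRight α) l))) =
        ptOp S Y α _ (P.op _ (pre S _ (S.cap α (X.obj l ⊗ α)) (whiskR S X α _ (unitVec S X l)))) :=
    fun P => by
      refine congrArg (ptOp S Y α _) ?_
      rw [P.op_pre]
      exact congrArg (fun ζ => pre S _ _ (P.op _ ζ)) (NatOp.whiskR_unitVec (X := X) α l).symm
  exact (h1 P).trans ((h _ _).trans (h1 Q).symm)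

namespace UnitaryHalfBraiding
variable {S : StandardSolutions C} {X Y : IndObj.{w} C} {σ : UnitaryHalfBraiding X}
  {ρ : UnitaryHalfBraiding Y}

/-- Composing the intertwining relation with the unitaries R_α of both half braidings turns a
relation for σ, ρ into one for the rotations. -/
theorem isMorphism_mat_iff' (T : NatOp S X Y) : σ.IsMorphism ρ T.mat ↔
    ∀ α, (ρ.rotationOp S α).comp (T.tensorRight α) = (T.tensorLeft α).comp (σ.rotationOp S α) := by
  have h1 : σ.IsMorphism ρ T.mat ↔ ∀ α, (T.tensorRight α).comp (σ.rotationOp S α).adj =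
      (ρ.rotationOp S α).adj.comp (T.tensorLeft α) := by
    have hs : ∀ α, ((σ.rotationOp S α).adj).mat = σ.σ α := fun α => by
      rw [rotationOp, NatOp.adj_adj, IndMat.mat_natOp]
    have hr : ∀ α, ((ρ.rotationOp S α).adj).mat = ρ.σ α := fun α => by
      rw [rotationOp, NatOp.adj_adj, IndMat.mat_natOp]
    have hL : ∀ α (k : Y.ι) (l : X.ι), ((T.tensorRight α).comp (σ.rotationOp S α).adj).mat k l =
        ∑' m : X.ι, σ.σ α m l ≫ (T.mat k m ▷ α) := fun α k l => by
      refine (congrFun (congrFun (NatOp.mat_comp (T.tensorRight α) (σ.rotationOp S α).adj) k)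
        l).trans (tsum_congr fun (m : X.ι) => ?_)
      exact congrArg₂ (· ≫ ·) (congrFun (congrFun (hs α) m) l) (T.mat_tensorRight α k m)
    have hR : ∀ α (k : Y.ι) (l : X.ι), ((ρ.rotationOp S α).adj.comp (T.tensorLeft α)).mat k l =
        ∑' m : Y.ι, (α ◁ T.mat m l) ≫ ρ.σ α k m := fun α k l => by
      refine (congrFun (congrFun (NatOp.mat_comp (ρ.rotationOp S α).adj (T.tensorLeft α)) k)
        l).trans (tsum_congr fun (m : Y.ι) => ?_)
      exact congrArg₂ (· ≫ ·) (T.mat_tensorLeft α m l) (congrFun (congrFun (hr α) k) m)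
    refine ⟨fun h α => NatOp.mat_injective (funext fun (k : Y.ι) => funext fun (l : X.ι) => ?_),
      fun h => ⟨T.isBounded, fun α k l => ?_⟩⟩
    · exact (hL α k l).trans ((h.2 α k l).trans (hR α k l).symm)
    · exact (hL α k l).symm.trans ((congrFun (congrFun (congrArg NatOp.mat (h α)) k) l).trans
        (hR α k l))
  rw [h1]
  refine forall_congr' fun α => ?_
  have s1 := fun γ ξ => congrArg (fun F : NatOp S _ _ => F.op γ ξ) ((σ.toRotation S).adj_comp α)
  have s2 := fun γ ξ => congrArg (fun F : NatOp S _ _ => F.op γ ξ) ((σ.toRotation S).comp_adj α)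
  have r1 := fun γ ξ => congrArg (fun F : NatOp S _ _ => F.op γ ξ) ((ρ.toRotation S).adj_comp α)
  have r2 := fun γ ξ => congrArg (fun F : NatOp S _ _ => F.op γ ξ) ((ρ.toRotation S).comp_adj α)
  change ∀ γ ξ, (σ.rotationOp S α).adj.op γ ((σ.rotationOp S α).op γ ξ) = ξ at s1
  change ∀ γ ξ, (σ.rotationOp S α).op γ ((σ.rotationOp S α).adj.op γ ξ) = ξ at s2
  change ∀ γ ξ, (ρ.rotationOp S α).adj.op γ ((ρ.rotationOp S α).op γ ξ) = ξ at r1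
  change ∀ γ ξ, (ρ.rotationOp S α).op γ ((ρ.rotationOp S α).adj.op γ ξ) = ξ at r2
  constructor
  · intro h
    refine NatOp.ext_op fun γ => ContinuousLinearMap.ext fun ξ => ?_
    have h2 := congrArg (fun F : NatOp S _ _ => F.op γ ((σ.rotationOp S α).op γ ξ)) h
    change (T.tensorRight α).op γ ((σ.rotationOp S α).adj.op γ ((σ.rotationOp S α).op γ ξ)) =
      (ρ.rotationOp S α).adj.op γ ((T.tensorLeft α).op γ ((σ.rotationOp S α).op γ ξ)) at h2
    rw [s1] at h2
    change (ρ.rotationOp S α).op γ ((T.tensorRight α).op γ ξ) = _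
    rw [h2, r2]
    rfl
  · intro h
    refine NatOp.ext_op fun γ => ContinuousLinearMap.ext fun ξ => ?_
    have h2 := congrArg (fun F : NatOp S _ _ => F.op γ ((σ.rotationOp S α).adj.op γ ξ)) h
    change (ρ.rotationOp S α).op γ ((T.tensorRight α).op γ ((σ.rotationOp S α).adj.op γ ξ)) =
      (T.tensorLeft α).op γ ((σ.rotationOp S α).op γ ((σ.rotationOp S α).adj.op γ ξ)) at h2
    rw [s2] at h2
    change _ = (ρ.rotationOp S α).adj.op γ ((T.tensorLeft α).op γ ξ)
    rw [← h2, r1]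
    rfl

/-- Partial traces of the two sides of the rotated relation are the two sides here: T ⊗ 1 commutes
with whiskering, and 1 ⊗ T can be taken out of the partial trace. Frobenius reciprocity
(`NatOp.tensor_ext`) shows that no information is lost. -/
theorem isMorphism_mat_iff (T : NatOp S X Y) : σ.IsMorphism ρ T.mat ↔
    ∀ {a b α : C} (V : α ⊗ b ⟶ a ⊗ α) (ξ : X.HomSpace S a),
      T.op b ((σ.toAction S).act V ξ) = (ρ.toAction S).act V (T.op a ξ) := by
  rw [isMorphism_mat_iff']
  have h1 : ∀ {a b α : C} (V : α ⊗ b ⟶ a ⊗ α) (ξ : X.HomSpace S a),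
      (ρ.toAction S).act V (T.op a ξ) = ptOp S Y α b
        (((ρ.rotationOp S α).comp (T.tensorRight α)).op _ (pre S _ V (whiskR S X α a ξ))) :=
    fun {a b α} V ξ => by
      change ptOp S Y α b ((ρ.rotationOp S α).op _ (pre S _ V (whiskR S Y α a (T.op a ξ)))) = _
      rw [← NatOp.tensorRight_whiskR, ← NatOp.op_pre]
      rfl
  have h2 : ∀ {a b α : C} (V : α ⊗ b ⟶ a ⊗ α) (ξ : X.HomSpace S a),
      T.op b ((σ.toAction S).act V ξ) = ptOp S Y α b
        (((T.tensorLeft α).comp (σ.rotationOp S α)).op _ (pre S _ V (whiskR S X α a ξ))) :=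
    fun {a b α} V ξ => (T.ptOp_tensorLeft α _).symm
  refine ⟨fun h {a b α} V ξ => ?_, fun h α => NatOp.tensor_ext fun {a b} V ξ => ?_⟩
  · rw [h1, h2, h]
  · rw [← h1, ← h2, h]

end UnitaryHalfBraiding

end

/-! ### Natural families and operators on the direct sum of the spaces (X, i). -/

section

open IndObj.HomSpace StandardSolutions TubeAlgebra

namespace NatOp
variable {S : StandardSolutions C} {I : Set C} {X Y Z : IndObj.{w} C}

theorem ext_irr (hI : IsIrr I) {P Q : NatOp S X Y}
    (h : ∀ (i : I) (ξ : X.HomSpace S i.1), P.op i.1 ξ = Q.op i.1 ξ) : P = Q :=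
  ext_op fun γ => ContinuousLinearMap.ext fun ξ => by
    obtain ⟨r⟩ := hI.nonempty_resolution S γ
    rw [← r.sum_pre ξ, map_sum, map_sum]
    refine Finset.sum_congr rfl fun k _ => ?_
    rw [P.op_pre, Q.op_pre, h]

theorem exists_total (I : Set C) (T : NatOp S X Y) : ∃ F : X.Total S I →L[ℂ] Y.Total S I,
    ∀ (i : I) (ξ : X.HomSpace S i.1), F (X.incl S I i ξ) = Y.incl S I i (T.op i.1 ξ) := by
  obtain ⟨c, hc⟩ := T.bounded
  have h : ∀ (s : Finset I) (x : ∀ i : I, X.HomSpace S i.1),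
      ‖∑ i ∈ s, ((Y.incl S I i).toContinuousLinearMap ∘L T.op i.1) (x i)‖ ^ 2 ≤
        c ^ 2 * ∑ i ∈ s, ‖x i‖ ^ 2 := fun s x => by
    have h1 : ∀ i ∈ s, ∀ j ∈ s, i ≠ j →
        inner ℂ (Y.incl S I i (T.op i.1 (x i))) (Y.incl S I j (T.op j.1 (x j))) = (0 : ℂ) :=
      fun i _ j _ hij => IndObj.inner_incl_of_ne hij _ _
    have h2 : ‖∑ i ∈ s, Y.incl S I i (T.op i.1 (x i))‖ ^ 2 =
        ∑ i ∈ s, ‖T.op i.1 (x i)‖ ^ 2 := by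
      have h3 : (inner ℂ (∑ i ∈ s, Y.incl S I i (T.op i.1 (x i)))
          (∑ i ∈ s, Y.incl S I i (T.op i.1 (x i))) : ℂ) =
          ∑ i ∈ s, inner ℂ (T.op i.1 (x i)) (T.op i.1 (x i)) := by
        rw [sum_inner]
        refine Finset.sum_congr rfl fun i hi => ?_
        rw [inner_sum, Finset.sum_eq_single i (fun j hj hij => h1 i hi j hj hij.symm)
          (fun h => absurd hi h), LinearIsometry.inner_map_map]
      have h4 := congrArg RCLike.re h3
      rw [inner_self_eq_norm_sq, map_sum] at h4
      simpa only [inner_self_eq_norm_sq] using h4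
    refine h2.le.trans ?_
    rw [Finset.mul_sum]
    refine Finset.sum_le_sum fun i _ => ?_
    rw [← mul_pow]
    exact pow_le_pow_left₀ (norm_nonneg _) (((T.op i.1).le_opNorm _).trans
      (mul_le_mul_of_nonneg_right (hc i.1) (norm_nonneg _))) 2
  exact ⟨lpLift _ (c ^ 2) h, fun i ξ => lpLift_single _ _ h i ξ⟩

/-- The operator on the direct sums of a natural family. -/
def total (I : Set C) (T : NatOp S X Y) : X.Total S I →L[ℂ] Y.Total S I :=
  Classical.choose (T.exists_total I)

theorem total_incl (T : NatOp S X Y) (i : I) (ξ : X.HomSpace S i.1) :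
    T.total I (X.incl S I i ξ) = Y.incl S I i (T.op i.1 ξ) :=
  Classical.choose_spec (T.exists_total I) i ξ

theorem total_injective (hI : IsIrr I) {P Q : NatOp S X Y} (h : P.total I = Q.total I) : P = Q :=
  ext_irr hI fun i ξ => (Y.incl S I i).injective (by rw [← total_incl, ← total_incl, h])

theorem total_comp (R : NatOp S Y Z) (T : NatOp S X Y) :
    (R.comp T).total I = R.total I ∘L T.total I :=
  IndObj.total_ext fun i ξ => by
    rw [total_incl, ContinuousLinearMap.comp_apply, total_incl, total_incl]
    rfl

theorem total_id : (NatOp.id S X).total I = 1 :=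
  IndObj.total_ext fun i ξ => total_incl _ i ξ

theorem proj_total (T : NatOp S X Y) (i : I) (ξ : X.Total S I) :
    IndObj.proj S I Y i (T.total I ξ) = T.op i.1 (IndObj.proj S I X i ξ) := by
  have : IndObj.proj S I Y i ∘L T.total I = T.op i.1 ∘L IndObj.proj S I X i :=
    IndObj.total_ext fun j η => by
      rw [ContinuousLinearMap.comp_apply, ContinuousLinearMap.comp_apply, total_incl]
      by_cases h : j = i
      · subst h
        rw [IndObj.proj_incl, IndObj.proj_incl]
      · rw [IndObj.proj_incl_of_ne h, IndObj.proj_incl_of_ne h, map_zero]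
  exact DFunLike.congr_fun this ξ

theorem adjoint_total (T : NatOp S X Y) : (T.total I).adjoint = T.adj.total I :=
  IndObj.total_ext fun i η => ext_inner_left ℂ fun ξ => by
    rw [ContinuousLinearMap.adjoint_inner_right, total_incl, ← IndObj.inner_proj_left,
      ← IndObj.inner_proj_left, proj_total, adj_inner_right]

theorem implements_mat_iff (T : NatOp S X Y) {F : X.Total S I →L[ℂ] Y.Total S I} :
    T.mat.Implements F ↔ F = T.total I := by
  have h : ∀ {i : C} (ξ : X.HomSpace S i) (k : Y.ι), (T.op i ξ).component k =
      ∑' l : X.ι, ξ.component l ≫ T.mat k l := fun ξ k => (T.hasSum_op ξ k).tsum_eq.symm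
  constructor
  · refine fun hF => IndObj.total_ext fun i ξ => ?_
    obtain ⟨ζ, h1, h2⟩ := hF i ξ
    rw [h2, total_incl]
    exact congrArg _ (ext' fun k => (h1 k).trans (h ξ k).symm)
  · rintro rfl i ξ
    exact ⟨T.op i.1 ξ, h ξ, T.total_incl i ξ⟩

theorem isUnitary_mat_iff_total (hI : IsIrr I) (T : NatOp S X Y) :
    T.mat.IsUnitary ↔ Isometry (T.total I) ∧ Function.Surjective (T.total I) := by
  have h1 : T.adj.comp T = id S X ↔ (T.total I).adjoint ∘L T.total I = 1 := by
    rw [adjoint_total, ← total_comp, ← total_id]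
    exact ⟨fun h => h ▸ rfl, total_injective hI⟩
  have h2 : T.comp T.adj = id S Y ↔ T.total I ∘L (T.total I).adjoint = 1 := by
    rw [adjoint_total, ← total_comp, ← total_id]
    exact ⟨fun h => h ▸ rfl, total_injective hI⟩
  rw [isUnitary_mat_iff, h1, h2, ← ContinuousLinearMap.norm_map_iff_adjoint_comp_self,
    AddMonoidHomClass.isometry_iff_norm]
  refine and_congr_right fun h => ⟨fun h' y => ⟨_, DFunLike.congr_fun h' y⟩, fun h' => ?_⟩
  refine ContinuousLinearMap.ext fun y => ?_
  obtain ⟨x, rfl⟩ := h' y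
  rw [ContinuousLinearMap.norm_map_iff_adjoint_comp_self] at h
  exact congrArg (T.total I) (DFunLike.congr_fun h x)

/-- By Schur's lemma naturality between members of I is automatic. The operators are carried to an
arbitrary γ along a decomposition, which identifies (X, γ) isometrically with a finite direct sum of
spaces (X, i); so the same bound holds for all γ. -/
theorem exists_of_irr (hI : IsIrr I) (f : ∀ i : I, X.HomSpace S i.1 →L[ℂ] Y.HomSpace S i.1)
    {c : ℝ} (hc : ∀ i ξ, ‖f i ξ‖ ≤ c * ‖ξ‖) :
    ∃ T : NatOp S X Y, ∀ (i : I) (ξ : X.HomSpace S i.1), T.op i.1 ξ = f i ξ := by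
  have hf : ∀ {i j : I} (g : i.1 ⟶ j.1) (ξ : X.HomSpace S j.1),
      f i (pre S X g ξ) = pre S Y g (f j ξ) := fun {i j} g ξ => by
    by_cases hg : g = 0
    · have h0 : ∀ {Z : IndObj.{w} C} (ζ : Z.HomSpace S j.1),
          pre S Z (0 : i.1 ⟶ j.1) ζ = 0 := fun ζ => by
        simpa using pre_smul_hom (S := S) (0 : ℂ) (0 : i.1 ⟶ j.1) ζ
      rw [hg, h0, h0, map_zero]
    · obtain rfl := hI.eq_of_hom hg
      obtain ⟨a, rfl, -⟩ := hI.1 _ i.2 g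
      rw [pre_smul_hom, pre_smul_hom, pre_id, pre_id, map_smul]
  let r : ∀ γ, Resolution I γ := fun γ => Classical.choice (hI.nonempty_resolution S γ)
  let op : ∀ γ : C, X.HomSpace S γ →L[ℂ] Y.HomSpace S γ := fun γ =>
    ∑ k, pre S Y (((r γ).u k)†) ∘L f ((r γ).Y k) ∘L pre S X ((r γ).u k)
  have hop : ∀ {γ : C} (ξ : X.HomSpace S γ),
      op γ ξ = ∑ k, pre S Y (((r γ).u k)†) (f ((r γ).Y k) (pre S X ((r γ).u k) ξ)) := fun ξ =>
    sum_apply _ _ _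
  -- The operator at γ is characterized by its compositions with morphisms from members of I, so
  -- naturality for arbitrary morphisms follows by testing on a decomposition.
  have key : ∀ {i : I} {γ : C} (g : i.1 ⟶ γ) (ξ : X.HomSpace S γ),
      pre S Y g (op γ ξ) = f i (pre S X g ξ) := fun {i γ} g ξ => by
    rw [hop, map_sum]
    conv_rhs => rw [← (r γ).sum_pre ξ, map_sum, map_sum]
    refine Finset.sum_congr rfl fun k _ => ?_
    rw [pre_pre, pre_pre, hf]
  refine ⟨⟨op, fun {γ δ} g ξ => ?_, |c|, fun γ => ContinuousLinearMap.opNorm_le_bound _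
    (abs_nonneg c) fun ξ => ?_⟩, fun i ξ => ?_⟩
  · rw [hop]
    conv_rhs => rw [← (r δ).sum_pre (pre S Y g (op γ ξ))]
    refine Finset.sum_congr rfl fun k _ => congrArg _ ?_
    rw [pre_pre, pre_pre, key]
  · refine le_of_sq_le_sq ?_ (mul_nonneg (abs_nonneg c) (norm_nonneg ξ))
    rw [hop, (r γ).norm_sq, mul_pow]
    conv_rhs => rw [← (r γ).sum_pre ξ, (r γ).norm_sq, Finset.mul_sum]
    refine Finset.sum_le_sum fun k _ => ?_
    rw [← mul_pow]
    exact pow_le_pow_left₀ (norm_nonneg _) ((hc _ _).trans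
      (mul_le_mul_of_nonneg_right (le_abs_self c) (norm_nonneg _))) 2
  · have := key (𝟙 i.1) ξ
    rwa [pre_id, pre_id] at this

end NatOp

end

/-! ### Naturality of the correspondence. -/

section

open IndObj.HomSpace StandardSolutions TubeAlgebra

namespace UnitaryHalfBraiding
variable {S : StandardSolutions C} {I : Set C} {X Y : IndObj.{w} C} {σ : UnitaryHalfBraiding X}
  {ρ : UnitaryHalfBraiding Y} {M : RightHilbertModule S I (X.Total S I)}
  {N : RightHilbertModule S I (Y.Total S I)}

theorem isMorphism_mat_iff_irr (hI : IsIrr I) (T : NatOp S X Y) : σ.IsMorphism ρ T.mat ↔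
    ∀ {i j α : I} (V : α.1 ⊗ j.1 ⟶ i.1 ⊗ α.1) (ξ : X.HomSpace S i.1),
      T.op j.1 ((σ.toAction S).act V ξ) = (ρ.toAction S).act V (T.op i.1 ξ) := by
  rw [isMorphism_mat_iff]
  refine ⟨fun h {i j α} V ξ => h V ξ, fun h {a b α} V ξ => ?_⟩
  obtain ⟨r⟩ := hI.nonempty_resolution S a
  obtain ⟨q⟩ := hI.nonempty_resolution S b
  obtain ⟨p⟩ := hI.nonempty_resolution S α
  rw [← AnnularAction.sum_act_conj _ p.isDirectSum.2, ← AnnularAction.sum_act_conj _ p.isDirectSum.2,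
    map_sum]
  refine Finset.sum_congr rfl fun m _ => ?_
  generalize p.u m ▷ b ≫ V ≫ a ◁ (p.u m)† = W
  rw [← q.sum_pre (T.op b _), ← q.sum_pre ((ρ.toAction S).act W _)]
  refine Finset.sum_congr rfl fun l _ => congrArg _ ?_
  rw [← T.op_pre, AnnularAction.pre_act, AnnularAction.pre_act, ← r.sum_pre ξ, map_sum, map_sum,
    map_sum, map_sum]
  refine Finset.sum_congr rfl fun k _ => ?_
  rw [T.op_pre]
  generalize pre S X (r.u k) ξ = ζ
  rw [AnnularAction.act_pre, AnnularAction.act_pre, h]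

theorem Induces.isMorphism_total_iff (hI : IsIrr I) (hM : σ.Induces M) (hN : ρ.Induces N)
    (T : NatOp S X Y) : M.IsMorphism N (T.total I) ↔ σ.IsMorphism ρ T.mat := by
  rw [isMorphism_mat_iff_irr hI]
  constructor
  · intro h i j α V ξ
    refine (Y.incl S I j).injective ?_
    rw [← T.total_incl, ← (σ.induces_iff M).1 hM, h, T.total_incl, (ρ.induces_iff N).1 hN]
  · intro h a ξ
    let F := T.total I
    let f : TubeAlgebra S I →ₗ[ℂ] (X.Total S I →L[ℂ] Y.Total S I) :=
      { toFun := fun a => F ∘L M.act a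
        map_add' := fun a b => by rw [map_add, ContinuousLinearMap.comp_add]
        map_smul' := fun c a => by rw [map_smul, ContinuousLinearMap.comp_smul]; rfl }
    let g : TubeAlgebra S I →ₗ[ℂ] (X.Total S I →L[ℂ] Y.Total S I) :=
      { toFun := fun a => N.act a ∘L F
        map_add' := fun a b => by rw [map_add, ContinuousLinearMap.add_comp]
        map_smul' := fun c a => by rw [map_smul, ContinuousLinearMap.smul_comp]; rfl }
    have hfg : f = g := RightHilbertModule.act_induction fun i j α V =>
      IndObj.total_ext fun i' ξ => by
        change T.total I (M.act (of S i j α V) (X.incl S I i' ξ)) =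
          N.act (of S i j α V) (T.total I (X.incl S I i' ξ))
        rw [T.total_incl]
        by_cases hi : i' = i
        · subst hi
          rw [(σ.induces_iff M).1 hM, (ρ.induces_iff N).1 hN, T.total_incl, h]
        · rw [hM.act_of_of_ne hI hi, hN.act_of_of_ne hI hi, map_zero]
    exact DFunLike.congr_fun (LinearMap.congr_fun hfg a) ξ

/-- A module map commutes with p_i, hence sends (X, i) into (Y, i). Its restrictions are bounded by
‖F‖ for every i, so they come from a natural family. -/
theorem Induces.exists_natOp (hI : IsIrr I) (hM : σ.Induces M) (hN : ρ.Induces N)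
    {F : X.Total S I →L[ℂ] Y.Total S I} (hF : M.IsMorphism N F) :
    ∃ T : NatOp S X Y, T.total I = F := by
  -- By uniqueness N is the module constructed from ρ, in which p_i acts as the orthogonal
  -- projection onto (Y, i).
  have hN' : N = (ρ.toAction S).toModule hI := hN.unique hI (ρ.induces_toModule hI)
  have hb : ∀ (i : I) (ξ : X.HomSpace S i.1),
      ‖(IndObj.proj S I Y i ∘L F ∘L (X.incl S I i).toContinuousLinearMap) ξ‖ ≤ ‖F‖ * ‖ξ‖ := by
    intro i ξ
    have h1 : ‖IndObj.proj S I Y i (F (X.incl S I i ξ))‖ = ‖F (X.incl S I i ξ)‖ := by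
      rw [← (Y.incl S I i).norm_map, ← (ρ.toAction S).toModule_act_proj hI, ← hN',
        ← hF, hM.act_proj hI]
    refine h1.le.trans ((F.le_opNorm _).trans ?_)
    rw [LinearIsometry.norm_map]
  obtain ⟨T, hT⟩ := NatOp.exists_of_irr hI _ hb
  refine ⟨T, IndObj.total_ext fun i ξ => ?_⟩
  rw [T.total_incl, hT]
  change Y.incl S I i (IndObj.proj S I Y i (F (X.incl S I i ξ))) = F (X.incl S I i ξ)
  conv_rhs => rw [← hM.act_proj hI, hF, hN', AnnularAction.toModule_act_proj]

end UnitaryHalfBraiding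

end

end

end TubeRep

theorem proposition3p13 {C : Type u} [CategoryTheory.Category.{v} C]
    [CategoryTheory.Preadditive C] [CategoryTheory.Linear ℂ C]
    [CategoryTheory.MonoidalCategory C] [CategoryTheory.MonoidalPreadditive C]
    [CategoryTheory.MonoidalLinear ℂ C] [TubeRep.RigidCStarTensorCategory C]
    (S : TubeRep.StandardSolutions C) (I : Set C) (hI : TubeRep.IsIrr I) :
    -- from half braidings to modules
    (∀ (X : TubeRep.IndObj.{w'} C) (σ : TubeRep.UnitaryHalfBraiding X),
      ∃ M : TubeRep.RightHilbertModule S I (X.Total S I),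
        σ.Induces M ∧ (∀ M' : TubeRep.RightHilbertModule S I (X.Total S I),
          σ.Induces M' → M' = M) ∧
        M.Nondegenerate ∧ M.IsRealizedBy (X.incl S I)) ∧
    -- from modules to half braidings
    (∀ (K : Type w) [NormedAddCommGroup K] [InnerProductSpace ℂ K] [CompleteSpace K]
      (M : TubeRep.RightHilbertModule S I K), M.Nondegenerate →
        (∃ (X : TubeRep.IndObj.{w} C) (φ : ∀ i : I, X.HomSpace S i.1 →ₗᵢ[ℂ] K),
          M.IsRealizedBy φ) ∧
        (∀ (X : TubeRep.IndObj.{w'} C) (φ : ∀ i : I, X.HomSpace S i.1 →ₗᵢ[ℂ] K),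
          M.IsRealizedBy φ → ∃! σ : TubeRep.UnitaryHalfBraiding X, M.Determines φ σ)) ∧
    -- the two constructions are mutually inverse
    (∀ (X : TubeRep.IndObj.{w'} C) (σ : TubeRep.UnitaryHalfBraiding X)
      (M : TubeRep.RightHilbertModule S I (X.Total S I)),
        σ.Induces M → M.Determines (X.incl S I) σ) ∧
    (∀ (K : Type w) [NormedAddCommGroup K] [InnerProductSpace ℂ K] [CompleteSpace K]
      (M : TubeRep.RightHilbertModule S I K), M.Nondegenerate →
        ∀ (X : TubeRep.IndObj.{w'} C) (φ : ∀ i : I, X.HomSpace S i.1 →ₗᵢ[ℂ] K),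
          M.IsRealizedBy φ → ∀ σ : TubeRep.UnitaryHalfBraiding X, M.Determines φ σ →
            ∀ M' : TubeRep.RightHilbertModule S I (X.Total S I), σ.Induces M' →
              ∃ U : X.Total S I ≃ₗᵢ[ℂ] K,
                (∀ (i : I) (ξ : X.HomSpace S i.1), U (X.incl S I i ξ) = φ i ξ) ∧
                ∀ (a : TubeRep.TubeAlgebra S I) (ξ : X.Total S I),
                  U (M'.act a ξ) = M.act a (U ξ)) ∧
    -- naturality, and compatibility with unitary equivalence
    (∀ (X Y : TubeRep.IndObj.{w'} C) (σ : TubeRep.UnitaryHalfBraiding X)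
      (ρ : TubeRep.UnitaryHalfBraiding Y) (M : TubeRep.RightHilbertModule S I (X.Total S I))
      (N : TubeRep.RightHilbertModule S I (Y.Total S I)), σ.Induces M → ρ.Induces N →
        (∀ T : TubeRep.IndMat X Y, σ.IsMorphism ρ T →
          ∃! F : X.Total S I →L[ℂ] Y.Total S I, M.IsMorphism N F ∧ T.Implements F) ∧
        (∀ F : X.Total S I →L[ℂ] Y.Total S I, M.IsMorphism N F →
          ∃! T : TubeRep.IndMat X Y, σ.IsMorphism ρ T ∧ T.Implements F) ∧
        (∀ (T : TubeRep.IndMat X Y) (F : X.Total S I →L[ℂ] Y.Total S I),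
          σ.IsMorphism ρ T → T.Implements F →
            (T.IsUnitary ↔ Isometry F ∧ Function.Surjective F))) := by
  refine ⟨fun X σ => ?_, fun K _ _ _ M hM => ?_, fun X σ M h => ?_, fun K _ _ _ M hM X φ hφ σ hσ M' hM' => ?_,
    fun X Y σ ρ M N hM hN => ⟨fun T hT => ?_, fun F hF => ?_, fun T F hT hF => ?_⟩⟩
  · exact ⟨(σ.toAction S).toModule hI, σ.induces_toModule hI,
      fun M' h => h.unique hI (σ.induces_toModule hI),
      (σ.toAction S).toModule_nondegenerate hI, (σ.toAction S).toModule_isRealizedBy hI⟩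
  · exact ⟨M.exists_isRealizedBy hI, fun X φ hφ => hφ.existsUnique_determines hI⟩
  · exact h.determines
  · exact hσ.exists_linearIsometryEquiv hI hM hφ hM'
  · obtain ⟨P, rfl⟩ := hT.1.exists_natOp S
    exact ⟨P.total I, ⟨(hM.isMorphism_total_iff hI hN P).2 hT, P.implements_mat_iff.2 rfl⟩,
      fun F hF => P.implements_mat_iff.1 hF.2⟩
  · obtain ⟨P, rfl⟩ := hM.exists_natOp hI hN hF
    refine ⟨P.mat, ⟨(hM.isMorphism_total_iff hI hN P).1 hF, P.implements_mat_iff.2 rfl⟩,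
      fun T hT => ?_⟩
    -- Any competing T is bounded, hence the matrix of a natural family, and a natural family is
    -- determined by its operator on the direct sum.
    obtain ⟨Q, rfl⟩ := hT.1.1.exists_natOp S
    rw [TubeRep.NatOp.total_injective hI (Q.implements_mat_iff.1 hT.2)]
  · obtain ⟨P, rfl⟩ := hT.1.exists_natOp S
    rw [P.implements_mat_iff.1 hF]
    exact P.isUnitary_mat_iff_total hI
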